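/- Work with monochromatic symmetric operads in simplicial sets (with operations in every arity $n\ge 0$). Give simplicial sets the Kan model structure; a map of operads is a weak equivalence (resp. fibration) if it is a Kan weak equivalence (resp. Kan fibration) in every arity, and a cofibration if it has the left lifting property with respect to the maps that are both fibrations and weak equivalences. Let $\varnothing$ be the operad with $\varnothing(1)=\{\mathrm{id}\}$ and $\varnothing(n)=\varnothing$ for $n\neq 1$; let $\varnothing_+$ be the operad with $\varnothing_+(0)=*$, $\varnothing_+(1)=\{\mathrm{id}\}$ and $\varnothing_+(n)=\varnothing$ for $n>1$; let $i:\varnothing\to\varnothing_+$ be the inclusion; and let $\mathrm{Com}$ be the commutative operad, $\mathrm{Com}(n)=*$ for all $n\ge 0$. An $E_\infty$-operad is an operad $A$ such that, for every $n\ge 0$, $A(n)$ is weakly contractible and $\Sigma_n$ acts freely on it. Then: 1. $\varnothing$ is the initial operad, and $i$ is a cofibration. 2. For every operad $A$ the pushout $A_+$ of $i$ along $\varnothing\to A$ exists, the map $\eta:A\to A_+$ is a cofibration, and there is an isomorphism $\coprod_{j\ge 0}A(j)/\Sigma_j\cong A_+(0)$ sending $[a]$, for $a\in A(j)$, to $\gamma(\eta(a);*,\dots,*)$,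 where $*$ is the point added in arity $0$. 3. $E_\infty$-operads exist. If $A$ is any $E_\infty$-operad, then the unique map $f:A\to\mathrm{Com}$ is a weak equivalence. If $f_+:A_+\to\mathrm{Com}_+$ is the pushout of $f$ along $\eta:A\to A_+$, then in arity $0$ the map $f_+$ is, up to weak equivalence, the map $\coprod_{j\ge0}B\Sigma_j\to\coprod_{j\ge0}*$: there are a weak equivalence $w:A_+(0)\to\coprod_j B\Sigma_j$, with $B\Sigma_j$ the nerve of $\Sigma_j$, and an isomorphism $e:\mathrm{Com}_+(0)\cong\coprod_j *$ such that $e\circ f_+(0)$ is the composite of $w$ with the coproduct of the maps $B\Sigma_j\to *$. The map $f_+(0)$ is not a weak equivalence, and hence $f_+$ is not a weak equivalence. 4. Consequently the category of monochromatic simplicial operads is not left proper: weak equivalences are not closed under cobase change along cofibrations. -/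

import Mathlib

open CategoryTheory Limits HomotopicalAlgebra

/-! ### Homotopy classes and Kan weak equivalences of simplicial sets -/

/-- The set `[X, K]` of homotopy classes of maps of simplicial sets: the quotient of `X ⟶ K` by the
equivalence relation generated by simplicial homotopy. -/
def SSet.HoClass (X K : SSet.{0}) : Type :=
  Quot (fun f g : X ⟶ K => Nonempty (SSet.Homotopy f g))

/-- Precomposition with `f : X ⟶ Y` on homotopy classes, `[Y, K] → [X, K]`. -/
def SSet.HoClass.precomp {X Y : SSet.{0}} (f : X ⟶ Y) (K : SSet.{0}) :
    SSet.HoClass Y K → SSet.HoClass X K :=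
  Quot.map (fun g => f ≫ g) (fun _ _ ⟨H⟩ =>
    ⟨H.precomp (f := SSet.RelativeMorphism.botEquiv.symm f) (by ext n ⟨_, h⟩; exact h.elim)⟩)

/-- A map `f : X ⟶ Y` of simplicial sets is a weak equivalence (for the Kan model structure) if
`[Y, K] → [X, K]` is bijective for every Kan complex `K`. -/
def SSet.IsKanWeakEquivalence {X Y : SSet.{0}} (f : X ⟶ Y) : Prop :=
  ∀ K : SSet.{0}, SSet.KanComplex K → Function.Bijective (SSet.HoClass.precomp f K)

/-- The one-point simplicial set. -/
abbrev SSet.point : SSet.{0} := (Functor.const SimplexCategoryᵒᵖ).obj PUnit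

/-- The unique map to the one-point simplicial set. -/
def SSet.toPoint (X : SSet.{0}) : X ⟶ SSet.point where
  app _ := TypeCat.ofHom fun _ => PUnit.unit

/-- A simplicial set is weakly contractible if its map to the point is a weak equivalence. -/
def SSet.IsWeaklyContractible (X : SSet.{0}) : Prop :=
  SSet.IsKanWeakEquivalence X.toPoint

/-- The classifying space `BG` of a group: the nerve of `G`, seen as a category with one object. -/
abbrev SSet.classifyingSpace (G : Type) [Group G] : SSet.{0} := nerve (SingleObj G)

/-! ### Bijections between finite sets used in the operad axioms

The set `Fin (∑ i, b i)` consists of consecutive blocks of sizes `b 0`, `b 1`, ...;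
`finSigmaFinEquiv` sends `⟨i, j⟩` to the `j`-th element of the `i`-th block. -/

namespace OperadBijections

/-- The bijection acting by `τ i : Fin (b i) ≃ Fin (c i)` on the `i`-th block. -/
def blockSum {m : ℕ} {b c : Fin m → ℕ} (τ : ∀ i, Fin (b i) ≃ Fin (c i)) :
    Fin (∑ i, b i) ≃ Fin (∑ i, c i) :=
  finSigmaFinEquiv.symm.trans ((Equiv.sigmaCongrRight τ).trans finSigmaFinEquiv)

/-- The block permutation: for `σ : Fin m ≃ Fin n`, the `i`-th block, of size `c (σ i)`,
is sent identically onto the `σ i`-th block. -/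
def blockPerm {m n : ℕ} (σ : Fin m ≃ Fin n) (c : Fin n → ℕ) :
    Fin (∑ i, c (σ i)) ≃ Fin (∑ i, c i) :=
  finSigmaFinEquiv.symm.trans
    ((Equiv.sigmaCongrLeft (β := fun i => Fin (c i)) σ).trans finSigmaFinEquiv)

/-- The identification of `Fin (∑ l, c l)`, with `l` in `Fin (∑ i, b i)`, with the iterated sum:
`⟨⟨i, j⟩, k⟩` corresponds to `⟨i, ⟨j, k⟩⟩`. -/
def assoc {m : ℕ} (b : Fin m → ℕ) (c : Fin (∑ i, b i) → ℕ) :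
    Fin (∑ l, c l) ≃ Fin (∑ i, ∑ j, c (finSigmaFinEquiv ⟨i, j⟩)) :=
  finSigmaFinEquiv.symm.trans
    ((Equiv.sigmaCongrLeft (β := fun l => Fin (c l)) finSigmaFinEquiv).symm.trans
      ((Equiv.sigmaAssoc fun i j => Fin (c (finSigmaFinEquiv ⟨i, j⟩))).trans
        ((Equiv.sigmaCongrRight fun _ => finSigmaFinEquiv).trans finSigmaFinEquiv)))

/-- One block of size `n`. -/
def unitLeft (n : ℕ) : Fin (∑ _ : Fin 1, n) ≃ Fin n := finCongr (by simp)

/-- `m` blocks of size one. -/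
def unitRight (m : ℕ) : Fin (∑ _ : Fin m, 1) ≃ Fin m := finCongr (by simp)

/-- `m` empty blocks. -/
def zero (m : ℕ) : Fin (∑ _ : Fin m, 0) ≃ Fin 0 := finCongr (by simp)

end OperadBijections

open OperadBijections in
/-- A monochromatic symmetric operad in simplicial sets. The symmetric sequence is given as a
functor from the groupoid of the sets `Fin n` and their bijections (so `act` restricts to a left
action of the symmetric group on `obj n`, and carries no other information). The composition
`O(m) × ∏ i, O(b i) ⟶ O(∑ i, b i)` is given degreewise, as a natural family of functions. -/
structure SimplicialOperad where
  /-- the simplicial set of `n`-ary operations -/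
  obj : ℕ → SSet.{0}
  /-- relabelling of the inputs: the input `i` of `x` becomes the input `σ i` of `act σ x` -/
  act : ∀ {m n : ℕ}, (Fin m ≃ Fin n) → (obj m ⟶ obj n)
  /-- the unit -/
  one : ∀ k, (obj 1).obj k
  /-- operadic composition `γ(x; y₁, …, yₘ)` -/
  comp : ∀ {k : SimplexCategoryᵒᵖ} {m : ℕ} {b : Fin m → ℕ},
    (obj m).obj k → (∀ i, (obj (b i)).obj k) → (obj (∑ i, b i)).obj k
  act_refl : ∀ n, act (Equiv.refl (Fin n)) = 𝟙 (obj n)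
  act_trans : ∀ {l m n : ℕ} (σ : Fin l ≃ Fin m) (τ : Fin m ≃ Fin n),
    act (σ.trans τ) = act σ ≫ act τ
  map_one : ∀ {k l : SimplexCategoryᵒᵖ} (φ : k ⟶ l), (obj 1).map φ (one k) = one l
  map_comp : ∀ {k l : SimplexCategoryᵒᵖ} (φ : k ⟶ l) {m : ℕ} {b : Fin m → ℕ}
    (x : (obj m).obj k) (y : ∀ i, (obj (b i)).obj k),
    (obj (∑ i, b i)).map φ (comp x y) = comp ((obj m).map φ x) (fun i => (obj (b i)).map φ (y i))
  one_comp : ∀ {k : SimplexCategoryᵒᵖ} {n : ℕ} (y : (obj n).obj k),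
    (act (unitLeft n)).app k (comp (one k) (fun _ => y)) = y
  comp_one : ∀ {k : SimplexCategoryᵒᵖ} {m : ℕ} (x : (obj m).obj k),
    (act (unitRight m)).app k (comp x (fun _ => one k)) = x
  comp_assoc : ∀ {k : SimplexCategoryᵒᵖ} {m : ℕ} {b : Fin m → ℕ} {c : Fin (∑ i, b i) → ℕ}
    (x : (obj m).obj k) (y : ∀ i, (obj (b i)).obj k) (z : ∀ l, (obj (c l)).obj k),
    (act (assoc b c)).app k (comp (comp x y) z) =
      comp x (fun i => comp (y i) (fun j => z (finSigmaFinEquiv ⟨i, j⟩)))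
  comp_act_right : ∀ {k : SimplexCategoryᵒᵖ} {m : ℕ} {b c : Fin m → ℕ}
    (τ : ∀ i, Fin (b i) ≃ Fin (c i)) (x : (obj m).obj k) (y : ∀ i, (obj (b i)).obj k),
    comp x (fun i => (act (τ i)).app k (y i)) = (act (blockSum τ)).app k (comp x y)
  comp_act_left : ∀ {k : SimplexCategoryᵒᵖ} {m n : ℕ} {c : Fin n → ℕ}
    (σ : Fin m ≃ Fin n) (x : (obj m).obj k) (y : ∀ i, (obj (c i)).obj k),
    comp ((act σ).app k x) y = (act (blockPerm σ c)).app k (comp x (fun i => y (σ i)))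

namespace SimplicialOperad

/-- Morphisms of operads. -/
@[ext]
structure Hom (A B : SimplicialOperad) where
  app : ∀ n, A.obj n ⟶ B.obj n
  app_act : ∀ {m n : ℕ} (σ : Fin m ≃ Fin n), A.act σ ≫ app n = app m ≫ B.act σ
  app_one : ∀ k, (app 1).app k (A.one k) = B.one k
  app_comp : ∀ {k : SimplexCategoryᵒᵖ} {m : ℕ} {b : Fin m → ℕ}
    (x : (A.obj m).obj k) (y : ∀ i, (A.obj (b i)).obj k),
    (app (∑ i, b i)).app k (A.comp x y) =
      B.comp ((app m).app k x) (fun i => (app (b i)).app k (y i))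

instance : Category SimplicialOperad where
  Hom := Hom
  id A :=
    { app := fun n => 𝟙 (A.obj n)
      app_act := by simp
      app_one := by simp
      app_comp := by simp }
  comp f g :=
    { app := fun n => f.app n ≫ g.app n
      app_act := fun σ => by
        rw [← Category.assoc, f.app_act, Category.assoc, g.app_act, Category.assoc]
      app_one := fun k => by simp [f.app_one, g.app_one]
      app_comp := fun x y => by simp [f.app_comp, g.app_comp] }

/-! ### The model structure

Weak equivalences and fibrations are defined in each arity; cofibrations are the maps with the left
lifting property with respect to trivial fibrations. -/

instance : CategoryWithWeakEquivalences SimplicialOperad where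
  weakEquivalences _ _ f := ∀ n, SSet.IsKanWeakEquivalence (Hom.app f n)

/-- `J` is the class of all horn inclusions, so `J.rlp` is the class of Kan fibrations. -/
instance : CategoryWithFibrations SimplicialOperad where
  fibrations _ _ f := ∀ n, SSet.modelCategoryQuillen.J.rlp (Hom.app f n)

instance : CategoryWithCofibrations SimplicialOperad where
  cofibrations := (trivialFibrations SimplicialOperad).llp

/-! ### The operads `∅`, `∅₊` and the commutative operad -/

/-- The operad having exactly one operation in each arity `n` satisfying `S n`, and none in the
other arities; here `S` has to contain `1` and to be closed under operadic composition. -/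
def ofArities (S : ℕ → Prop) (h₁ : S 1)
    (hS : ∀ {m : ℕ} {b : Fin m → ℕ}, S m → (∀ i, S (b i)) → S (∑ i, b i)) :
    SimplicialOperad where
  obj n := (Functor.const SimplexCategoryᵒᵖ).obj (PLift (S n))
  act {m n} σ := (Functor.const SimplexCategoryᵒᵖ).map (TypeCat.ofHom fun x =>
    ⟨(Fin.equiv_iff_eq.1 ⟨σ⟩ : m = n) ▸ x.down⟩)
  one _ := ⟨h₁⟩
  comp x y := ⟨hS x.down fun i => (y i).down⟩
  act_refl _ := rfl
  act_trans _ _ := rfl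
  map_one _ := rfl
  map_comp _ _ _ _ _ := rfl
  one_comp _ := rfl
  comp_one _ := rfl
  comp_assoc _ _ _ := rfl
  comp_act_right _ _ _ := rfl
  comp_act_left _ _ _ := rfl

/-- The operad `∅`, consisting of the identity in arity `1` only. -/
def empty : SimplicialOperad :=
  ofArities (fun n => n = 1) rfl (by rintro m b rfl hb; simp [hb])

/-- The operad `∅₊`, with a point in arity `0`, the identity in arity `1`, and nothing else. -/
def emptyPlus : SimplicialOperad :=
  ofArities (fun n => n ≤ 1) le_rfl (fun {m b} hm hb =>
    (Finset.sum_le_sum fun i _ => hb i).trans (by simpa using hm))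

/-- The commutative operad, with a point in every arity. -/
def comm : SimplicialOperad :=
  ofArities (fun _ => True) trivial (fun _ _ => trivial)

/-- The inclusion `∅ ⟶ ∅₊`. -/
def inclusion : empty ⟶ emptyPlus where
  app _ := (Functor.const SimplexCategoryᵒᵖ).map (TypeCat.ofHom fun x => ⟨x.down.le⟩)
  app_act _ := rfl
  app_one _ := rfl
  app_comp _ _ := rfl

/-- The unique morphism from an operad to the commutative operad. -/
def toComm (A : SimplicialOperad) : A ⟶ comm where
  app _ := { app := fun _ => TypeCat.ofHom fun _ => ⟨trivial⟩ }
  app_act _ := rfl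
  app_one _ := rfl
  app_comp _ _ := rfl

/-- The extra point of `∅₊`, of arity `0`, as a (degenerate) simplex of each dimension. -/
def emptyPlusPoint (k : SimplexCategoryᵒᵖ) : (emptyPlus.obj 0).obj k := ⟨zero_le_one⟩

/-! ### Orbits and `E∞`-operads -/

/-- The quotient `A(j)/Σⱼ` of the simplicial set of `j`-ary operations by the symmetric group. -/
def orbits (A : SimplicialOperad) (j : ℕ) : SSet.{0} where
  obj k := Quot (fun x y : (A.obj j).obj k => ∃ σ : Equiv.Perm (Fin j), (A.act σ).app k x = y)
  map φ := TypeCat.ofHom (Quot.map ((A.obj j).map φ) (by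
    rintro x _ ⟨σ, rfl⟩
    exact ⟨σ, by simp [NatTrans.naturality_apply]⟩))
  map_id k := by
    ext x
    induction x using Quot.ind
    simp [Quot.map]
  map_comp φ ψ := by
    ext x
    induction x using Quot.ind
    simp [Quot.map]

/-- An `E∞`-operad: every simplicial set `A(n)` is weakly contractible and the symmetric group
acts freely on it (so that `A(n)` is an `EΣₙ`). -/
structure IsEInfinity (A : SimplicialOperad) : Prop where
  contractible : ∀ n, (A.obj n).IsWeaklyContractible
  free : ∀ (n : ℕ) (k : SimplexCategoryᵒᵖ) (σ : Equiv.Perm (Fin n)) (x : (A.obj n).obj k),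
    (A.act σ).app k x = x → σ = 1

end SimplicialOperad

/-- Left properness: weak equivalences are closed under cobase change along cofibrations. -/
def IsLeftProper (C : Type*) [Category C] [CategoryWithCofibrations C]
    [CategoryWithWeakEquivalences C] : Prop :=
  ∀ ⦃X Y Z W : C⦄ (i : X ⟶ Y) (f : X ⟶ Z) (g : Y ⟶ W) (j : Z ⟶ W),
    IsPushout i f g j → Cofibration i → WeakEquivalence f → WeakEquivalence g

/-! ### Operads in sets, and operads of linear elements of a monad -/

namespace OperadBijections

/-! The pushout `A₊` is `A` with a nullary operation `*` freely added, and it is written down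
explicitly, one simplicial degree at a time. An operad in sets is recovered from its free algebra
monad as the operad of linear elements, those in which every variable occurs exactly once
(`SetOperad.Free.ofOp_bijective`). Algebras over `A₊` are `A`-algebras with a chosen point, and the
free one on `X` is the free `A`-algebra on `X ⊔ {*}`. So `A₊` is defined as the operad of elements
linear in `X`, with `*` allowed any number of times. The operad axioms then reduce to the monad
laws. In arity `0` every label is `*`, so only an operation up to permutation of its inputs remains:
`A₊(0) = ∐ A(j)/Σⱼ` (`plusZeroIsColimit`).

A map `∅₊ ⟶ B` is a vertex of `B(0)`, and maps out of `∅` are unique. Hence `i` is a cofibration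
because trivial fibrations are surjective on vertices (`SSet.surjective_vertices`), and `A ⟶ A₊` is
one by cobase change.

Pasting pushouts shows that the cobase change of `A ⟶ Com` is `∐ A(j)/Σⱼ ⟶ ∐ *` in arity `0`. For an
`E∞`-operad, `A(j)/Σⱼ` is weakly equivalent to `BΣⱼ`. This is `SSet.isKanWeakEquivalence_of_free`,
proved directly on homotopy classes of maps to a Kan complex `K`. The constant maps `K ⟶ K^A` form a
deformation retract, so their mapping path fibration is a trivial fibration
(`SSet.rlp_mappingPathStart`). It is equivariant, and free `G`-objects lift against it equivariantly
(`SSet.exists_equivariant_lift`). This turns an equivariant map `EG ⟶ K^A` into an invariant map `EG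
⟶ K`, that is, a map `BG ⟶ K`, in a way that is unique up to homotopy.

Finally `BΣ₂` does not contract to a point (`SSet.eq_one_of_homotopic_const`), so `∐ BΣⱼ ⟶ ∐ *` is
no weak equivalence. The Barratt–Eccles operad is an `E∞`-operad, which makes the failure of left
properness unconditional. -/

lemma blockSum_apply {m : ℕ} {b c : Fin m → ℕ} (τ : ∀ i, Fin (b i) ≃ Fin (c i)) (i : Fin m)
    (j : Fin (b i)) :
    blockSum τ (finSigmaFinEquiv ⟨i, j⟩) = finSigmaFinEquiv ⟨i, τ i j⟩ := by
  simp [blockSum]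

lemma blockPerm_apply {m n : ℕ} (σ : Fin m ≃ Fin n) (c : Fin n → ℕ) (i : Fin m)
    (j : Fin (c (σ i))) :
    blockPerm σ c (finSigmaFinEquiv ⟨i, j⟩) = finSigmaFinEquiv ⟨σ i, j⟩ := by
  simp [blockPerm, Equiv.sigmaCongrLeft]

lemma assoc_apply {m : ℕ} (b : Fin m → ℕ) (c : Fin (∑ i, b i) → ℕ) (i : Fin m) (j : Fin (b i))
    (l : Fin (c (finSigmaFinEquiv ⟨i, j⟩))) :
    assoc b c (finSigmaFinEquiv ⟨finSigmaFinEquiv ⟨i, j⟩, l⟩) =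
      finSigmaFinEquiv ⟨i, finSigmaFinEquiv ⟨j, l⟩⟩ := by
  have h : (Equiv.sigmaCongrLeft (β := fun l => Fin (c l)) finSigmaFinEquiv).symm
      ⟨finSigmaFinEquiv ⟨i, j⟩, l⟩ = ⟨⟨i, j⟩, l⟩ := by
    rw [Equiv.symm_apply_eq]; rfl
  simp only [assoc, Equiv.trans_apply, Equiv.symm_apply_apply, h]
  rfl

lemma unitLeft_apply (n : ℕ) (i : Fin 1) (j : Fin n) :
    unitLeft n (finSigmaFinEquiv (n := fun _ : Fin 1 => n) ⟨i, j⟩) = j := by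
  apply Fin.ext
  simp [unitLeft]

lemma unitRight_apply (m : ℕ) (i : Fin m) (j : Fin 1) :
    unitRight m (finSigmaFinEquiv (n := fun _ : Fin m => 1) ⟨i, j⟩) = i := by
  apply Fin.ext
  simp [unitRight, finSigmaFinEquiv_apply]

/-- The block decomposition of `Fin (∑ i, b i)` at the level of multisets. It is what makes linear
elements closed under substitution, and labels compatible with it. -/
lemma bind_univ_map_finSigmaFinEquiv {m : ℕ} (b : Fin m → ℕ) :
    (Finset.univ : Finset (Fin m)).val.bind (fun i =>
      (Finset.univ : Finset (Fin (b i))).val.map fun j => finSigmaFinEquiv ⟨i, j⟩) =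
      (Finset.univ : Finset (Fin (∑ i, b i))).val := by
  symm
  refine Multiset.eq_of_le_of_card_le
    ((Multiset.le_iff_subset Finset.univ.nodup).2 fun p _ => ?_) ?_
  · obtain ⟨⟨i, j⟩, rfl⟩ := finSigmaFinEquiv.surjective p
    simp only [Multiset.mem_bind, Multiset.mem_map]
    exact ⟨i, Finset.mem_univ_val i, j, Finset.mem_univ_val j, rfl⟩
  · simp [Multiset.card_bind, List.sum_ofFn]

end OperadBijections

section OperadsInSets

open OperadBijections

/-- A symmetric operad in sets. -/
structure SetOperad where
  obj : ℕ → Type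
  act : ∀ {m n : ℕ}, (Fin m ≃ Fin n) → obj m → obj n
  one : obj 1
  comp : ∀ {m : ℕ} {b : Fin m → ℕ}, obj m → (∀ i, obj (b i)) → obj (∑ i, b i)
  act_refl : ∀ {n} (x : obj n), act (Equiv.refl (Fin n)) x = x
  act_trans : ∀ {l m n : ℕ} (σ : Fin l ≃ Fin m) (τ : Fin m ≃ Fin n) (x : obj l),
    act (σ.trans τ) x = act τ (act σ x)
  one_comp : ∀ {n : ℕ} (y : obj n), act (unitLeft n) (comp one (fun _ => y)) = y
  comp_one : ∀ {m : ℕ} (x : obj m), act (unitRight m) (comp x (fun _ => one)) = x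
  comp_assoc : ∀ {m : ℕ} {b : Fin m → ℕ} {c : Fin (∑ i, b i) → ℕ}
    (x : obj m) (y : ∀ i, obj (b i)) (z : ∀ l, obj (c l)),
    act (assoc b c) (comp (comp x y) z) =
      comp x (fun i => comp (y i) (fun j => z (finSigmaFinEquiv ⟨i, j⟩)))
  comp_act_right : ∀ {m : ℕ} {b c : Fin m → ℕ}
    (τ : ∀ i, Fin (b i) ≃ Fin (c i)) (x : obj m) (y : ∀ i, obj (b i)),
    comp x (fun i => act (τ i) (y i)) = act (blockSum τ) (comp x y)
  comp_act_left : ∀ {m n : ℕ} {c : Fin n → ℕ}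
    (σ : Fin m ≃ Fin n) (x : obj m) (y : ∀ i, obj (c i)),
    comp (act σ x) y = act (blockPerm σ c) (comp x (fun i => y (σ i)))

namespace SetOperad

/-- Morphisms of operads in sets. -/
structure Hom (O P : SetOperad) where
  app : ∀ n, O.obj n → P.obj n
  app_act : ∀ {m n : ℕ} (σ : Fin m ≃ Fin n) (x : O.obj m), app n (O.act σ x) = P.act σ (app m x)
  app_one : app 1 O.one = P.one
  app_comp : ∀ {m : ℕ} {b : Fin m → ℕ} (x : O.obj m) (y : ∀ i, O.obj (b i)),
    app (∑ i, b i) (O.comp x y) = P.comp (app m x) (fun i => app (b i) (y i))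

/-- The composition of morphisms of operads in sets. -/
def Hom.trans {O P Q : SetOperad} (f : Hom O P) (g : Hom P Q) : Hom O Q where
  app n x := g.app n (f.app n x)
  app_act σ x := by rw [f.app_act, g.app_act]
  app_one := by rw [f.app_one, g.app_one]
  app_comp x y := by rw [f.app_comp, g.app_comp]

/-- The inverse of a bijective morphism of operads in sets. -/
noncomputable def Hom.inverse {O P : SetOperad} (f : Hom O P)
    (hf : ∀ n, Function.Bijective (f.app n)) : Hom P O where
  app n := (Equiv.ofBijective _ (hf n)).symm
  app_act {m n} σ x := by
    obtain ⟨x, rfl⟩ := (hf m).2 x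
    rw [← f.app_act, Equiv.ofBijective_symm_apply_apply, Equiv.ofBijective_symm_apply_apply]
  app_one := by rw [← f.app_one, Equiv.ofBijective_symm_apply_apply]
  app_comp {m b} x y := by
    obtain ⟨x, rfl⟩ := (hf m).2 x
    choose z hz using fun i => (hf (b i)).2 (y i)
    obtain rfl : (fun i => f.app _ (z i)) = y := funext hz
    rw [← f.app_comp, Equiv.ofBijective_symm_apply_apply, Equiv.ofBijective_symm_apply_apply]
    simp only [Equiv.ofBijective_symm_apply_apply]

lemma Hom.app_inverse {O P : SetOperad} (f : Hom O P)
    (hf : ∀ n, Function.Bijective (f.app n)) {n : ℕ} (x : P.obj n) :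
    f.app n ((f.inverse hf).app n x) = x :=
  Equiv.ofBijective_apply_symm_apply _ (hf n) x

lemma act_injective (O : SetOperad) {m n : ℕ} (σ : Fin m ≃ Fin n) :
    Function.Injective (O.act σ) := fun x y h => by
  have := congrArg (O.act σ.symm) h
  rwa [← act_trans, ← act_trans, Equiv.self_trans_symm, act_refl, act_refl] at this

end SetOperad

namespace SimplicialOperad

/-- The operad of `k`-simplices. -/
def level (A : SimplicialOperad) (k : SimplexCategoryᵒᵖ) : SetOperad where
  obj n := (A.obj n).obj k
  act σ := (A.act σ).app k
  one := A.one k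
  comp := A.comp
  act_refl x := by rw [A.act_refl]; rfl
  act_trans σ τ x := by rw [A.act_trans]; rfl
  one_comp := A.one_comp
  comp_one := A.comp_one
  comp_assoc := A.comp_assoc
  comp_act_right := A.comp_act_right
  comp_act_left := A.comp_act_left

/-- The simplicial structure maps of an operad, as morphisms of operads in sets. -/
def levelMap (A : SimplicialOperad) {k l : SimplexCategoryᵒᵖ} (φ : k ⟶ l) :
    (A.level k).Hom (A.level l) where
  app n := (A.obj n).map φ
  app_act σ x := (NatTrans.naturality_apply (A.act σ) φ x).symm
  app_one := A.map_one φ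
  app_comp := A.map_comp φ

/-- A morphism of simplicial operads, restricted to the `k`-simplices. -/
def Hom.level {A B : SimplicialOperad} (f : A ⟶ B) (k : SimplexCategoryᵒᵖ) :
    (A.level k).Hom (B.level k) where
  app n := (Hom.app f n).app k
  app_act σ x := ConcreteCategory.congr_hom (congr_app (Hom.app_act f σ) k) x
  app_one := Hom.app_one f k
  app_comp := Hom.app_comp f

/-- The simplicial operad given by a simplicial object in operads in sets. -/
def ofLevels (O : SimplexCategoryᵒᵖ → SetOperad)
    (map : ∀ {k l : SimplexCategoryᵒᵖ}, (k ⟶ l) → (O k).Hom (O l))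
    (map_id : ∀ k n (x : (O k).obj n), (map (𝟙 k)).app n x = x)
    (map_comp : ∀ {k l m} (φ : k ⟶ l) (ψ : l ⟶ m) n (x : (O k).obj n),
      (map (φ ≫ ψ)).app n x = (map ψ).app n ((map φ).app n x)) : SimplicialOperad where
  obj n :=
    { obj := fun k => (O k).obj n
      map := fun φ => TypeCat.ofHom ((map φ).app n)
      map_id := fun k => by ext x; exact map_id k n x
      map_comp := fun φ ψ => by ext x; exact map_comp φ ψ n x }
  act σ :=
    { app := fun k => TypeCat.ofHom ((O k).act σ)
      naturality := fun k l φ => by ext x; exact ((map φ).app_act σ x).symm }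
  one k := (O k).one
  comp := (O _).comp
  act_refl n := by ext k x; exact (O _).act_refl x
  act_trans σ τ := by ext k x; exact (O _).act_trans σ τ x
  map_one φ := (map φ).app_one
  map_comp φ _ _ x y := (map φ).app_comp x y
  one_comp := (O _).one_comp
  comp_one := (O _).comp_one
  comp_assoc := (O _).comp_assoc
  comp_act_right := (O _).comp_act_right
  comp_act_left := (O _).comp_act_left

/-- A morphism of simplicial operads given by a natural family of morphisms of operads in sets. -/
def homOfLevels {A B : SimplicialOperad} (f : ∀ k, (A.level k).Hom (B.level k))
    (nat : ∀ {k l : SimplexCategoryᵒᵖ} (φ : k ⟶ l) (n : ℕ) (x : (A.level k).obj n),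
      (f l).app n ((A.levelMap φ).app n x) = (B.levelMap φ).app n ((f k).app n x)) : A ⟶ B :=
  { app := fun n =>
      { app := fun k => TypeCat.ofHom ((f k).app n)
        naturality := fun k l φ => by ext x; exact nat φ n x }
    app_act := fun σ => by ext k x; exact (f _).app_act σ x
    app_one := fun k => (f k).app_one
    app_comp := (f _).app_comp : Hom A B }

lemma hom_ext_level {A B : SimplicialOperad} {f g : A ⟶ B}
    (h : ∀ k n x, (Hom.level f k).app n x = (Hom.level g k).app n x) : f = g := by
  apply Hom.ext
  funext n
  ext k x
  exact h _ n x

end SimplicialOperad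

/-- A monad `M` on types, where every element of `M X` has a family of multisets of elements
of `X` as its contents, in a way compatible with the monad structure. -/
structure ContentMonad where
  M : Type → Type
  pure : ∀ {X}, X → M X
  bind : ∀ {X Y}, M X → (X → M Y) → M Y
  pure_bind : ∀ {X Y} (x : X) (f : X → M Y), bind (pure x) f = f x
  bind_pure : ∀ {X} (t : M X), bind t pure = t
  bind_assoc : ∀ {X Y Z} (t : M X) (f : X → M Y) (g : Y → M Z),
    bind (bind t f) g = bind t fun x => bind (f x) g
  κ : Type
  content : ∀ {X}, M X → κ → Multiset X
  content_pure : ∀ {X} (x : X) c, content (pure x) c = {x}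
  content_bind : ∀ {X Y} (t : M X) (f : X → M Y) c,
    content (bind t f) c = (content t c).bind fun x => content (f x) c

namespace ContentMonad

variable (M : ContentMonad)

/-- The functoriality of a monad. -/
def map {X Y : Type} (f : X → Y) (t : M.M X) : M.M Y := M.bind t fun x => M.pure (f x)

variable {M} in
lemma map_id {X : Type} (t : M.M X) : M.map (fun x => x) t = t := M.bind_pure t

lemma map_map {X Y Z : Type} (f : X → Y) (g : Y → Z) (t : M.M X) :
    M.map g (M.map f t) = M.map (fun x => g (f x)) t := by
  simp [map, bind_assoc, pure_bind]

lemma bind_map {X Y Z : Type} (f : X → Y) (g : Y → M.M Z) (t : M.M X) :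
    M.bind (M.map f t) g = M.bind t fun x => g (f x) := by
  simp [map, bind_assoc, pure_bind]

lemma map_bind {X Y Z : Type} (f : X → M.M Y) (g : Y → Z) (t : M.M X) :
    M.map g (M.bind t f) = M.bind t fun x => M.map g (f x) := by
  simp [map, bind_assoc]

lemma map_pure {X Y : Type} (f : X → Y) (x : X) : M.map f (M.pure x) = M.pure (f x) := by
  simp [map, pure_bind]

lemma content_map {X Y : Type} (f : X → Y) (t : M.M X) (c : M.κ) :
    M.content (M.map f t) c = (M.content t c).map f := by
  simp [map, content_bind, content_pure, Multiset.bind_singleton]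

/-- An element of `M (Fin n)` is linear if each of its contents is `0, …, n - 1`, in some order. -/
def Linear {n : ℕ} (t : M.M (Fin n)) : Prop :=
  ∀ c, M.content t c = (Finset.univ : Finset (Fin n)).val

variable {M}

lemma Linear.map {m n : ℕ} {t : M.M (Fin m)} (ht : M.Linear t) (σ : Fin m ≃ Fin n) :
    M.Linear (M.map σ t) := fun c => by
  rw [content_map, ht c]
  simp

lemma Linear.bind {m : ℕ} {b : Fin m → ℕ} {t : M.M (Fin m)} (ht : M.Linear t)
    {y : ∀ i, M.M (Fin (b i))} (hy : ∀ i, M.Linear (y i)) :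
    M.Linear (M.bind t fun i => M.map (fun j => finSigmaFinEquiv ⟨i, j⟩) (y i)) := fun c => by
  rw [content_bind, ht c, ← bind_univ_map_finSigmaFinEquiv]
  simp only [content_map, hy _ c]

/-- The contents of the image are the values of `s`, listed once per variable. If they are again all
variables without repetition, then `s` is a bijection. This is the source of every permutation
extracted from a linear element below. -/
lemma Linear.bijective_of_map {m n : ℕ} {t : M.M (Fin m)} (ht : M.Linear t) (c : M.κ)
    {s : Fin m → Fin n} (hs : M.Linear (M.map s t)) : Function.Bijective s := by
  have h := hs c
  rw [content_map, ht c] at h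
  refine ⟨fun x y hxy => ?_, fun y => ?_⟩
  · refine Multiset.inj_on_of_nodup_map ?_ x (Finset.mem_univ_val x) y (Finset.mem_univ_val y) hxy
    rw [h]; exact Finset.univ.nodup
  · have hy : y ∈ (Finset.univ : Finset (Fin n)).val := Finset.mem_univ_val y
    rw [← h, Multiset.mem_map] at hy
    obtain ⟨x, -, hx⟩ := hy
    exact ⟨x, hx⟩

variable (M)

/-- The operad of linear elements of a monad with contents. -/
def operad : SetOperad where
  obj n := { t : M.M (Fin n) // M.Linear t }
  act σ x := ⟨M.map σ x.1, x.2.map σ⟩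
  one := ⟨M.pure 0, fun c => by rw [content_pure]; rfl⟩
  -- Substitution after renaming the variables of `y i` into the `i`-th block. With this choice each
  -- operad axiom follows from the monad laws and the value of the coherence bijection on pairs.
  comp x y := ⟨M.bind x.1 fun i => M.map (fun j => finSigmaFinEquiv ⟨i, j⟩) (y i).1,
    x.2.bind fun i => (y i).2⟩
  act_refl x := Subtype.ext (M.map_id x.1)
  act_trans σ τ x := Subtype.ext (M.map_map σ τ x.1).symm
  one_comp y := Subtype.ext <| by
    dsimp only
    rw [pure_bind, map_map]
    simp only [unitLeft_apply, map_id]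
  comp_one x := Subtype.ext <| by
    dsimp only
    rw [map_bind]
    simp only [map_pure, unitRight_apply, bind_pure]
  comp_assoc x y z := Subtype.ext <| by
    dsimp only
    simp only [map_bind, bind_assoc, bind_map, map_map, assoc_apply]
  comp_act_right τ x y := Subtype.ext <| by
    dsimp only
    simp only [map_bind, map_map, blockSum_apply]
  comp_act_left σ x y := Subtype.ext <| by
    dsimp only
    simp only [map_bind, bind_map, map_map, blockPerm_apply]

variable {M} {N P : ContentMonad}

/-- Morphisms of monads that preserve linear elements. -/
structure Hom (M N : ContentMonad) where
  app : ∀ {X}, M.M X → N.M X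
  app_pure : ∀ {X} (x : X), app (M.pure x) = N.pure x
  app_bind : ∀ {X Y} (t : M.M X) (f : X → M.M Y),
    app (M.bind t f) = N.bind (app t) fun x => app (f x)
  linear_app : ∀ {n : ℕ} {t : M.M (Fin n)}, M.Linear t → N.Linear (app t)

lemma Hom.app_map (f : Hom M N) {X Y : Type} (g : X → Y) (t : M.M X) :
    f.app (M.map g t) = N.map g (f.app t) := by
  simp [map, f.app_bind, f.app_pure]

/-- The morphism between operads of linear elements given by a morphism of monads. -/
def Hom.operad (f : Hom M N) : SetOperad.Hom (ContentMonad.operad M) (ContentMonad.operad N) where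
  app n x := ⟨f.app x.1, f.linear_app x.2⟩
  app_act σ x := Subtype.ext (f.app_map _ _)
  app_one := Subtype.ext (f.app_pure _)
  app_comp x y := Subtype.ext <| by
    change f.app (M.bind _ _) = N.bind _ _
    rw [f.app_bind]
    simp only [f.app_map]

end ContentMonad

/-! ### The free algebra monad of an operad -/

namespace SetOperad

/-- An operation of an operad, with inputs labelled by elements of `X`. -/
structure Labelled (O : SetOperad) (X : Type) where
  arity : ℕ
  op : O.obj arity
  label : Fin arity → X

namespace Labelled

variable {O : SetOperad} {X Y : Type}

/-- Two labelled operations are equivalent if they agree up to a relabelling of inputs. -/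
def Rel (r s : O.Labelled X) : Prop :=
  ∃ σ : Fin r.arity ≃ Fin s.arity, O.act σ r.op = s.op ∧ ∀ i, r.label i = s.label (σ i)

lemma Rel.refl (r : O.Labelled X) : Rel r r := ⟨Equiv.refl _, O.act_refl _, fun _ => rfl⟩

lemma Rel.symm {r s : O.Labelled X} : Rel r s → Rel s r := fun ⟨σ, h, h'⟩ =>
  ⟨σ.symm, by rw [← h, ← O.act_trans, Equiv.self_trans_symm, O.act_refl], fun i => by simp [h']⟩

lemma Rel.trans {r s t : O.Labelled X} : Rel r s → Rel s t → Rel r t :=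
  fun ⟨σ, h₁, h₁'⟩ ⟨τ, h₂, h₂'⟩ =>
    ⟨σ.trans τ, by rw [O.act_trans, h₁, h₂], fun i => by simp [h₁', h₂']⟩

/-- Equivalence of labelled operations as a setoid. -/
instance setoid (O : SetOperad) (X : Type) : Setoid (O.Labelled X) :=
  ⟨Rel, Rel.refl, Rel.symm, Rel.trans⟩

/-- Substitution of labelled operations for the inputs of an operation. -/
def subst {m : ℕ} (x : O.obj m) (g : Fin m → O.Labelled Y) : O.Labelled Y where
  arity := ∑ i, (g i).arity
  op := O.comp x fun i => (g i).op
  label p := (g (finSigmaFinEquiv.symm p).1).label (finSigmaFinEquiv.symm p).2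

lemma subst_label {m : ℕ} (x : O.obj m) (g : Fin m → O.Labelled Y) (i : Fin m)
    (j : Fin (g i).arity) : (subst x g).label (finSigmaFinEquiv ⟨i, j⟩) = (g i).label j := by
  simp only [subst]
  rw [Equiv.symm_apply_apply]

/-- The three compatibilities `subst_act`, `subst_rel` and `subst_assoc` are the two equivariance
axioms and the associativity axiom of an operad. They give that `Free.bind` is well defined, is
independent of representatives, and is associative. -/
lemma subst_act {m n : ℕ} (σ : Fin m ≃ Fin n) (x : O.obj m) (g : Fin n → O.Labelled Y) :
    Rel (subst x fun i => g (σ i)) (subst (O.act σ x) g) := by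
  refine ⟨blockPerm σ fun i => (g i).arity, (O.comp_act_left σ x fun i => (g i).op).symm, ?_⟩
  intro p
  obtain ⟨⟨i, j⟩, rfl⟩ := finSigmaFinEquiv.surjective p
  erw [subst_label, blockPerm_apply σ (fun i => (g i).arity) i j, subst_label]

lemma subst_rel {m : ℕ} (x : O.obj m) {g h : Fin m → O.Labelled Y} (H : ∀ i, Rel (g i) (h i)) :
    Rel (subst x g) (subst x h) := by
  choose τ hτ hτ' using H
  refine ⟨blockSum τ, ?_, ?_⟩
  · refine (O.comp_act_right τ x fun i => (g i).op).symm.trans ?_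
    exact congrArg (O.comp x) (funext hτ)
  · intro p
    obtain ⟨⟨i, j⟩, rfl⟩ := finSigmaFinEquiv.surjective p
    erw [subst_label, blockSum_apply τ, subst_label, hτ']

lemma subst_assoc {m : ℕ} {b : Fin m → ℕ} (x : O.obj m) (y : ∀ i, O.obj (b i))
    (g : Fin (∑ i, b i) → O.Labelled Y) :
    Rel (subst (O.comp x y) g)
      (subst x fun i => subst (y i) fun j => g (finSigmaFinEquiv ⟨i, j⟩)) := by
  refine ⟨assoc b fun l => (g l).arity, O.comp_assoc x y fun l => (g l).op, fun p => ?_⟩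
  obtain ⟨⟨l, k⟩, rfl⟩ := finSigmaFinEquiv.surjective p
  obtain ⟨⟨i, j⟩, rfl⟩ := finSigmaFinEquiv.surjective l
  erw [subst_label, assoc_apply b fun l => (g l).arity, subst_label, subst_label]

end Labelled

/-- The free algebra over an operad. -/
def Free (O : SetOperad) (X : Type) : Type := Quotient (Labelled.setoid O X)

namespace Free

variable {O : SetOperad} {X Y Z : Type}

/-- The class of a labelled operation. -/
def mk {m : ℕ} (x : O.obj m) (f : Fin m → X) : O.Free X := Quotient.mk _ ⟨m, x, f⟩

lemma ind {p : O.Free X → Prop} (h : ∀ {m : ℕ} (x : O.obj m) (f : Fin m → X), p (mk x f))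
    (t : O.Free X) : p t := Quotient.ind (fun r => h r.op r.label) t

lemma mk_eq_mk_iff {m n : ℕ} {x : O.obj m} {y : O.obj n} {f : Fin m → X} {g : Fin n → X} :
    mk x f = mk y g ↔ ∃ σ : Fin m ≃ Fin n, O.act σ x = y ∧ ∀ i, f i = g (σ i) :=
  Quotient.eq

/-- The unit of the free algebra monad. -/
def pure (O : SetOperad) (x : X) : O.Free X := mk O.one fun _ => x

/-- The multiplication of the free algebra monad. -/
noncomputable def bind (t : O.Free X) (g : X → O.Free Y) : O.Free Y :=
  -- Representatives of the substituted elements are chosen by `out`; `bind_mk` shows that the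
  -- choice is irrelevant.
  Quotient.lift (fun r : O.Labelled X =>
      (Quotient.mk _ (Labelled.subst r.op fun i => (g (r.label i)).out) : O.Free Y)) (by
    rintro ⟨m, x, f⟩ ⟨n, y, f'⟩ ⟨σ, h, hf⟩
    dsimp only at σ h hf
    subst h
    obtain rfl : f = fun i => f' (σ i) := funext hf
    exact Quotient.sound (Labelled.subst_act σ x fun i => (g (f' i)).out)) t

lemma bind_mk {m : ℕ} (x : O.obj m) (f : Fin m → X) (g : X → O.Labelled Y) :
    bind (mk x f) (fun y => Quotient.mk _ (g y)) =
      Quotient.mk _ (Labelled.subst x fun i => g (f i)) :=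
  Quotient.sound (Labelled.subst_rel x fun i =>
    Quotient.exact (Quotient.out_eq (Quotient.mk (Labelled.setoid O Y) (g (f i)))))

lemma exists_rep (g : X → O.Free Y) : ∃ h : X → O.Labelled Y, g = fun x => Quotient.mk _ (h x) :=
  ⟨fun x => (g x).out, funext fun x => (Quotient.out_eq (g x)).symm⟩

lemma pure_bind (x : X) (g : X → O.Free Y) : bind (pure O x) g = g x := by
  obtain ⟨g, rfl⟩ := exists_rep g
  rw [pure, bind_mk]
  refine Quotient.sound ⟨unitLeft _, O.one_comp _, fun p => ?_⟩
  obtain ⟨⟨i, j⟩, rfl⟩ := finSigmaFinEquiv.surjective p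
  erw [Labelled.subst_label, unitLeft_apply]

lemma bind_pure_comp (t : O.Free X) (f : X → Y) :
    bind t (fun x => pure O (f x)) =
      Quotient.map (sa := Labelled.setoid O X) (sb := Labelled.setoid O Y)
      (fun r => ⟨_, r.op, fun i => f (r.label i)⟩)
      (fun _ _ ⟨σ, h, h'⟩ => ⟨σ, h, fun i => congrArg f (h' i)⟩) t := by
  induction t using Free.ind with
  | h x g =>
    erw [bind_mk]
    refine Quotient.sound ⟨unitRight _, O.comp_one _, fun p => ?_⟩
    obtain ⟨⟨i, j⟩, rfl⟩ := finSigmaFinEquiv.surjective p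
    erw [Labelled.subst_label, unitRight_apply]

lemma bind_pure (t : O.Free X) : bind t (pure O) = t := by
  refine (bind_pure_comp t fun x => x).trans ?_
  induction t using Free.ind with
  | h x g => rfl

lemma bind_assoc (t : O.Free X) (f : X → O.Free Y) (g : Y → O.Free Z) :
    bind (bind t f) g = bind t fun x => bind (f x) g := by
  obtain ⟨f, rfl⟩ := exists_rep f
  obtain ⟨g, rfl⟩ := exists_rep g
  induction t using Free.ind with
  | h x a =>
    rw [bind_mk]
    have h : (fun y => bind (Quotient.mk _ (f y)) fun y => Quotient.mk _ (g y)) =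
        fun y => (Quotient.mk _ (Labelled.subst (f y).op fun i => g ((f y).label i)) : O.Free Z) :=
      funext fun y => bind_mk (f y).op (f y).label g
    rw [h, bind_mk]
    erw [bind_mk]
    refine Quotient.sound ((Labelled.subst_assoc x (fun i => (f (a i)).op) _).trans ?_)
    have H : (fun i => Labelled.subst (f (a i)).op fun j => g ((f (a i)).label j)) =
        fun i => Labelled.subst (f (a i)).op fun j =>
          g ((Labelled.subst x fun i => f (a i)).label (finSigmaFinEquiv ⟨i, j⟩)) := by
      simp only [Labelled.subst_label]
    rw [H]
    exact Labelled.Rel.refl _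

/-- The multiset of labels of a labelled operation. -/
def content (t : O.Free X) : Multiset X :=
  Quotient.lift (fun r : O.Labelled X => (Finset.univ : Finset (Fin r.arity)).val.map r.label) (by
    rintro ⟨m, x, f⟩ ⟨n, y, g⟩ ⟨σ, -, h⟩
    dsimp only at σ h ⊢
    obtain rfl : f = fun i => g (σ i) := funext h
    rw [← Finset.map_univ_equiv σ, Finset.map_val, Multiset.map_map]
    rfl) t

lemma content_mk {m : ℕ} (x : O.obj m) (f : Fin m → X) :
    content (mk x f) = (Finset.univ : Finset (Fin m)).val.map f := rfl

lemma content_bind (t : O.Free X) (g : X → O.Free Y) :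
    content (bind t g) = (content t).bind fun x => content (g x) := by
  obtain ⟨g, rfl⟩ := exists_rep g
  induction t using Free.ind with
  | h x f =>
    rw [bind_mk, content_mk, Multiset.bind_map]
    refine (congrArg (Multiset.map _) (bind_univ_map_finSigmaFinEquiv _).symm).trans ?_
    refine (Multiset.map_bind _ _ _).trans (Multiset.bind_congr fun i _ => ?_)
    refine (Multiset.map_map _ _ _).trans (Multiset.map_congr rfl fun j _ => ?_)
    exact Labelled.subst_label x (fun i => g (f i)) i j

variable (O) in
/-- The free algebra monad of an operad, with its labels as contents. -/
noncomputable abbrev monad : ContentMonad where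
  M := O.Free
  pure := pure O
  bind := bind
  pure_bind := pure_bind
  bind_pure := bind_pure
  bind_assoc := bind_assoc
  κ := Unit
  content t _ := content t
  content_pure x _ := by rw [pure, content_mk]; rfl
  content_bind t f _ := content_bind t f

lemma map_mk {m : ℕ} (x : O.obj m) (f : Fin m → X) (g : X → Y) :
    (monad O).map g (mk x f) = mk x fun i => g (f i) :=
  bind_pure_comp (mk x f) g

/-- An operation with its inputs as labels. -/
def ofOp (O : SetOperad) : O.Hom (monad O).operad where
  app n x := ⟨mk x fun i => i, fun _ => (content_mk x _).trans (Multiset.map_id' _)⟩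
  app_act σ x := Subtype.ext <| by
    refine Eq.trans ?_ (map_mk x (fun i => i) σ).symm
    exact mk_eq_mk_iff.2 ⟨σ.symm, by rw [← O.act_trans, Equiv.self_trans_symm, O.act_refl], by simp⟩
  app_one := Subtype.ext (congrArg (mk O.one) (Subsingleton.elim _ _))
  app_comp {m b} x y := Subtype.ext <| by
    have h : (fun i => (monad O).map (fun j => finSigmaFinEquiv ⟨i, j⟩) (mk (y i) fun j => j)) =
        fun i => (mk (y i) fun j => finSigmaFinEquiv ⟨i, j⟩ : O.Free (Fin (∑ i, b i))) :=
      funext fun i => map_mk _ _ _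
    refine Eq.symm <| (congrArg (bind (mk x fun i => i)) h).trans <|
      (bind_mk x (fun i => i) fun i => ⟨b i, y i, fun j => finSigmaFinEquiv ⟨i, j⟩⟩).trans ?_
    refine Quotient.sound ⟨Equiv.refl _, O.act_refl _, fun p => ?_⟩
    obtain ⟨⟨i, j⟩, rfl⟩ := finSigmaFinEquiv.surjective p
    erw [Labelled.subst_label]
    rfl

/-- Linearity forces the labelling of an element to be a bijection, which can be absorbed into the
operation by `act`. With the identity labelling, the only permitted relabelling is the identity, so
the operation is determined. -/
lemma ofOp_bijective (O : SetOperad) (n : ℕ) : Function.Bijective ((ofOp O).app n) := by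
  refine ⟨fun x y h => ?_, ?_⟩
  · obtain ⟨σ, h, h'⟩ := mk_eq_mk_iff.1 (congrArg Subtype.val h)
    obtain rfl : σ = Equiv.refl _ := Equiv.ext fun i => (h' i).symm
    rwa [O.act_refl] at h
  · rintro ⟨t, ht⟩
    induction t using Free.ind with
    | @h m x f =>
      have hf : Function.Bijective f := by
        refine ContentMonad.Linear.bijective_of_map (M := monad O) (t := mk x fun i => i)
          ((ofOp O).app m x).2 () ?_
        exact (map_mk x (fun i => i) f).symm ▸ ht
      refine ⟨O.act (Equiv.ofBijective f hf) x, Subtype.ext (mk_eq_mk_iff.2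
        ⟨(Equiv.ofBijective f hf).symm, ?_, fun i => ?_⟩)⟩
      · rw [← O.act_trans, Equiv.self_trans_symm, O.act_refl]
      · exact (Equiv.ofBijective_apply_symm_apply f hf i).symm

/-- The map of free algebras given by a morphism of operads. -/
def mapOperad {P : SetOperad} (f : O.Hom P) (t : O.Free X) : P.Free X :=
  Quotient.map (sa := Labelled.setoid O X) (sb := Labelled.setoid P X)
    (fun r => ⟨_, f.app _ r.op, r.label⟩)
    (fun _ _ ⟨σ, h, h'⟩ => ⟨σ, by rw [← f.app_act, h], h'⟩) t

lemma mapOperad_mk {P : SetOperad} (f : O.Hom P) {m : ℕ} (x : O.obj m) (g : Fin m → X) :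
    mapOperad f (mk x g) = mk (f.app m x) g := rfl

lemma content_mapOperad {P : SetOperad} (f : O.Hom P) (t : O.Free X) :
    content (mapOperad f t) = content t := by
  induction t using Free.ind with
  | h x g => rfl

lemma mapOperad_pure {P : SetOperad} (f : O.Hom P) (x : X) : mapOperad f (pure O x) = pure P x := by
  rw [pure, mapOperad_mk, f.app_one, pure]

lemma mapOperad_bind {P : SetOperad} (f : O.Hom P) (t : O.Free X) (g : X → O.Free Y) :
    mapOperad f (bind t g) = bind (mapOperad f t) fun x => mapOperad f (g x) := by
  obtain ⟨g, rfl⟩ := exists_rep g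
  induction t using Free.ind with
  | h x a =>
    rw [bind_mk, mapOperad_mk]
    refine Eq.trans ?_ (bind_mk (f.app _ x) a fun y => ⟨_, f.app _ (g y).op, (g y).label⟩).symm
    change Quotient.mk _ _ = _
    congr 1
    simp only [Labelled.subst, f.app_comp]

end Free
end SetOperad

/-! ### Adding a nullary operation to an operad -/

namespace SetOperad

namespace Free

variable {O P Q : SetOperad} {X Y Z : Type}

lemma bind_map (f : X → Y) (g : Y → O.Free Z) (t : O.Free X) :
    bind ((monad O).map f t) g = bind t fun x => g (f x) :=
  (monad O).bind_map f g t

/-- A nullary operation has nothing to substitute into. It comes from the free algebra on `Empty`,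
where all substitutions coincide with a renaming. -/
lemma bind_mk_zero (x : O.obj 0) (f : Fin 0 → X) (g : X → O.Free Y) (h : Fin 0 → Y) :
    bind (mk x f) g = mk x h := by
  have h₁ : mk x f = (monad O).map (Empty.elim) (mk x Fin.elim0) := by
    rw [map_mk]; congr 1; exact Subsingleton.elim _ _
  have h₂ : mk x h = (monad O).map (Empty.elim) (mk x Fin.elim0) := by
    rw [map_mk]; congr 1; exact Subsingleton.elim _ _
  rw [h₁, h₂]
  refine (bind_map _ _ _).trans ?_
  have h : (fun e : Empty => g e.elim) = fun e : Empty => pure O e.elim :=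
    funext fun e => e.elim
  rw [h]
  rfl

variable (O) in
/-- The monad whose algebras are the algebras over an operad with an additional point. -/
noncomputable abbrev pointedMonad : ContentMonad where
  M X := O.Free (Option X)
  pure x := pure O (some x)
  -- The label `none` is the added point: it is a constant, hence fixed by substitution, and it is
  -- discarded from the contents below.
  bind t g := bind t fun o => o.elim (pure O none) g
  pure_bind x f := by rw [pure_bind]; rfl
  bind_pure t := by
    convert bind_pure t using 2
    funext o
    cases o <;> rfl
  bind_assoc t f g := by
    rw [bind_assoc]
    congr 1
    funext o
    cases o with
    | none => exact pure_bind _ _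
    | some x => rfl
  κ := Unit
  content t _ := (content t).filterMap id
  content_pure x _ := rfl
  content_bind t f _ := by
    rw [content_bind]
    generalize content t = s
    induction s using Multiset.induction_on with
    | empty => simp
    | cons o s ih =>
      cases o with
      | none =>
        rw [Multiset.cons_bind, Multiset.filterMap_add, ih, Multiset.filterMap_cons_none none s rfl]
        exact zero_add (Multiset.bind _ _)
      | some x =>
        rw [Multiset.cons_bind, Multiset.filterMap_add, ih,
          Multiset.filterMap_cons_some id (some x) s rfl, Multiset.cons_bind]
        rfl

lemma bind_option_elim (s : Multiset (Option X)) :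
    (s.bind fun o => o.elim 0 fun x => {x}) = s.filterMap id := by
  induction s using Multiset.induction_on with
  | empty => simp
  | cons o s ih =>
    cases o with
    | none => rw [Multiset.cons_bind, ih, Multiset.filterMap_cons_none _ _ rfl]; exact zero_add _
    | some x =>
      rw [Multiset.cons_bind, ih, Multiset.filterMap_cons_some id (some x) s rfl]
      exact Multiset.singleton_add x _

variable (O) in
/-- The inclusion of the free algebra in the free pointed algebra. -/
noncomputable def toPointed : ContentMonad.Hom (monad O) (pointedMonad O) where
  app t := (monad O).map some t
  app_pure x := (monad O).map_pure _ _
  app_bind t f := by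
    refine ((monad O).map_bind _ _ _).trans ?_
    exact (bind_map some (fun o => o.elim (pure O none) fun x => (monad O).map some (f x)) t).symm
  linear_app {n t} ht c := by
    change Multiset.filterMap id ((monad O).content _ c) = _
    rw [ContentMonad.content_map, ht c, Multiset.filterMap_map]
    exact Multiset.filterMap_some _

/-- The map of free pointed algebras given by a morphism of operads. -/
def mapPointed (f : O.Hom P) : ContentMonad.Hom (pointedMonad O) (pointedMonad P) where
  app t := mapOperad f t
  app_pure x := mapOperad_pure f _
  app_bind t g := by
    change mapOperad f (bind t fun o => o.elim (pure O none) g) =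
      bind (mapOperad f t) fun o => o.elim (pure P none) fun x => mapOperad f (g x)
    rw [mapOperad_bind]
    congr 1
    funext o
    cases o with
    | none => exact mapOperad_pure f _
    | some x => rfl
  linear_app {n t} ht c := by
    rw [← ht c]
    exact congrArg _ (content_mapOperad f t)

/-- Evaluation of the point of a free pointed algebra at a nullary operation. -/
noncomputable def evalPoint (f : O.Hom P) (β : P.obj 0) :
    ContentMonad.Hom (pointedMonad O) (monad P) where
  app t := bind (mapOperad f t) fun o => o.elim (mk β Fin.elim0) (pure P)
  app_pure x := by
    refine (congrArg (fun t => bind t _) (mapOperad_pure f (some x))).trans ?_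
    exact pure_bind _ _
  app_bind t g := by
    let e {X} : Option X → P.Free X := fun o => o.elim (mk β Fin.elim0) (pure P)
    change bind (mapOperad f (bind t fun o => o.elim (pure O none) g)) e =
      bind (bind (mapOperad f t) e) fun x => bind (mapOperad f (g x)) e
    rw [mapOperad_bind, bind_assoc, bind_assoc]
    congr 1
    funext o
    cases o with
    | none =>
      refine Eq.trans ?_ (bind_mk_zero β _ _ Fin.elim0).symm
      change bind (mapOperad f (pure O none)) e = _
      rw [mapOperad_pure, pure_bind]
      rfl
    | some x => exact (pure_bind x fun x => bind (mapOperad f (g x)) e).symm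
  linear_app {n t} ht c := by
    rw [← ht c]
    refine (content_bind _ _).trans ?_
    rw [content_mapOperad]
    refine Eq.trans ?_ (bind_option_elim _)
    refine Multiset.bind_congr fun o _ => ?_
    cases o <;> rfl

end Free

open Free

variable {O P Q : SetOperad}

/-- The operad `O` with a nullary operation freely added. -/
noncomputable def plus (O : SetOperad) : SetOperad := (pointedMonad O).operad

/-- The inclusion of an operad `O` in `O.plus`. -/
noncomputable def toPlus (O : SetOperad) : O.Hom O.plus := (ofOp O).trans (toPointed O).operad

/-- The additional nullary operation. -/
noncomputable def plusPoint (O : SetOperad) : O.plus.obj 0 := ⟨pure O none, fun _ => rfl⟩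

/-- The functoriality of the construction `plus`. -/
noncomputable def plusMap (f : O.Hom P) : O.plus.Hom P.plus := (mapPointed f).operad

/-- The morphism out of `O.plus` determined by a morphism out of `O` and a nullary operation. -/
noncomputable def plusDesc (f : O.Hom P) (β : P.obj 0) : O.plus.Hom P :=
  -- Evaluating `none` at `β` lands in linear elements of the free algebra monad of `P`, which are
  -- the operations of `P` itself.
  (evalPoint f β).operad.trans ((ofOp P).inverse (ofOp_bijective P))

lemma plus_ext {n : ℕ} {x y : O.plus.obj n} (h : x.1 = y.1) : x = y := Subtype.ext h

lemma toPlus_val {n : ℕ} (x : O.obj n) : (O.toPlus.app n x).1 = Free.mk x some := map_mk _ _ _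

lemma plusMap_toPlus (f : O.Hom P) {n : ℕ} (x : O.obj n) :
    (plusMap f).app n (O.toPlus.app n x) = P.toPlus.app n (f.app n x) := by
  refine plus_ext (Eq.trans ?_ (toPlus_val _).symm)
  exact congrArg (mapOperad f) (toPlus_val x)

lemma plusMap_plusPoint (f : O.Hom P) : (plusMap f).app 0 O.plusPoint = P.plusPoint :=
  plus_ext (mapOperad_pure f none)

lemma plusDesc_toPlus (f : O.Hom P) (β : P.obj 0) {n : ℕ} (x : O.obj n) :
    (plusDesc f β).app n (O.toPlus.app n x) = f.app n x := by
  apply (ofOp_bijective P n).1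
  refine ((ofOp P).app_inverse _ _).trans (Subtype.ext ?_)
  change Free.bind (mapOperad f (O.toPlus.app n x).1)
    (fun o => o.elim (Free.mk β Fin.elim0) (Free.pure P)) = Free.mk (f.app n x) fun i => i
  rw [toPlus_val, mapOperad_mk, ← map_mk (f.app n x) (fun i => i) some, Free.bind_map]
  exact Free.bind_pure _

lemma plusDesc_plusPoint (f : O.Hom P) (β : P.obj 0) :
    (plusDesc f β).app 0 O.plusPoint = β := by
  apply (ofOp_bijective P 0).1
  refine ((ofOp P).app_inverse _ _).trans (Subtype.ext ?_)
  change bind (mapOperad f (Free.pure O none))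
    (fun o => o.elim (Free.mk β Fin.elim0) (Free.pure P)) =
    Free.mk β fun i => i
  rw [mapOperad_pure, Free.pure_bind]
  exact congrArg (Free.mk β) (Subsingleton.elim _ _)

/-- Generation of `O.plus` by `O` and the point: in a labelled operation, insert the point at the
inputs labelled `none` and the unit at the others. The remaining inputs are matched with `Fin n` by
the labels, bijectively because of linearity. -/
lemma plus_eq_act_comp {n : ℕ} (x : O.plus.obj n) :
    ∃ (m : ℕ) (a : O.obj m) (b : Fin m → ℕ) (z : ∀ l, O.plus.obj (b l))
      (σ : Fin (∑ l, b l) ≃ Fin n),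
      (∀ l, (⟨b l, z l⟩ : Σ b, O.plus.obj b) = ⟨0, O.plusPoint⟩ ∨
        (⟨b l, z l⟩ : Σ b, O.plus.obj b) = ⟨1, O.plus.one⟩) ∧
      x = O.plus.act σ (O.plus.comp (O.toPlus.app m a) z) := by
  obtain ⟨t, ht⟩ := x
  induction t using Free.ind with
  | @h m a f =>
    let Z (o : Option (Fin n)) : Σ b, O.plus.obj b :=
      o.elim ⟨0, O.plusPoint⟩ fun _ => ⟨1, O.plus.one⟩
    -- An input of the composite can only lie in a block whose label is not `none`, since the other
    -- blocks are empty; `s` sends it to that label.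
    let s (p : Fin (∑ l, (Z (f l)).1)) : Fin n :=
      (f (finSigmaFinEquiv.symm p).1).get (by
        obtain ⟨l, q⟩ := finSigmaFinEquiv.symm p
        dsimp only
        generalize f l = o at q
        cases o with
        | none => exact q.elim0
        | some i => rfl)
    let w := O.plus.comp (O.toPlus.app m a) fun l => (Z (f l)).2
    have hs : (pointedMonad O).map s w.1 = Free.mk a f := by
      change (pointedMonad O).map s ((pointedMonad O).bind (O.toPlus.app m a).1 fun l =>
        (pointedMonad O).map (fun j => finSigmaFinEquiv ⟨l, j⟩) (Z (f l)).2.1) = _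
      rw [ContentMonad.map_bind, toPlus_val, ← map_mk a (fun i => i) f,
        ← map_mk a (fun i => i) some]
      refine (Free.bind_map some (fun o => o.elim (Free.pure O none) fun l =>
        (pointedMonad O).map s ((pointedMonad O).map (fun j => finSigmaFinEquiv ⟨l, j⟩)
          (Z (f l)).2.1)) (Free.mk a fun i => i)).trans ?_
      change _ = Free.bind (Free.mk a fun i => i) fun l => Free.pure O (f l)
      congr 1
      funext l
      refine ((pointedMonad O).map_map _ _ _).trans ?_
      have key (o : Option (Fin n)) (q : Fin (Z o).1 → Fin n) (hq : ∀ j, o = some (q j)) :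
          (pointedMonad O).map q (Z o).2.1 = pure O o := by
        cases o with
        | none => exact pure_bind _ _
        | some i =>
            exact ((pointedMonad O).map_pure q (0 : Fin 1)).trans
              (congrArg (Free.pure O) (hq (0 : Fin 1)).symm)
      refine key (f l) _ fun j => ?_
      simp only [s, Option.some_get, Equiv.symm_apply_apply]
    have hb : Function.Bijective s :=
      ContentMonad.Linear.bijective_of_map w.2 () (by rwa [hs])
    refine ⟨m, a, fun l => (Z (f l)).1, fun l => (Z (f l)).2, Equiv.ofBijective s hb, fun l => ?_,
      plus_ext hs.symm⟩
    change Z (f l) = _ ∨ Z (f l) = _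
    cases f l with
    | none => exact Or.inl rfl
    | some i => exact Or.inr rfl

/-- The uniqueness half of the universal property, from the generation statement `plus_eq_act_comp`.
-/
lemma plus_hom_ext {g h : O.plus.Hom P}
    (H : ∀ n x, g.app n (O.toPlus.app n x) = h.app n (O.toPlus.app n x))
    (H' : g.app 0 O.plusPoint = h.app 0 O.plusPoint) {n : ℕ} (x : O.plus.obj n) :
    g.app n x = h.app n x := by
  obtain ⟨m, a, b, z, σ, hz, rfl⟩ := plus_eq_act_comp x
  rw [g.app_act, h.app_act, g.app_comp, h.app_comp, H]
  congr 2
  funext l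
  have key (y : Σ b, O.plus.obj b) (hy : y = ⟨0, O.plusPoint⟩ ∨ y = ⟨1, O.plus.one⟩) :
      g.app _ y.2 = h.app _ y.2 := by
    obtain rfl | rfl := hy
    · exact H'
    · exact g.app_one.trans h.app_one.symm
  exact key ⟨b l, z l⟩ (hz l)

end SetOperad

namespace SimplicialOperad

/-! ### Morphisms out of `∅` and `∅₊` -/

/-- A morphism out of an operad with at most one operation in each arity. -/
def ofAritiesHom {S : ℕ → Prop} {h₁ : S 1}
    (hS : ∀ {m : ℕ} {b : Fin m → ℕ}, S m → (∀ i, S (b i)) → S (∑ i, b i))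
    (B : SimplicialOperad) (e : ∀ n, S n → ∀ k, (B.obj n).obj k)
    (he : ∀ n (h : S n) {k l} (φ : k ⟶ l), (B.obj n).map φ (e n h k) = e n h l)
    (e_act : ∀ {m n} (σ : Fin m ≃ Fin n) (hm : S m) (hn : S n) k,
      (B.act σ).app k (e m hm k) = e n hn k)
    (e_one : ∀ k, e 1 h₁ k = B.one k)
    (e_comp : ∀ {m : ℕ} {b : Fin m → ℕ} (hm : S m) (hb : ∀ i, S (b i)) (h : S (∑ i, b i)) k,
      e _ h k = B.comp (e m hm k) fun i => e (b i) (hb i) k) :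
    ofArities S h₁ hS ⟶ B :=
  { app := fun n =>
      { app := fun k => TypeCat.ofHom fun x : PLift (S n) => e n x.down k
        naturality := fun k l φ => by ext x; exact (he n (x : PLift (S n)).down φ).symm }
    app_act := fun σ => by ext k x; exact (e_act σ (x : PLift (S _)).down _ _).symm
    app_one := e_one
    app_comp := fun {_ m b} (x : PLift (S m)) (y : ∀ i, PLift (S (b i))) =>
      e_comp x.down (fun i => (y i).down) _ _ : Hom _ B }

variable (B : SimplicialOperad)

lemma act_eq_self {n : ℕ} (hn : n ≤ 1) (σ : Fin n ≃ Fin n) {k : SimplexCategoryᵒᵖ}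
    (x : (B.obj n).obj k) : (B.act σ).app k x = x := by
  have : Subsingleton (Fin n) := Fin.subsingleton_iff_le_one.2 hn
  obtain rfl : σ = Equiv.refl _ := Subsingleton.elim _ _
  exact (B.level k).act_refl x

/-- The elements of the image of a morphism out of `∅₊`. -/
def pointElem (β : ∀ k, (B.obj 0).obj k) : ∀ n, n ≤ 1 → ∀ k, (B.obj n).obj k
  | 0, _ => β
  | 1, _ => B.one
  | _ + 2, h => absurd h (by omega)

lemma pointElem_act (β : ∀ k, (B.obj 0).obj k) {m n} (σ : Fin m ≃ Fin n) (hm : m ≤ 1)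
    (hn : n ≤ 1) (k) : (B.act σ).app k (B.pointElem β m hm k) = B.pointElem β n hn k := by
  obtain rfl : m = n := Fin.equiv_iff_eq.1 ⟨σ⟩
  exact B.act_eq_self hm _ _

/-- In arities at most one, every composition is an instance of a unit law: the right one for an
empty composition and the left one for a unary one. The coherence bijection is removed by
injectivity of `act`. -/
lemma pointElem_comp (β : ∀ k, (B.obj 0).obj k) {m : ℕ} {b : Fin m → ℕ} (hm : m ≤ 1)
    (hb : ∀ i, b i ≤ 1) (h : ∑ i, b i ≤ 1) (k) :
    B.pointElem β _ h k =
      B.comp (B.pointElem β m hm k) fun i => B.pointElem β (b i) (hb i) k := by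
  obtain rfl | rfl : m = 0 ∨ m = 1 := by omega
  · obtain rfl : b = fun _ => 1 := Subsingleton.elim _ _
    apply (B.level k).act_injective (unitRight 0)
    refine (B.pointElem_act β _ _ (Nat.zero_le 1) k).trans ?_
    refine Eq.trans (B.comp_one _).symm ?_
    congr 2
  · obtain ⟨n, rfl⟩ : ∃ n, b = fun _ => n := ⟨b 0, funext fun i => by rw [Subsingleton.elim i 0]⟩
    apply (B.level k).act_injective (unitLeft n)
    refine (B.pointElem_act β _ _ (hb 0) k).trans ?_
    exact (B.one_comp _).symm

lemma pointElem_map {β : ∀ k, (B.obj 0).obj k}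
    (hβ : ∀ {k l} (φ : k ⟶ l), (B.obj 0).map φ (β k) = β l) :
    ∀ n (h : n ≤ 1) {k l} (φ : k ⟶ l),
      (B.obj n).map φ (B.pointElem β n h k) = B.pointElem β n h l
  | 0, _, _, _, φ => hβ φ
  | 1, _, _, _, φ => B.map_one φ
  | _ + 2, h, _, _, _ => absurd h (by omega)

/-- The morphism out of `∅₊` given by a nullary operation. -/
def emptyPlusHom (β : ∀ k, (B.obj 0).obj k)
    (hβ : ∀ {k l} (φ : k ⟶ l), (B.obj 0).map φ (β k) = β l) : emptyPlus ⟶ B :=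
  ofAritiesHom (fun hm hb => (Finset.sum_le_sum fun i _ => hb i).trans (by simpa using hm))
    B (B.pointElem β) (B.pointElem_map hβ) (B.pointElem_act β) (fun _ => rfl)
    (B.pointElem_comp β)

variable {B}

lemma emptyPlus_hom_ext {f g : emptyPlus ⟶ B}
    (h : ∀ k, (Hom.app f 0).app k (emptyPlusPoint k) = (Hom.app g 0).app k (emptyPlusPoint k)) :
    f = g := by
  apply hom_ext_level
  rintro k n ⟨hn⟩
  obtain rfl | rfl : n = 0 ∨ n = 1 := by have : n ≤ 1 := hn; omega
  · exact h k
  · exact (Hom.app_one f k).trans (Hom.app_one g k).symm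

lemma map_emptyPlusPoint (f : emptyPlus ⟶ B) {k l} (φ : k ⟶ l) :
    (B.obj 0).map φ ((Hom.app f 0).app k (emptyPlusPoint k)) =
      (Hom.app f 0).app l (emptyPlusPoint l) :=
  (NatTrans.naturality_apply (Hom.app f 0) φ _).symm

lemma empty_hom_ext {f g : empty ⟶ B} : f = g := by
  apply hom_ext_level
  rintro k n ⟨hn⟩
  obtain rfl : n = 1 := hn
  exact (Hom.app_one f k).trans (Hom.app_one g k).symm

/-- The morphism out of `∅`. -/
def emptyHom (B : SimplicialOperad) : empty ⟶ B :=
  ofAritiesHom (by rintro m b rfl hb; simp [hb]) B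
    (fun n h k => (B.act (finCongr h.symm)).app k (B.one k))
    (fun n h k l φ => by rw [← NatTrans.naturality_apply, B.map_one])
    (fun {m n} σ hm hn k => by
      subst hm; subst hn
      exact B.act_eq_self le_rfl _ _)
    (fun k => B.act_eq_self le_rfl _ _)
    (fun {m b} hm hb h k => by
      subst hm
      obtain rfl : b = fun _ => 1 := funext hb
      apply (B.level k).act_injective (unitLeft 1)
      refine (((B.level k).act_trans _ _ _).symm.trans (B.act_eq_self le_rfl _ _)).trans ?_
      refine (B.one_comp (B.one k)).symm.trans ?_
      refine congrArg _ ?_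
      congr 1
      · exact (B.act_eq_self le_rfl _ _).symm
      · funext i; exact (B.act_eq_self le_rfl _ _).symm)

/-- The operad `∅` is initial. -/
def emptyIsInitial : IsInitial empty :=
  IsInitial.ofUniqueHom emptyHom fun _ _ => empty_hom_ext

/-- The nullary operation given by a morphism out of `∅₊`. -/
def pointOf (b : emptyPlus ⟶ B) (k : SimplexCategoryᵒᵖ) : (B.level k).obj 0 :=
  (Hom.app b 0).app k (emptyPlusPoint k)

/-! ### The operad `A₊` -/

/-- The operad `A` with a nullary operation freely added. -/
noncomputable def plus (A : SimplicialOperad) : SimplicialOperad :=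
  ofLevels (fun k => (A.level k).plus) (fun φ => SetOperad.plusMap (A.levelMap φ))
    (fun k n x => by
      refine SetOperad.plus_ext ?_
      change SetOperad.Free.mapOperad _ x.1 = x.1
      induction x.1 using SetOperad.Free.ind with
      | h y f => exact congrArg (SetOperad.Free.mk · f) (Functor.map_id_apply _ _ _))
    (fun φ ψ n x => by
      refine SetOperad.plus_ext ?_
      change SetOperad.Free.mapOperad _ x.1 =
        SetOperad.Free.mapOperad _ (SetOperad.Free.mapOperad _ x.1)
      induction x.1 using SetOperad.Free.ind with
      | h y f => exact congrArg (SetOperad.Free.mk · f) (Functor.map_comp_apply _ _ _ _))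

/-- The inclusion `A ⟶ A₊`. -/
noncomputable def toPlus (A : SimplicialOperad) : A ⟶ A.plus :=
  homOfLevels (B := A.plus) (fun k => (A.level k).toPlus) fun φ _ x =>
    (SetOperad.plusMap_toPlus (A.levelMap φ) x).symm

/-- The additional point of `A₊`. -/
noncomputable def plusPoint (A : SimplicialOperad) : emptyPlus ⟶ A.plus :=
  A.plus.emptyPlusHom (fun k => (A.level k).plusPoint)
    fun φ => SetOperad.plusMap_plusPoint (A.levelMap φ)

/-- The morphism out of `A₊` given by a morphism out of `A` and a nullary operation. -/
noncomputable def plusDesc {A B : SimplicialOperad} (f : A ⟶ B) (b : emptyPlus ⟶ B) :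
    A.plus ⟶ B :=
  homOfLevels (A := A.plus)
    (fun k => SetOperad.plusDesc (Hom.level f k) (pointOf b k))
    fun {k l} φ n x => by
      refine SetOperad.plus_hom_ext (O := A.level k)
        (g := ((A.plus).levelMap φ).trans (SetOperad.plusDesc (Hom.level f l)
          (pointOf b l)))
        (h := (SetOperad.plusDesc (Hom.level f k)
          (pointOf b k)).trans (B.levelMap φ)) (fun n x => ?_) ?_ x
      · change (SetOperad.plusDesc (Hom.level f l) _).app n
            ((SetOperad.plusMap (A.levelMap φ)).app n ((A.level k).toPlus.app n x)) =
          (B.levelMap φ).app n ((SetOperad.plusDesc (Hom.level f k) _).app n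
            ((A.level k).toPlus.app n x))
        rw [SetOperad.plusMap_toPlus, SetOperad.plusDesc_toPlus, SetOperad.plusDesc_toPlus]
        exact NatTrans.naturality_apply (Hom.app f n) φ x
      · change (SetOperad.plusDesc (Hom.level f l) _).app 0
            ((SetOperad.plusMap (A.levelMap φ)).app 0 (A.level k).plusPoint) =
          (B.levelMap φ).app 0 ((SetOperad.plusDesc (Hom.level f k) _).app 0
            (A.level k).plusPoint)
        rw [SetOperad.plusMap_plusPoint, SetOperad.plusDesc_plusPoint,
          SetOperad.plusDesc_plusPoint]
        exact (map_emptyPlusPoint b φ).symm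

lemma toPlus_plusDesc {A B : SimplicialOperad} (f : A ⟶ B) (b : emptyPlus ⟶ B) :
    A.toPlus ≫ plusDesc f b = f :=
  hom_ext_level fun _ _ x => SetOperad.plusDesc_toPlus _ _ x

lemma plusPoint_plusDesc {A B : SimplicialOperad} (f : A ⟶ B) (b : emptyPlus ⟶ B) :
    A.plusPoint ≫ plusDesc f b = b :=
  emptyPlus_hom_ext fun k => SetOperad.plusDesc_plusPoint (Hom.level f k)
    (pointOf b k)

lemma plus_hom_ext {A B : SimplicialOperad} {f g : A.plus ⟶ B}
    (h : A.toPlus ≫ f = A.toPlus ≫ g) (h' : A.plusPoint ≫ f = A.plusPoint ≫ g) : f = g := by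
  refine hom_ext_level fun k n x => ?_
  refine SetOperad.plus_hom_ext (O := A.level k) (g := Hom.level f k) (h := Hom.level g k)
    (fun n x => ?_) ?_ x
  · exact congrArg (fun φ : A ⟶ B => (Hom.level φ k).app n x) h
  · exact congrArg (fun φ : emptyPlus ⟶ B => (Hom.level φ k).app 0 (emptyPlusPoint k)) h'

/-- A map out of `A₊` is a map out of `A` together with a map out of `∅₊`. The compatibility over
`∅` is automatic, because maps out of `∅` are unique. -/
lemma isPushout_plus (A : SimplicialOperad) (u : empty ⟶ A) :
    IsPushout inclusion u A.plusPoint A.toPlus :=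
  .of_isColimit' ⟨empty_hom_ext⟩ <| PushoutCocone.IsColimit.mk _
    (fun s => plusDesc s.inr s.inl) (fun _ => plusPoint_plusDesc _ _)
    (fun _ => toPlus_plusDesc _ _)
    (fun _ _ h h' => plus_hom_ext (h'.trans (toPlus_plusDesc _ _).symm)
      (h.trans (plusPoint_plusDesc _ _).symm))

end SimplicialOperad

/-! ### The composites `γ(a; *, …, *)` -/

namespace SetOperad

/-- Plugging the point into all inputs gives the operation with all labels `none`. Every nullary
operation of `O.plus` has this form, since `Option (Fin 0)` has no other element. -/
lemma act_comp_plusPoint_val {O : SetOperad} {j : ℕ} (a : O.obj j) :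
    (O.plus.act (zero j) (O.plus.comp (O.toPlus.app j a) fun _ => O.plusPoint)).1 =
      Free.mk a fun _ => none := by
  change (Free.pointedMonad O).map (zero j)
    ((Free.pointedMonad O).bind (O.toPlus.app j a).1 fun i =>
    (Free.pointedMonad O).map (fun j => finSigmaFinEquiv ⟨i, j⟩) (Free.pure O none)) = _
  rw [ContentMonad.map_bind, toPlus_val, ← Free.map_mk _ (fun i => i) (fun _ => none),
    ← Free.map_mk _ (fun i => i) some]
  refine (Free.bind_map some (fun o => o.elim (Free.pure _ none) fun i =>
    (Free.pointedMonad O).map (zero j) ((Free.pointedMonad O).map (fun j => finSigmaFinEquiv ⟨i, j⟩)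
      (Free.pure O none))) (Free.mk a fun i => i)).trans ?_
  change _ = Free.bind (Free.mk a fun i => i) fun _ => Free.pure O none
  congr 1
  funext i
  exact (congrArg ((Free.pointedMonad O).map (zero j)) (Free.pure_bind _ _)).trans
    (Free.pure_bind _ _)

end SetOperad

namespace SimplicialOperad

/-! ### The nullary operations of `A₊` -/

/-- The simplicial set of `n`-ary operations, as a functor. -/
def arity (n : ℕ) : SimplicialOperad ⥤ SSet.{0} where
  obj A := A.obj n
  map f := Hom.app f n
  map_id _ := rfl
  map_comp _ _ := rfl

/-- The operation `γ(a; *, …, *)`, as a map from orbits. -/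
def orbitMap {A A' : SimplicialOperad} (q : emptyPlus ⟶ A') (η : A ⟶ A') (j : ℕ) :
    A.orbits j ⟶ A'.obj 0 where
  app k := TypeCat.ofHom (Quot.lift (fun a : (A.obj j).obj k => (A'.act (zero j)).app k
      (A'.comp ((Hom.app η j).app k a) fun _ => (Hom.app q 0).app k (emptyPlusPoint k))) (by
    rintro a _ ⟨σ, rfl⟩
    refine Eq.trans ?_ (congrArg (fun x => (A'.act (zero j)).app k (A'.comp x fun _ =>
      (Hom.app q 0).app k (emptyPlusPoint k))) ((Hom.level η k).app_act σ a)).symm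
    refine Eq.trans ?_ (congrArg ((A'.act (zero j)).app k) (A'.comp_act_left (c := fun _ => 0) σ
      ((Hom.app η j).app k a) fun _ => (Hom.app q 0).app k (emptyPlusPoint k))).symm
    refine Eq.trans ?_ ((A'.level k).act_trans _ _ _)
    -- The block permutation induced by `σ` permutes empty blocks, so it is invisible after landing
    -- in `Fin 0`.
    exact congrArg (fun τ => (A'.act τ).app k (A'.comp ((Hom.app η j).app k a) fun _ =>
      (Hom.app q 0).app k (emptyPlusPoint k))) (Equiv.ext fun i => Subsingleton.elim _ _)))
  naturality k l φ := by
    ext a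
    induction a using Quot.ind with
    | mk a =>
      refine Eq.trans ?_ (NatTrans.naturality_apply (A'.act (zero j)) φ _)
      refine congrArg ((A'.act (zero j)).app l) ?_
      refine Eq.trans ?_ (A'.map_comp φ _ _).symm
      refine congrArg₂ (A'.comp (b := fun _ : Fin j => 0)) ?_ (funext fun _ => ?_)
      · exact NatTrans.naturality_apply (Hom.app η j) φ a
      · exact (map_emptyPlusPoint q φ).symm

lemma orbitMap_comp {A A' A'' : SimplicialOperad} (q : emptyPlus ⟶ A') (η : A ⟶ A')
    (f : A' ⟶ A'') (j : ℕ) :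
    orbitMap q η j ≫ Hom.app f 0 = orbitMap (q ≫ f) (η ≫ f) j := by
  ext k a
  induction a using Quot.ind with
  | mk a =>
    refine ((Hom.level f _).app_act _ _).trans ?_
    exact congrArg ((A''.act (zero j)).app _) (Hom.app_comp f _ _)

/-- Functoriality of orbits. -/
def orbitsMap {A B : SimplicialOperad} (f : A ⟶ B) (j : ℕ) : A.orbits j ⟶ B.orbits j where
  app k := TypeCat.ofHom (Quot.map ((Hom.app f j).app k) (by
    rintro a _ ⟨σ, rfl⟩
    exact ⟨σ, ((Hom.level f k).app_act σ a).symm⟩))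
  naturality k l φ := by
    ext a
    induction a using Quot.ind with
    | mk a => exact congrArg (Quot.mk _) (NatTrans.naturality_apply (Hom.app f j) φ a)

lemma orbitsMap_orbitMap {A B A' : SimplicialOperad} (f : A ⟶ B) (q : emptyPlus ⟶ A')
    (η : B ⟶ A') (j : ℕ) : orbitsMap f j ≫ orbitMap q η j = orbitMap q (f ≫ η) j := by
  ext k a
  induction a using Quot.ind with
  | mk a => rfl

lemma orbitMap_plus_val (A : SimplicialOperad) (j : ℕ) (k : SimplexCategoryᵒᵖ)
    (a : (A.obj j).obj k) :
    (show (A.level k).plus.obj 0 from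
      (orbitMap A.plusPoint A.toPlus j).app k (Quot.mk _ a)).1 =
      SetOperad.Free.mk (O := A.level k) a fun _ => none :=
  SetOperad.act_comp_plusPoint_val (O := A.level k) a

/-- The map out of a free algebra given by maps out of the orbits of `A`. -/
def freeDesc (A : SimplicialOperad) {X : SSet.{0}} (f : ∀ j, A.orbits j ⟶ X)
    (k : SimplexCategoryᵒᵖ) {Y : Type} (t : (A.level k).Free Y) : X.obj k :=
  Quotient.lift (s := SetOperad.Labelled.setoid (A.level k) Y)
    (fun r => (f r.arity).app k (Quot.mk _ r.op)) (by
      rintro ⟨m, x, g⟩ ⟨n, y, h⟩ ⟨σ, hσ, -⟩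
      dsimp only at σ hσ ⊢
      obtain rfl : m = n := Fin.equiv_iff_eq.1 ⟨σ⟩
      exact congrArg ((f m).app k) (Quot.sound ⟨σ, hσ⟩)) t

/-- The map out of the nullary operations of `A₊` given by maps out of the orbits of `A`. -/
def plusZeroDesc (A : SimplicialOperad) {X : SSet.{0}} (f : ∀ j, A.orbits j ⟶ X) :
    A.plus.obj 0 ⟶ X where
  app k := TypeCat.ofHom fun t : (A.level k).plus.obj 0 => A.freeDesc f k t.1
  naturality k l φ := by
    ext t
    obtain ⟨t, ht⟩ : (A.level k).plus.obj 0 := t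
    induction t using SetOperad.Free.ind with
    | h x g => exact NatTrans.naturality_apply (f _) φ (Quot.mk _ x)

/-- The nullary operations of `A₊` are the coproduct of the orbits of `A`. -/
noncomputable def plusZeroIsColimit (A : SimplicialOperad) :
    IsColimit (Cofan.mk (A.plus.obj 0) (orbitMap A.plusPoint A.toPlus)) :=
  Cofan.IsColimit.mk _ (fun s => A.plusZeroDesc s.inj)
    (fun s j => by
      ext k a
      induction a using Quot.ind with
      | mk a => exact congrArg (A.freeDesc s.inj k) (A.orbitMap_plus_val j k a))
    (fun s m hm => by
      ext k t
      obtain ⟨t, ht⟩ : (A.level k).plus.obj 0 := t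
      induction t using SetOperad.Free.ind with
      | @h j x g =>
        -- The labels lie in `Option (Fin 0)`, so they are all `none` and the element is the image
        -- of the orbit of `x`.
        refine Eq.trans ?_ (ConcreteCategory.congr_hom (congr_app (hm j) k) (Quot.mk _ x))
        refine congrArg (m.app k) (SetOperad.plus_ext ?_)
        refine Eq.trans ?_ (A.orbitMap_plus_val j k x).symm
        exact congrArg (SetOperad.Free.mk x) (Subsingleton.elim _ _))

/-- In a pushout `A'` of `∅₊` and `A`, the nullary operations are the coproduct of the orbits
of `A`. -/
noncomputable def sigmaOrbitsIso {A A' : SimplicialOperad} {u : empty ⟶ A} {q : emptyPlus ⟶ A'}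
    {η : A ⟶ A'} (h : IsPushout inclusion u q η) :
    (∐ fun j : ℕ => A.orbits j) ≅ A'.obj 0 :=
  (coproductIsCoproduct _).coconePointUniqueUpToIso A.plusZeroIsColimit ≪≫
    (arity 0).mapIso ((A.isPushout_plus u).isoIsPushout _ _ h)

lemma ι_sigmaOrbitsIso_hom {A A' : SimplicialOperad} {u : empty ⟶ A} {q : emptyPlus ⟶ A'}
    {η : A ⟶ A'} (h : IsPushout inclusion u q η) (j : ℕ) :
    Sigma.ι (fun j : ℕ => A.orbits j) j ≫ (sigmaOrbitsIso h).hom = orbitMap q η j := by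
  have h₁ := (coproductIsCoproduct _).comp_coconePointUniqueUpToIso_hom A.plusZeroIsColimit ⟨j⟩
  refine (Category.assoc _ _ _).symm.trans ((congrArg (· ≫ _) h₁).trans ?_)
  refine (orbitMap_comp _ _ _ j).trans ?_
  rw [IsPushout.inl_isoIsPushout_hom, IsPushout.inr_isoIsPushout_hom]

lemma sigmaOrbitsIso_hom_comp {A A' B B' : SimplicialOperad} {u : empty ⟶ A}
    {q : emptyPlus ⟶ A'} {η : A ⟶ A'} (h : IsPushout inclusion u q η) {v : empty ⟶ B}
    {r : emptyPlus ⟶ B'} {θ : B ⟶ B'} (h' : IsPushout inclusion v r θ) (f : A ⟶ B)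
    (f' : A' ⟶ B') (hf : η ≫ f' = f ≫ θ) (hr : q ≫ f' = r) :
    (sigmaOrbitsIso h).hom ≫ Hom.app f' 0 =
      Limits.Sigma.map (orbitsMap f) ≫ (sigmaOrbitsIso h').hom := by
  refine Limits.Sigma.hom_ext _ _ fun j => ?_
  rw [← Category.assoc, ι_sigmaOrbitsIso_hom, orbitMap_comp, hr, hf, Limits.Sigma.ι_map_assoc,
    ι_sigmaOrbitsIso_hom, orbitsMap_orbitMap]

end SimplicialOperad

end OperadsInSets

namespace SSet

open Simplicial Opposite

/-! ### Kan complexes: discrete simplicial sets and classifying spaces -/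

open modelCategoryQuillen in
lemma kanComplex_of_hornFilling {X : SSet.{0}}
    (h : ∀ (n : ℕ) (i : Fin (n + 2)) (s : (Λ[n + 1, i] : SSet.{0}) ⟶ X),
      ∃ t : Δ[n + 1] ⟶ X, Λ[n + 1, i].ι ≫ t = s) : KanComplex X := by
  refine (isFibrant_iff _).2 ⟨?_⟩
  rw [modelCategoryQuillen.fibrations_eq]
  intro _ _ _ hf
  simp only [modelCategoryQuillen.J, MorphismProperty.iSup_iff] at hf
  obtain ⟨n, ⟨i⟩⟩ := hf
  refine ⟨fun {s _} _ => ?_⟩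
  obtain ⟨t, ht⟩ := h n i s
  exact ⟨⟨{ l := t, fac_left := ht, fac_right := by subsingleton }⟩⟩

/-- A simplex lies in the horn exactly when its vertices together with `i` do not exhaust `[n]`.
This depends only on the set of vertices, and adding `i` is harmless: the horn is a cone with apex
`i`. -/
lemma mem_horn_of_range_subset {n : ℕ} {i : Fin (n + 1)} {k l : SimplexCategoryᵒᵖ}
    {x : (Δ[n] : SSet.{0}).obj k} {y : (Δ[n] : SSet.{0}).obj l} (hx : x ∈ Λ[n, i].obj k)
    (h : ∀ b, stdSimplex.asOrderHom y b = i ∨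
      ∃ a, stdSimplex.asOrderHom y b = stdSimplex.asOrderHom x a) :
    y ∈ Λ[n, i].obj l := by
  rw [mem_horn_iff] at hx ⊢
  refine fun H => hx (Set.eq_univ_of_univ_subset (H ▸ ?_))
  rintro _ (⟨b, rfl⟩ | hb)
  · obtain h | ⟨a, h⟩ := h b
    · exact Or.inr h
    · exact Or.inl ⟨a, h.symm⟩
  · exact Or.inr hb

/-- The simplex of `Δ[n]` given by a monotone map. -/
def stdMk {n : ℕ} {k : SimplexCategoryᵒᵖ} (f : Fin (k.unop.len + 1) →o Fin (n + 1)) :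
    (Δ[n] : SSet.{0}).obj k :=
  stdSimplex.objEquiv.symm (SimplexCategory.Hom.mk f)

lemma std_ext {n : ℕ} {k : SimplexCategoryᵒᵖ} {x y : (Δ[n] : SSet.{0}).obj k}
    (h : ∀ a, stdSimplex.asOrderHom x a = stdSimplex.asOrderHom y a) : x = y := by
  apply stdSimplex.objEquiv.injective
  ext a
  exact congrArg Fin.val (h a)

/-- The discrete simplicial set on a type. -/
abbrev discrete (S : Type) : SSet.{0} := (Functor.const SimplexCategoryᵒᵖ).obj S

/-- A map of simplices `[m] ⟶ [n]` given by a monotone map. -/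
def opMk {k l : SimplexCategoryᵒᵖ} (f : Fin (l.unop.len + 1) →o Fin (k.unop.len + 1)) : k ⟶ l :=
  Quiver.Hom.op (SimplexCategory.Hom.mk f : l.unop ⟶ k.unop)

lemma hom_map_eq {X : SSet.{0}} {A : X.Subcomplex} {Y : SSet.{0}} (f : (A : SSet.{0}) ⟶ Y)
    {k l : SimplexCategoryᵒᵖ} (φ : k ⟶ l) {x : X.obj k} (hx : x ∈ A.obj k) {y : X.obj l}
    (hy : y ∈ A.obj l) (h : X.map φ x = y) : Y.map φ (f.app k ⟨x, hx⟩) = f.app l ⟨y, hy⟩ := by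
  subst h
  exact (NatTrans.naturality_apply f φ ⟨x, hx⟩).symm

/-- Each simplex of the horn has a vertex joined to `i` by an edge of the horn. A map to a discrete
simplicial set is therefore constant on the horn and extends as a constant. -/
instance kanComplex_discrete (S : Type) : KanComplex (discrete S) := by
  refine kanComplex_of_hornFilling fun n i s => ?_
  have hi (k) : stdMk (k := k) (OrderHom.const _ i) ∈
        (Λ[n + 1, i] : (Δ[n + 1] : SSet.{0}).Subcomplex).obj k := by
    rw [mem_horn_iff]
    intro H
    obtain ⟨j, hj⟩ := exists_ne i
    have : j ∈ (Set.univ : Set (Fin (n + 2))) := Set.mem_univ j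
    rw [← H] at this
    obtain ⟨a, ha⟩ | h := this
    · exact hj ha.symm
    · exact hj h
  refine ⟨{ app := fun k => TypeCat.ofHom fun _ => s.app (op ⦋0⦌) ⟨_, hi _⟩ }, ?_⟩
  ext k ⟨x, hx⟩
  change s.app (op ⦋0⦌) ⟨_, hi _⟩ = s.app k ⟨x, hx⟩
  set v := stdSimplex.asOrderHom x 0
  have hv (l) : stdMk (k := l) (OrderHom.const _ v) ∈
        (Λ[n + 1, i] : (Δ[n + 1] : SSet.{0}).Subcomplex).obj l :=
    mem_horn_of_range_subset hx fun _ => Or.inr ⟨0, rfl⟩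
  have h₁ : s.app k ⟨x, hx⟩ = s.app (op ⦋0⦌) ⟨_, hv _⟩ :=
    hom_map_eq s (opMk (k := k) (l := op ⦋0⦌) (OrderHom.const _ 0)) hx (hv _) rfl
  rw [h₁]
  obtain h | h := le_total v i
  · have hm : Monotone ![v, i] := by
      intro a b; fin_cases a <;> fin_cases b <;> simp [h]
    have he : stdMk (k := op ⦋1⦌) ⟨![v, i], hm⟩ ∈
        (Λ[n + 1, i] : (Δ[n + 1] : SSet.{0}).Subcomplex).obj _ :=
      mem_horn_of_range_subset hx fun b => by
        fin_cases b
        · exact Or.inr ⟨0, rfl⟩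
        · exact Or.inl rfl
    exact (hom_map_eq s
        (opMk (k := op ⦋1⦌) (l := op ⦋0⦌) (OrderHom.const _ (1 : Fin 2))) he (hi _) rfl).symm.trans
      (hom_map_eq s (opMk (k := op ⦋1⦌) (l := op ⦋0⦌) (OrderHom.const _ (0 : Fin 2))) he (hv _) rfl)
  · have hm : Monotone ![i, v] := by
      intro a b; fin_cases a <;> fin_cases b <;> simp [h]
    have he : stdMk (k := op ⦋1⦌) ⟨![i, v], hm⟩ ∈
        (Λ[n + 1, i] : (Δ[n + 1] : SSet.{0}).Subcomplex).obj _ :=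
      mem_horn_of_range_subset hx fun b => by
        fin_cases b
        · exact Or.inl rfl
        · exact Or.inr ⟨0, rfl⟩
    exact (hom_map_eq s
        (opMk (k := op ⦋1⦌) (l := op ⦋0⦌) (OrderHom.const _ (0 : Fin 2))) he (hi _) rfl).symm.trans
      (hom_map_eq s (opMk (k := op ⦋1⦌) (l := op ⦋0⦌) (OrderHom.const _ (1 : Fin 2))) he (hv _) rfl)

section classifyingSpace

variable {G : Type} [Group G]

/-- The element of `G` on the edge `a ≤ b` of a simplex of `BG`. -/
def edgeLabel {k : SimplexCategoryᵒᵖ} (x : (classifyingSpace G).obj k)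
    {a b : Fin (k.unop.len + 1)} (h : a ≤ b) : G :=
  CategoryTheory.Functor.map (C := Fin (k.unop.len + 1)) (D := SingleObj G) x (homOfLE h)

lemma edgeLabel_trans {k : SimplexCategoryᵒᵖ} (x : (classifyingSpace G).obj k)
    {a b c : Fin (k.unop.len + 1)} (h : a ≤ b) (h' : b ≤ c) :
    edgeLabel x (h.trans h') = edgeLabel x h' * edgeLabel x h :=
  CategoryTheory.Functor.map_comp (C := Fin (k.unop.len + 1)) (D := SingleObj G) x
    (homOfLE h) (homOfLE h')

lemma edgeLabel_refl {k : SimplexCategoryᵒᵖ} (x : (classifyingSpace G).obj k)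
    (a : Fin (k.unop.len + 1)) : edgeLabel x (le_refl a) = 1 :=
  CategoryTheory.Functor.map_id (C := Fin (k.unop.len + 1)) (D := SingleObj G) x a

lemma classifyingSpace_ext {k : SimplexCategoryᵒᵖ} {x y : (classifyingSpace G).obj k}
    (H : ∀ (a b) (h : a ≤ b), edgeLabel x h = edgeLabel y h) : x = y := by
  refine CategoryTheory.Functor.ext (C := Fin (k.unop.len + 1)) (D := SingleObj G)
    (fun _ => rfl) fun a b f => ?_
  refine Eq.trans ?_ ((Category.id_comp _).trans (Category.comp_id _)).symm
  exact H a b (leOfHom f)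

/-- The simplex of `BG` with vertices in the total space `EG`. -/
def classifyingSpaceMk {k : SimplexCategoryᵒᵖ} (c : Fin (k.unop.len + 1) → G) :
    (classifyingSpace G).obj k :=
  ({ obj := fun _ => SingleObj.star G
     map := fun {a b} _ => ((c b)⁻¹ * c a : G)
     map_id := fun a => inv_mul_cancel (c a)
     map_comp := fun {a b d} _ _ => by
      change (c d)⁻¹ * c a = ((c d)⁻¹ * c b) * ((c b)⁻¹ * c a)
      group } : Fin (k.unop.len + 1) ⥤ SingleObj G)

lemma edgeLabel_mk {k : SimplexCategoryᵒᵖ} (c : Fin (k.unop.len + 1) → G)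
    {a b : Fin (k.unop.len + 1)} (h : a ≤ b) :
    edgeLabel (classifyingSpaceMk c) h = (c b)⁻¹ * c a := rfl

/-- The horn is a cone with apex `i`, so the labels of the edges to `i` form a potential `c` on the
vertices. The filler is the simplex with edge labels `(c b)⁻¹ * c a`. It restricts to the given map
by the cocycle identity on the triangles with apex `i`, uniformly in `n` and `i`. -/
instance kanComplex_classifyingSpace : KanComplex (classifyingSpace G) := by
  refine kanComplex_of_hornFilling fun n i s => ?_
  let e {x y : Fin (n + 2)} (h : x ≤ y) : (Δ[n + 1] : SSet.{0}).obj (op ⦋1⦌) :=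
    stdMk (k := op ⦋1⦌) ⟨![x, y], by intro a b; fin_cases a <;> fin_cases b <;> simp [h]⟩
  classical
  -- The default `1` outside the horn only serves to make the filler total. All edges used in the
  -- verification lie in the horn.
  let E {x y : Fin (n + 2)} (h : x ≤ y) : G :=
    if H : e h ∈ Λ[n + 1, i].obj (op ⦋1⦌) then
      edgeLabel (s.app (op ⦋1⦌) ⟨e h, H⟩) (Fin.zero_le (1 : Fin 2)) else 1
  let c (v : Fin (n + 2)) : G :=
    if h : v ≤ i then E h else (E (le_of_not_ge h))⁻¹
  refine ⟨{ app := fun k => TypeCat.ofHom fun x =>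
    classifyingSpaceMk fun a => c (stdSimplex.asOrderHom x a) }, ?_⟩
  ext k ⟨x, hx⟩
  refine classifyingSpace_ext fun a b hab => ?_
  change (c (stdSimplex.asOrderHom x b))⁻¹ * c (stdSimplex.asOrderHom x a) =
    edgeLabel (s.app k ⟨x, hx⟩) hab
  -- The cocycle identity. A triangle on vertices of `x` and the apex `i` lies in the horn as soon
  -- as `x` does.
  have tri {u v w : Fin (n + 2)} (huv : u ≤ v) (hvw : v ≤ w)
      (hu : u = i ∨ ∃ a, u = stdSimplex.asOrderHom x a)
      (hv : v = i ∨ ∃ a, v = stdSimplex.asOrderHom x a)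
      (hw : w = i ∨ ∃ a, w = stdSimplex.asOrderHom x a) :
      E (huv.trans hvw) = E hvw * E huv := by
    have mem {x' y' : Fin (n + 2)} (h : x' ≤ y')
        (h₁ : x' = i ∨ ∃ a, x' = stdSimplex.asOrderHom x a)
        (h₂ : y' = i ∨ ∃ a, y' = stdSimplex.asOrderHom x a) : e h ∈ Λ[n + 1, i].obj (op ⦋1⦌) :=
      mem_horn_of_range_subset hx fun b => by
        fin_cases b
        · exact h₁
        · exact h₂
    have ht : stdMk (k := op ⦋2⦌) ⟨![u, v, w], by
        intro a b h
        fin_cases a <;> fin_cases b <;>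
          first
            | exact le_rfl
            | exact huv
            | exact hvw
            | exact huv.trans hvw
            | exact absurd h (by decide)⟩ ∈
        (Λ[n + 1, i] : (Δ[n + 1] : SSet.{0}).Subcomplex).obj (op ⦋2⦌) :=
      mem_horn_of_range_subset hx fun b => by
        fin_cases b
        · exact hu
        · exact hv
        · exact hw
    simp only [E, dif_pos (mem _ hu hv), dif_pos (mem _ hv hw), dif_pos (mem _ hu hw)]
    rw [← hom_map_eq s (opMk (k := op ⦋2⦌) (l := op ⦋1⦌) ⟨![0, 1], by decide⟩) ht (mem _ hu hv)
        (std_ext fun a => by fin_cases a <;> rfl),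
      ← hom_map_eq s (opMk (k := op ⦋2⦌) (l := op ⦋1⦌) ⟨![1, 2], by decide⟩) ht (mem _ hv hw)
        (std_ext fun a => by fin_cases a <;> rfl),
      ← hom_map_eq s (opMk (k := op ⦋2⦌) (l := op ⦋1⦌) ⟨![0, 2], by decide⟩) ht (mem _ hu hw)
        (std_ext fun a => by fin_cases a <;> rfl)]
    exact edgeLabel_trans (k := op ⦋2⦌) _ (a := (0 : Fin 3)) (b := (1 : Fin 3)) (c := (2 : Fin 3))
      _ _
    exacts [huv.trans hvw, hvw, huv]
  have hE : edgeLabel (s.app k ⟨x, hx⟩) hab = E ((stdSimplex.asOrderHom x).monotone hab) := by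
    have mem : e ((stdSimplex.asOrderHom x).monotone hab) ∈ Λ[n + 1, i].obj (op ⦋1⦌) :=
      mem_horn_of_range_subset hx fun d => by
        fin_cases d
        · exact Or.inr ⟨a, rfl⟩
        · exact Or.inr ⟨b, rfl⟩
    simp only [E, dif_pos mem]
    rw [← hom_map_eq s (opMk (k := k) (l := op ⦋1⦌) ⟨![a, b], by
      intro d d'; fin_cases d <;> fin_cases d' <;> simp [hab]⟩) hx mem
        (std_ext fun a => by fin_cases a <;> rfl)]
    rfl
  have hc₁ (v : Fin (n + 2)) (h : v ≤ i) : c v = E h := dif_pos h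
  have hc₂ (v : Fin (n + 2)) (h : ¬ v ≤ i) : c v = (E (le_of_not_ge h))⁻¹ := dif_neg h
  have key {u v : Fin (n + 2)} (huv : u ≤ v) (hu : ∃ a, u = stdSimplex.asOrderHom x a)
      (hv : ∃ a, v = stdSimplex.asOrderHom x a) : (c v)⁻¹ * c u = E huv := by
    by_cases hv' : v ≤ i
    · rw [hc₁ v hv', hc₁ u (huv.trans hv'), tri huv hv' (Or.inr hu) (Or.inr hv) (Or.inl rfl)]
      group
    · rw [hc₂ v hv']
      by_cases hu' : u ≤ i
      · rw [hc₁ u hu', inv_inv, tri hu' (le_of_not_ge hv') (Or.inr hu) (Or.inl rfl) (Or.inr hv)]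
      · rw [hc₂ u hu', tri (le_of_not_ge hu') huv (Or.inl rfl) (Or.inr hu) (Or.inr hv)]
        group
  exact (key ((stdSimplex.asOrderHom x).monotone hab) ⟨a, rfl⟩ ⟨b, rfl⟩).trans hE.symm

end classifyingSpace

end SSet

namespace SSet

open Simplicial Opposite MonoidalCategory CartesianMonoidalCategory

/-! ### Homotopies into Kan complexes -/

lemma congr_app_apply {X Y : SSet.{0}} {f g : X ⟶ Y} (h : f = g) {k : SimplexCategoryᵒᵖ}
    (x : X.obj k) : f.app k x = g.app k x := by rw [h]

lemma hom_ext_apply {X Y : SSet.{0}} {f g : X ⟶ Y} (h : ∀ k (x : X.obj k), f.app k x = g.app k x) :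
    f = g := by
  ext k x
  exact h k x

open modelCategoryQuillen in
lemma exists_extension_of_anodyne {X Y L : SSet.{0}} [KanComplex L] {i : X ⟶ Y}
    (hi : anodyneExtensions i) (f : X ⟶ L) : ∃ g : Y ⟶ L, i ≫ g = f := by
  have hL : fibrations SSet.{0} (terminal.from L) :=
    (fibration_iff _).1 ((isFibrant_iff L).1 inferInstance)
  have := hi _ hL
  have sq : CommSq f i (terminal.from L) (terminal.from Y) := ⟨by subsingleton⟩
  exact ⟨sq.lift, sq.fac_left⟩

lemma eq_ι₀_of_mem_horn {X : SSet.{0}} {k : SimplexCategoryᵒᵖ} (x : X.obj k)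
    {t : (Δ[1] : SSet.{0}).obj k} (ht : t ∈ Λ[1, 0].obj k) :
    (⟨x, t⟩ : (X ⊗ Δ[1] : SSet.{0}).obj k) = ι₀.app k x := by
  refine Prod.ext rfl (std_ext fun a => ?_)
  change _ = (0 : Fin 2)
  by_contra h
  rw [mem_horn_iff] at ht
  refine ht (Set.eq_univ_of_univ_subset fun j _ => ?_)
  obtain rfl | hj := eq_or_ne j 0
  · exact Or.inr rfl
  · exact Or.inl ⟨a, (Fin.eq_one_of_ne_zero _ h).trans (Fin.eq_one_of_ne_zero j hj).symm⟩

/-- The homotopy extension property for maps to a Kan complex. -/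
lemma exists_homotopy_extension {V L : SSet.{0}} [KanComplex L] (U : V.Subcomplex)
    (a : (U : SSet.{0}) ⊗ Δ[1] ⟶ L) (b : V ⟶ L) (h : ι₀ ≫ a = U.ι ≫ b) :
    ∃ c : V ⊗ Δ[1] ⟶ L, ι₀ ≫ c = b ∧ U.ι ▷ Δ[1] ≫ c = a := by
  let B : (Δ[1] : SSet.{0}).Subcomplex := Λ[1, 0]
  have po := Subcomplex.unionProd.isPushout U B
  have comm : U.ι ▷ (B : SSet.{0}) ≫ fst V (B : SSet.{0}) ≫ b = (U : SSet.{0}) ◁ B.ι ≫ a := by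
    refine hom_ext_apply fun k ⟨x, t⟩ => ?_
    change b.app k (U.ι.app k x) = a.app k ⟨x, t.1⟩
    rw [eq_ι₀_of_mem_horn x t.2]
    exact (congr_app_apply h x).symm
  -- The inclusion of `U ⊗ Δ[1] ∪ V ⊗ Λ[1, 0]` is the pushout-product of a monomorphism with a horn
  -- inclusion, hence anodyne. Here `Λ[1, 0]` is the vertex `0`.
  obtain ⟨c, hc⟩ := exists_extension_of_anodyne
    (anodyneExtensions_unionProd_ι U B (anodyneExtensions.horn_ι 0)) (po.desc _ _ comm)
  have h₁ : V ◁ B.ι ≫ c = fst V (B : SSet.{0}) ≫ b := by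
    rw [← Subcomplex.unionProd.ι₁_ι U B, Category.assoc, hc, po.inl_desc]
  have h₂ : U.ι ▷ Δ[1] ≫ c = a := by
    rw [← Subcomplex.unionProd.ι₂_ι U B, Category.assoc, hc, po.inr_desc]
  refine ⟨c, hom_ext_apply fun k x => ?_, h₂⟩
  have hm : stdMk (k := k) (OrderHom.const _ 0) ∈ B.obj k := by
    rw [mem_horn_iff]
    intro H
    have : (1 : Fin 2) ∈ (Set.univ : Set (Fin 2)) := Set.mem_univ 1
    rw [← H] at this
    obtain ⟨a, ha⟩ | h := this
    · exact zero_ne_one (α := Fin 2) ha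
    · exact one_ne_zero (α := Fin 2) h
  exact congr_app_apply h₁ (⟨x, ⟨_, hm⟩⟩ : (V ⊗ (B : SSet.{0})).obj k)

/-- The subcomplex `X ⊗ Δ[1] ∪ Y ⊗ ∂Δ[1]` of `Y ⊗ Δ[1]`. -/
def tube {Y : SSet.{0}} (X : Y.Subcomplex) : (Y ⊗ Δ[1] : SSet.{0}).Subcomplex where
  obj k := { v | v.1 ∈ X.obj k ∨ v = ι₀.app k v.1 ∨ v = ι₁.app k v.1 }
  map {k l} φ v hv := by
    obtain h | h | h := hv
    · exact Or.inl (X.map φ h)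
    · refine Or.inr (Or.inl ?_)
      have := congrArg ((Y ⊗ Δ[1] : SSet.{0}).map φ) h
      exact this
    · refine Or.inr (Or.inr ?_)
      have := congrArg ((Y ⊗ Δ[1] : SSet.{0}).map φ) h
      exact this

lemma ι₀_ne_ι₁ {Y : SSet.{0}} {k : SimplexCategoryᵒᵖ} (x y : Y.obj k) :
    (ι₀.app k x : (Y ⊗ Δ[1] : SSet.{0}).obj k) ≠ ι₁.app k y := fun h => by
  have : stdSimplex.asOrderHom (ι₀.app k x : (Y ⊗ Δ[1] : SSet.{0}).obj k).2 0 =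
      stdSimplex.asOrderHom (ι₁.app k y : (Y ⊗ Δ[1] : SSet.{0}).obj k).2 0 := by rw [h]
  exact zero_ne_one (α := Fin 2) this

/-- Gluing maps on `(X ⊗ Δ[1] ∪ Y ⊗ ∂Δ[1]) ⊗ T`. -/
lemma exists_tube_desc {Y T L : SSet.{0}} (X : Y.Subcomplex)
    (q : ((X : SSet.{0}) ⊗ Δ[1]) ⊗ T ⟶ L) (d₀ d₁ : Y ⊗ T ⟶ L)
    (h₀ : ι₀ ▷ T ≫ q = X.ι ▷ T ≫ d₀) (h₁ : ι₁ ▷ T ≫ q = X.ι ▷ T ≫ d₁) :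
    ∃ a : (tube X : SSet.{0}) ⊗ T ⟶ L,
      (∀ k (x : X.obj k) (s : (Δ[1] : SSet.{0}).obj k) (t : T.obj k),
        a.app k ⟨⟨⟨x.1, s⟩, Or.inl x.2⟩, t⟩ = q.app k ⟨⟨x, s⟩, t⟩) ∧
      (∀ k (y : Y.obj k) (t : T.obj k),
        a.app k ⟨⟨ι₀.app k y, Or.inr (Or.inl rfl)⟩, t⟩ = d₀.app k ⟨y, t⟩) ∧
      (∀ k (y : Y.obj k) (t : T.obj k),
        a.app k ⟨⟨ι₁.app k y, Or.inr (Or.inr rfl)⟩, t⟩ = d₁.app k ⟨y, t⟩) := by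
  classical
  let a (k : SimplexCategoryᵒᵖ) (v : ((tube X : SSet.{0}) ⊗ T).obj k) : L.obj k :=
    -- The three pieces overlap only over `X`, where `h₀` and `h₁` make the definitions agree, so
    -- the order of the tests does not matter.
    if h : v.1.1.1 ∈ X.obj k then q.app k ⟨⟨⟨_, h⟩, v.1.1.2⟩, v.2⟩ else
      if v.1.1 = ι₀.app k v.1.1.1 then d₀.app k ⟨v.1.1.1, v.2⟩ else d₁.app k ⟨v.1.1.1, v.2⟩
  have ha k (x : X.obj k) (s : (Δ[1] : SSet.{0}).obj k) (t : T.obj k) :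
      a k ⟨⟨⟨x.1, s⟩, Or.inl x.2⟩, t⟩ = q.app k ⟨⟨x, s⟩, t⟩ := dif_pos x.2
  have ha₀ k (y : Y.obj k) (t : T.obj k) :
      a k ⟨⟨ι₀.app k y, Or.inr (Or.inl rfl)⟩, t⟩ = d₀.app k ⟨y, t⟩ := by
    by_cases h : y ∈ X.obj k
    · exact (dif_pos h).trans (congr_app_apply h₀ (⟨⟨y, h⟩, t⟩ : ((X : SSet.{0}) ⊗ T).obj k))
    · exact (dif_neg h).trans (if_pos rfl)
  have ha₁ k (y : Y.obj k) (t : T.obj k) :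
      a k ⟨⟨ι₁.app k y, Or.inr (Or.inr rfl)⟩, t⟩ = d₁.app k ⟨y, t⟩ := by
    by_cases h : y ∈ X.obj k
    · exact (dif_pos h).trans (congr_app_apply h₁ (⟨⟨y, h⟩, t⟩ : ((X : SSet.{0}) ⊗ T).obj k))
    · exact (dif_neg h).trans (if_neg (ι₀_ne_ι₁ y y).symm)
  refine ⟨{ app := fun k => TypeCat.ofHom (a k), naturality := fun k l φ => ?_ }, ha, ha₀, ha₁⟩
  ext ⟨⟨⟨y, s⟩, hv⟩, t⟩
  change a l _ = L.map φ (a k _)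
  obtain h | h | h := hv
  · refine (ha l ⟨Y.map φ y, X.map φ h⟩ _ _).trans (Eq.trans ?_ (congrArg _ (ha k ⟨y, h⟩ s t).symm))
    exact NatTrans.naturality_apply q φ (⟨⟨⟨y, h⟩, s⟩, t⟩ : (((X : SSet.{0}) ⊗ Δ[1]) ⊗ T).obj k)
  · obtain rfl : s = (ι₀.app k y : (Y ⊗ Δ[1] : SSet.{0}).obj k).2 := congrArg Prod.snd h
    refine (ha₀ l (Y.map φ y) _).trans (Eq.trans ?_ (congrArg _ (ha₀ k y t).symm))
    exact NatTrans.naturality_apply d₀ φ (⟨y, t⟩ : (Y ⊗ T).obj k)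
  · obtain rfl : s = (ι₁.app k y : (Y ⊗ Δ[1] : SSet.{0}).obj k).2 := congrArg Prod.snd h
    refine (ha₁ l (Y.map φ y) _).trans (Eq.trans ?_ (congrArg _ (ha₁ k y t).symm))
    exact NatTrans.naturality_apply d₁ φ (⟨y, t⟩ : (Y ⊗ T).obj k)

/-- Filling the missing face of a box, relatively to a subcomplex. -/
lemma exists_box_filling {Y L : SSet.{0}} [KanComplex L] (X : Y.Subcomplex)
    (q : ((X : SSet.{0}) ⊗ Δ[1]) ⊗ Δ[1] ⟶ L) (d₀ d₁ b : Y ⊗ Δ[1] ⟶ L)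
    (h₀ : ι₀ ▷ Δ[1] ≫ q = X.ι ▷ Δ[1] ≫ d₀) (h₁ : ι₁ ▷ Δ[1] ≫ q = X.ι ▷ Δ[1] ≫ d₁)
    (hb : ι₀ ≫ q = X.ι ▷ Δ[1] ≫ b) (hb₀ : ι₀ ≫ d₀ = ι₀ ≫ b) (hb₁ : ι₀ ≫ d₁ = ι₁ ≫ b) :
    ∃ c : Y ⊗ Δ[1] ⟶ L, X.ι ▷ Δ[1] ≫ c = ι₁ ≫ q ∧ ι₀ ≫ c = ι₁ ≫ d₀ ∧ ι₁ ≫ c = ι₁ ≫ d₁ := by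
  obtain ⟨a, ha, ha₀, ha₁⟩ := exists_tube_desc X q d₀ d₁ h₀ h₁
  -- The first interval is the direction of the result and the second is the direction of filling:
  -- `b` is the bottom, `q`, `d₀` and `d₁` are the walls, and the lid at the far end is the desired
  -- homotopy.
  obtain ⟨c, hc₀, hc⟩ := exists_homotopy_extension (tube X) a b (by
    refine hom_ext_apply fun k ⟨⟨y, s⟩, hv⟩ => ?_
    obtain h | h | h := hv
    · exact (ha k ⟨y, h⟩ s _).trans
        (congr_app_apply hb (⟨⟨y, h⟩, s⟩ : ((X : SSet.{0}) ⊗ Δ[1]).obj k))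
    · obtain rfl : s = (ι₀.app k y : (Y ⊗ Δ[1] : SSet.{0}).obj k).2 := congrArg Prod.snd h
      exact (ha₀ k y _).trans (congr_app_apply hb₀ y)
    · obtain rfl : s = (ι₁.app k y : (Y ⊗ Δ[1] : SSet.{0}).obj k).2 := congrArg Prod.snd h
      exact (ha₁ k y _).trans (congr_app_apply hb₁ y))
  refine ⟨ι₁ ≫ c, hom_ext_apply fun k ⟨x, s⟩ => ?_, hom_ext_apply fun k y => ?_,
    hom_ext_apply fun k y => ?_⟩
  · exact (congr_app_apply hc (ι₁.app k ⟨⟨x.1, s⟩, Or.inl x.2⟩)).trans (ha k x s _)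
  · exact (congr_app_apply hc (ι₁.app k ⟨ι₀.app k y, Or.inr (Or.inl rfl)⟩)).trans (ha₀ k y _)
  · exact (congr_app_apply hc (ι₁.app k ⟨ι₁.app k y, Or.inr (Or.inr rfl)⟩)).trans (ha₁ k y _)

/-- Two maps are homotopic if there is a homotopy from the first to the second. -/
def Homotopic {X K : SSet.{0}} (f g : X ⟶ K) : Prop :=
  ∃ h : X ⊗ Δ[1] ⟶ K, ι₀ ≫ h = f ∧ ι₁ ≫ h = g

lemma homotopic_iff {X K : SSet.{0}} (f g : X ⟶ K) : Homotopic f g ↔ Nonempty (Homotopy f g) := by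
  constructor
  · rintro ⟨h, h₀, h₁⟩
    exact ⟨{ h := h, h₀ := h₀, h₁ := h₁, rel := by ext n ⟨⟨_, h⟩, _⟩; exact h.elim }⟩
  · rintro ⟨H⟩
    exact ⟨H.h, H.h₀, H.h₁⟩

namespace Homotopic

variable {X Y K L : SSet.{0}}

lemma refl (f : X ⟶ K) : Homotopic f f := ⟨fst _ _ ≫ f, rfl, rfl⟩

lemma comp_left {f g : X ⟶ K} (h : Homotopic f g) (p : Y ⟶ X) : Homotopic (p ≫ f) (p ≫ g) := by
  obtain ⟨h, rfl, rfl⟩ := h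
  exact ⟨p ▷ Δ[1] ≫ h, rfl, rfl⟩

lemma comp_right {f g : X ⟶ K} (h : Homotopic f g) (p : K ⟶ L) : Homotopic (f ≫ p) (g ≫ p) := by
  obtain ⟨h, rfl, rfl⟩ := h
  exact ⟨h ≫ p, rfl, rfl⟩

variable [KanComplex K]

/-- Fill a box whose bottom is the constant homotopy at `f` and whose walls are the two given
homotopies. The lid joins `g` to `h`. Symmetry and transitivity are formal consequences. -/
lemma euclid {f g h : X ⟶ K} (H : Homotopic f g) (H' : Homotopic f h) : Homotopic g h := by
  obtain ⟨d₀, rfl, rfl⟩ := H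
  obtain ⟨d₁, h₁, rfl⟩ := H'
  obtain ⟨c, -, hc₀, hc₁⟩ := exists_box_filling (⊥ : X.Subcomplex)
    (q := { app := fun _ => TypeCat.ofHom fun x => x.1.1.2.elim,
            naturality := fun k l φ => by ext x; exact x.1.1.2.elim })
    d₀ d₁ (fst _ _ ≫ ι₀ ≫ d₀) (by ext k x; exact x.1.2.elim) (by ext k x; exact x.1.2.elim)
    (by ext k x; exact x.1.2.elim) (by rw [ι₀_fst_assoc]) (by rw [ι₁_fst_assoc, h₁])
  exact ⟨c, hc₀, hc₁⟩

lemma symm {f g : X ⟶ K} (H : Homotopic f g) : Homotopic g f := H.euclid (refl f)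

lemma trans {f g h : X ⟶ K} (H : Homotopic f g) (H' : Homotopic g h) : Homotopic f h :=
  H.symm.euclid H'

end Homotopic

lemma HoClass.mk_eq_mk_iff {X K : SSet.{0}} [KanComplex K] (f g : X ⟶ K) :
    (Quot.mk _ f : HoClass X K) = Quot.mk _ g ↔ Homotopic f g := by
  constructor
  · intro h
    have := Quot.eqvGen_exact h
    induction this with
    | rel _ _ h' => exact (homotopic_iff _ _).2 h'
    | refl _ => exact .refl _
    | symm _ _ _ ih => exact ih (Quot.eqvGen_sound ‹_›) |>.symm
    | trans _ _ _ h₁ h₂ ih₁ ih₂ =>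
      exact (ih₁ (Quot.eqvGen_sound h₁)).trans (ih₂ (Quot.eqvGen_sound h₂))
  · exact fun h => Quot.sound ((homotopic_iff _ _).1 h)

/-- Weak equivalences in terms of maps and homotopies. -/
lemma bijective_precomp_iff {X Y K : SSet.{0}} [KanComplex K] (f : X ⟶ Y) :
    Function.Bijective (HoClass.precomp f K) ↔
      (∀ g h : Y ⟶ K, Homotopic (f ≫ g) (f ≫ h) → Homotopic g h) ∧
        ∀ g : X ⟶ K, ∃ h : Y ⟶ K, Homotopic (f ≫ h) g := by
  refine and_congr ⟨fun H g h e => ?_, ?_⟩ ⟨fun H g => ?_, ?_⟩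
  · exact (HoClass.mk_eq_mk_iff _ _).1 (H ((HoClass.mk_eq_mk_iff _ _).2 e))
  · rintro H ⟨g⟩ ⟨h⟩ e
    exact (HoClass.mk_eq_mk_iff _ _).2 (H g h ((HoClass.mk_eq_mk_iff _ _).1 e))
  · obtain ⟨⟨h⟩, e⟩ := H (Quot.mk _ g)
    exact ⟨h, (HoClass.mk_eq_mk_iff _ _).1 e⟩
  · rintro H ⟨g⟩
    obtain ⟨h, e⟩ := H g
    exact ⟨Quot.mk _ h, (HoClass.mk_eq_mk_iff _ _).2 e⟩

end SSet

namespace SSet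

open Simplicial Opposite MonoidalCategory CartesianMonoidalCategory

/-! ### Path objects and the mapping path fibration of a section -/

section

variable {T W L : SSet.{0}}

/-- The evaluation of the internal hom, with the exponent on the right. -/
noncomputable def powerEv (T L : SSet.{0}) : (ihom T).obj L ⊗ T ⟶ L :=
  (β_ _ _).hom ≫ (ihom.ev T).app L

/-- The map to the internal hom which corresponds to `H`. -/
noncomputable def powerLift (H : W ⊗ T ⟶ L) : W ⟶ (ihom T).obj L :=
  MonoidalClosed.curry ((β_ _ _).hom ≫ H)

lemma powerLift_whiskerRight_ev (H : W ⊗ T ⟶ L) :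
    powerLift H ▷ T ≫ powerEv T L = H := by
  rw [powerEv, powerLift, BraidedCategory.braiding_naturality_left_assoc,
    ← MonoidalClosed.uncurry_eq, MonoidalClosed.uncurry_curry,
    SymmetricCategory.symmetry_assoc]

lemma power_hom_ext {f g : W ⟶ (ihom T).obj L}
    (h : f ▷ T ≫ powerEv T L = g ▷ T ≫ powerEv T L) : f = g := by
  apply MonoidalClosed.uncurry_injective
  rw [MonoidalClosed.uncurry_eq, MonoidalClosed.uncurry_eq]
  rw [powerEv, BraidedCategory.braiding_naturality_left_assoc,
    BraidedCategory.braiding_naturality_left_assoc] at h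
  exact (cancel_epi (β_ W T).hom).1 h

end

/-- The path object `L^Δ[1]`. -/
noncomputable abbrev path (L : SSet.{0}) : SSet.{0} := (ihom Δ[1]).obj L

/-- The evaluation of paths. -/
noncomputable abbrev pathEv (L : SSet.{0}) : path L ⊗ Δ[1] ⟶ L := powerEv Δ[1] L

/-- The map to the path object given by a homotopy. -/
noncomputable abbrev pathLift {W L : SSet.{0}} (H : W ⊗ Δ[1] ⟶ L) : W ⟶ path L := powerLift H

lemma pathLift_whiskerRight_ev {W L : SSet.{0}} (H : W ⊗ Δ[1] ⟶ L) :
    pathLift H ▷ Δ[1] ≫ pathEv L = H := powerLift_whiskerRight_ev H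

lemma path_hom_ext {W L : SSet.{0}} {f g : W ⟶ path L}
    (h : f ▷ Δ[1] ≫ pathEv L = g ▷ Δ[1] ≫ pathEv L) : f = g := power_hom_ext h

/-- The mapping path space of `φ : K ⟶ L`: points `k` of `K` and paths ending at `φ k`. -/
noncomputable abbrev mappingPath {K L : SSet.{0}} (φ : K ⟶ L) : SSet.{0} :=
  pullback φ (ι₁ ≫ pathEv L)

/-- The path underlying a map to the mapping path space. -/
noncomputable def mappingPathHomotopy {W K L : SSet.{0}} {φ : K ⟶ L} (f : W ⟶ mappingPath φ) :
    W ⊗ Δ[1] ⟶ L :=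
  (f ≫ pullback.snd _ _) ▷ Δ[1] ≫ pathEv L

/-- The starting point of the path. -/
noncomputable def mappingPathStart {K L : SSet.{0}} (φ : K ⟶ L) : mappingPath φ ⟶ L :=
  pullback.snd _ _ ≫ ι₀ ≫ pathEv L

section

variable {W K L : SSet.{0}} {φ : K ⟶ L}

lemma ι₀_mappingPathHomotopy (f : W ⟶ mappingPath φ) :
    ι₀ ≫ mappingPathHomotopy f = f ≫ mappingPathStart φ := by
  rw [mappingPathHomotopy, ι₀_comp_assoc, mappingPathStart, Category.assoc]

lemma ι₁_mappingPathHomotopy (f : W ⟶ mappingPath φ) :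
    ι₁ ≫ mappingPathHomotopy f = f ≫ pullback.fst _ _ ≫ φ := by
  rw [mappingPathHomotopy, ι₁_comp_assoc, pullback.condition, Category.assoc]

lemma mappingPathHomotopy_comp {V : SSet.{0}} (g : V ⟶ W) (f : W ⟶ mappingPath φ) :
    mappingPathHomotopy (g ≫ f) = g ▷ Δ[1] ≫ mappingPathHomotopy f := by
  simp only [mappingPathHomotopy, Category.assoc, comp_whiskerRight]

/-- The map to the mapping path space given by a map and a homotopy. -/
noncomputable def mappingPathLift (k : W ⟶ K) (H : W ⊗ Δ[1] ⟶ L) (h : ι₁ ≫ H = k ≫ φ) :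
    W ⟶ mappingPath φ :=
  pullback.lift k (pathLift H) (by
    rw [← ι₁_comp_assoc, pathLift_whiskerRight_ev, h])

lemma mappingPathLift_fst (k : W ⟶ K) (H : W ⊗ Δ[1] ⟶ L) (h : ι₁ ≫ H = k ≫ φ) :
    mappingPathLift k H h ≫ pullback.fst _ _ = k :=
  pullback.lift_fst _ _ _

lemma mappingPathHomotopy_lift (k : W ⟶ K) (H : W ⊗ Δ[1] ⟶ L) (h : ι₁ ≫ H = k ≫ φ) :
    mappingPathHomotopy (mappingPathLift k H h) = H := by
  rw [mappingPathHomotopy, mappingPathLift, pullback.lift_snd, pathLift_whiskerRight_ev]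

lemma mappingPath_hom_ext {f g : W ⟶ mappingPath φ}
    (h₁ : f ≫ pullback.fst _ _ = g ≫ pullback.fst _ _)
    (h₂ : mappingPathHomotopy f = mappingPathHomotopy g) : f = g :=
  pullback.hom_ext h₁ (path_hom_ext h₂)

end

/-- If `φ : K ⟶ L` has a retraction which is a deformation retraction, then the mapping path
fibration of `φ` is a trivial fibration. -/
lemma rlp_mappingPathStart {K L : SSet.{0}} [KanComplex K] [KanComplex L] {φ : K ⟶ L}
    {r : L ⟶ K} (hr : φ ≫ r = 𝟙 K) (D : L ⊗ Δ[1] ⟶ L) (hD₀ : ι₀ ≫ D = r ≫ φ)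
    (hD₁ : ι₁ ≫ D = 𝟙 L) : modelCategoryQuillen.I.rlp (mappingPathStart φ) := by
  have key {Y : SSet.{0}} (X : Y.Subcomplex) : HasLiftingProperty X.ι (mappingPathStart φ) := by
    refine ⟨fun {f y} sq => ?_⟩
    let H := mappingPathHomotopy f
    have hH₀ : ι₀ ≫ H = X.ι ≫ y := (ι₀_mappingPathHomotopy f).trans sq.w
    have hH₁ : ι₁ ≫ H = (f ≫ pullback.fst _ _) ≫ φ :=
      (ι₁_mappingPathHomotopy f).trans (Category.assoc _ _ _).symm
    -- Transport the problem to `K` by `r` and extend the path there. The end point of `N` is the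
    -- `K`-component of the lift.
    obtain ⟨N, hN₀, hN⟩ := exists_homotopy_extension X (H ≫ r) (y ≫ r) (by
      rw [reassoc_of% hH₀])
    have hrφ : ι₁ ≫ N ≫ φ ≫ r = ι₁ ≫ N := by rw [hr, Category.comp_id]
    have hN₁ : X.ι ≫ ι₁ ≫ N = f ≫ pullback.fst _ _ := by
      rw [← ι₁_comp_assoc, hN, reassoc_of% hH₁, hr, Category.comp_id]
    -- `N ≫ φ` has the right shape, but it starts at `y ≫ r ≫ φ` rather than `y` and extends `H ≫ r
    -- ≫ φ` rather than `H`. Walls built from the deformation `D` correct all of this at once, and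
    -- the lid `c` is the path of the lift.
    obtain ⟨c, hc, hc₀, hc₁⟩ := exists_box_filling X (H ▷ Δ[1] ≫ D) (y ▷ Δ[1] ≫ D)
      ((ι₁ ≫ N ≫ φ) ▷ Δ[1] ≫ D) (N ≫ φ)
      (by rw [← comp_whiskerRight_assoc, ← comp_whiskerRight_assoc, hH₀])
      (by rw [← comp_whiskerRight_assoc, ← comp_whiskerRight_assoc, hH₁, reassoc_of% hN₁,
        Category.assoc])
      (by rw [ι₀_comp_assoc, hD₀, reassoc_of% hN])
      (by rw [ι₀_comp_assoc, hD₀, reassoc_of% hN₀])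
      (by rw [ι₀_comp_assoc, hD₀, Category.assoc, Category.assoc, reassoc_of% hr])
    rw [ι₁_comp_assoc, hD₁, Category.comp_id] at hc hc₀ hc₁
    refine ⟨⟨{ l := mappingPathLift (ι₁ ≫ N) c (by rw [hc₁, Category.assoc])
               fac_left := ?_
               fac_right := ?_ }⟩⟩
    · refine mappingPath_hom_ext ?_ ?_
      · rw [Category.assoc, mappingPathLift_fst, hN₁]
      · rw [mappingPathHomotopy_comp, mappingPathHomotopy_lift, hc]
    · rw [← ι₀_mappingPathHomotopy, mappingPathHomotopy_lift, hc₀]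
  intro _ _ _ hi
  obtain ⟨n⟩ := hi
  exact key _

end SSet

namespace SSet

open Simplicial Opposite MonoidalCategory CartesianMonoidalCategory

/-! ### Group actions on simplicial sets and equivariant lifting -/

/-- The condition that a family of endomorphisms is a left action of a group. -/
structure IsAction {G : Type} [Group G] {Z : SSet.{0}} (ρ : G → (Z ⟶ Z)) : Prop where
  one : ρ 1 = 𝟙 Z
  mul : ∀ g h, ρ (g * h) = ρ h ≫ ρ g

/-- The condition that a group acts freely on every set of simplices. -/
def IsFree {G : Type} [Group G] {Z : SSet.{0}} (ρ : G → (Z ⟶ Z)) : Prop :=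
  ∀ (g : G) (k : SimplexCategoryᵒᵖ) (x : Z.obj k), (ρ g).app k x = x → g = 1

/-- The quotient of a simplicial set by an action. -/
def orbitSpace {G : Type} {Z : SSet.{0}} (ρ : G → (Z ⟶ Z)) : SSet.{0} where
  obj k := Quot (fun x y : Z.obj k => ∃ g : G, (ρ g).app k x = y)
  map φ := TypeCat.ofHom (Quot.map (Z.map φ) (by
    rintro x _ ⟨g, rfl⟩
    exact ⟨g, by simp [NatTrans.naturality_apply]⟩))
  map_id k := by
    ext x
    induction x using Quot.ind
    simp [Quot.map]
  map_comp φ ψ := by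
    ext x
    induction x using Quot.ind
    simp [Quot.map]

variable {G : Type} {X Y Z W E B : SSet.{0}}

/-- The projection to the quotient. -/
def orbitMk (ρ : G → (Z ⟶ Z)) : Z ⟶ orbitSpace ρ where
  app _ := TypeCat.ofHom fun x => Quot.mk _ x
  naturality _ _ _ := rfl

lemma orbitMk_surjective (ρ : G → (Z ⟶ Z)) {k : SimplexCategoryᵒᵖ} (x : (orbitSpace ρ).obj k) :
    ∃ z, (orbitMk ρ).app k z = x := Quot.exists_rep x

lemma orbitMk_app (ρ : G → (Z ⟶ Z)) (g : G) {k : SimplexCategoryᵒᵖ} (x : Z.obj k) :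
    (orbitMk ρ).app k ((ρ g).app k x) = (orbitMk ρ).app k x :=
  (Quot.sound ⟨g, rfl⟩).symm

/-- The map out of a quotient induced by an invariant map. -/
def orbitDesc {ρ : G → (Z ⟶ Z)} (f : Z ⟶ W) (hf : ∀ g, ρ g ≫ f = f) : orbitSpace ρ ⟶ W where
  app k := TypeCat.ofHom (Quot.lift (f.app k) (by
    rintro x _ ⟨g, rfl⟩
    exact (congr_app_apply (hf g) x).symm))
  naturality k l φ := by
    ext ⟨x⟩
    exact NatTrans.naturality_apply f φ x

lemma orbitMk_cancel {ρ : G → (Z ⟶ Z)} {f g : orbitSpace ρ ⟶ W}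
    (h : orbitMk ρ ≫ f = orbitMk ρ ≫ g) : f = g := by
  ext k ⟨x⟩
  exact congr_app_apply h x

/-- The diagonal action on a product. -/
noncomputable abbrev diagonalAction (ρ : G → (Z ⟶ Z)) (σ : G → (E ⟶ E)) (g : G) : Z ⊗ E ⟶ Z ⊗ E :=
  ρ g ⊗ₘ σ g

variable [Group G]

namespace IsAction

variable {ρ : G → (Z ⟶ Z)} (hρ : IsAction ρ) {k : SimplexCategoryᵒᵖ}
include hρ

lemma one_app (x : Z.obj k) : (ρ 1).app k x = x := congr_app_apply hρ.one x

lemma mul_app (g h : G) (x : Z.obj k) :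
    (ρ (g * h)).app k x = (ρ g).app k ((ρ h).app k x) := congr_app_apply (hρ.mul g h) x

lemma inv_app (g : G) (x : Z.obj k) : (ρ g⁻¹).app k ((ρ g).app k x) = x := by
  rw [← hρ.mul_app, inv_mul_cancel, hρ.one_app]

lemma diagonal {σ : G → (E ⟶ E)} (hσ : IsAction σ) : IsAction (diagonalAction ρ σ) where
  one := by rw [diagonalAction, hρ.one, hσ.one, id_tensorHom_id]
  mul g h := by rw [diagonalAction, hρ.mul, hσ.mul, tensorHom_comp_tensorHom]

lemma orbitMk_eq_iff (x y : Z.obj k) :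
    (orbitMk ρ).app k x = (orbitMk ρ).app k y ↔ ∃ g, (ρ g).app k x = y := by
  constructor
  · intro h
    have := Quot.eqvGen_exact h
    clear h
    induction this with
    | rel _ _ h => exact h
    | refl x => exact ⟨1, hρ.one_app x⟩
    | symm _ _ _ ih =>
      obtain ⟨g, rfl⟩ := ih
      exact ⟨g⁻¹, hρ.inv_app g _⟩
    | trans _ _ _ _ _ h₁ h₂ =>
      obtain ⟨g, rfl⟩ := h₁
      obtain ⟨h, rfl⟩ := h₂
      exact ⟨h * g, hρ.mul_app h g _⟩
  · rintro ⟨g, rfl⟩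
    exact (orbitMk_app ρ g x).symm

end IsAction

section lifting

variable {ρE : G → (E ⟶ E)} {ρB : G → (B ⟶ B)} {ρZ : G → (Z ⟶ Z)} {p : E ⟶ B}

/-- Over a free orbit, a point of `(Z ⊗ E)/G` has exactly one representative with given first
coordinate. This makes equivariant maps `Z ⟶ E` the same as sections of `(Z ⊗ E)/G` over `Z/G`. -/
lemma eq_of_orbitMk_eq (hE : IsAction ρE) (hZ : IsAction ρZ) (free : IsFree ρZ)
    {k : SimplexCategoryᵒᵖ} {z : Z.obj k} {e e' : E.obj k}
    (h : (orbitMk (diagonalAction ρZ ρE)).app k ⟨z, e⟩ =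
      (orbitMk (diagonalAction ρZ ρE)).app k ⟨z, e'⟩) : e = e' := by
  obtain ⟨g, hg⟩ := ((hZ.diagonal hE).orbitMk_eq_iff _ _).1 h
  obtain rfl := free g k z (congrArg Prod.fst hg)
  exact (hE.one_app e).symm.trans (congrArg Prod.snd hg)

/-- The map of twisted products induced by an equivariant map. -/
noncomputable def twistedMap (ρZ : G → (Z ⟶ Z)) (hp : ∀ g, ρE g ≫ p = p ≫ ρB g) :
    orbitSpace (diagonalAction ρZ ρE) ⟶ orbitSpace (diagonalAction ρZ ρB) :=
  orbitDesc (Z ◁ p ≫ orbitMk _) fun g => by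
    ext k ⟨z, e⟩
    refine Eq.trans ?_ (orbitMk_app (diagonalAction ρZ ρB) g (⟨z, p.app k e⟩ : (Z ⊗ B).obj k))
    exact congrArg (fun b => (orbitMk (diagonalAction ρZ ρB)).app k
      (⟨(ρZ g).app k z, b⟩ : (Z ⊗ B).obj k)) (congr_app_apply (hp g) e)

/-- Maps to the twisted product `(Z ⊗ E)/G` lift to `E` over `Z ⊗ B`. -/
lemma exists_twisted_lift (hE : IsAction ρE) (hB : IsAction ρB) (hZ : IsAction ρZ)
    (free : IsFree ρZ) (hp : ∀ g, ρE g ≫ p = p ≫ ρB g)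
    (s : W ⟶ orbitSpace (diagonalAction ρZ ρE)) (t : W ⟶ Z ⊗ B)
    (h : s ≫ twistedMap ρZ hp = t ≫ orbitMk _) :
    ∃ r : W ⟶ E, lift (t ≫ fst _ _) r ≫ orbitMk _ = s ∧ r ≫ p = t ≫ snd _ _ := by
  have H k (w : W.obj k) : ∃ e : E.obj k,
      (orbitMk (diagonalAction ρZ ρE)).app k ⟨(t.app k w).1, e⟩ = s.app k w ∧
        p.app k e = (t.app k w).2 := by
    obtain ⟨⟨z, e⟩, he⟩ := orbitMk_surjective _ (s.app k w)
    have h' := congr_app_apply h w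
    change (twistedMap ρZ hp).app k (s.app k w) = (orbitMk _).app k (t.app k w) at h'
    rw [← he] at h'
    change (orbitMk (diagonalAction ρZ ρB)).app k (⟨z, p.app k e⟩ : (Z ⊗ B).obj k) = _ at h'
    -- Any representative becomes one over `t` after translation by this `g`; uniqueness later gives
    -- naturality.
    obtain ⟨g, hg⟩ := ((hZ.diagonal hB).orbitMk_eq_iff _ _).1 h'
    refine ⟨(ρE g).app k e, ?_, (congr_app_apply (hp g) e).trans (congrArg Prod.snd hg)⟩
    rw [← he, ← hg]
    exact orbitMk_app (diagonalAction ρZ ρE) g (⟨z, e⟩ : (Z ⊗ E).obj k)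
  choose r hr hr' using H
  refine ⟨{ app := fun k => TypeCat.ofHom (r k), naturality := fun k l φ => ?_ },
    hom_ext_apply hr, hom_ext_apply hr'⟩
  ext w
  refine eq_of_orbitMk_eq (z := (t.app l (W.map φ w)).1) hE hZ free ((hr l _).trans ?_)
  refine (NatTrans.naturality_apply s φ w).trans ?_
  rw [← hr k w]
  refine (NatTrans.naturality_apply (orbitMk (diagonalAction ρZ ρE)) φ _).symm.trans ?_
  rw [NatTrans.naturality_apply t φ w]
  rfl

/-- A simplex of `(Z ⊗ B)/G` lifts to `Z ⊗ B`, because the simplices of `Z ⊗ B` surject onto those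
of the quotient. After such a lift, the lifting problem is one for `p`. -/
lemma rlp_twistedMap (hE : IsAction ρE) (hB : IsAction ρB) (hZ : IsAction ρZ)
    (free : IsFree ρZ) (hp : ∀ g, ρE g ≫ p = p ≫ ρB g) (hI : modelCategoryQuillen.I.rlp p) :
    modelCategoryQuillen.I.rlp (twistedMap ρZ hp) := by
  intro _ _ _ hi
  have hi' := hi
  obtain ⟨n⟩ := hi
  refine ⟨fun {s t'} sq => ?_⟩
  obtain ⟨v, hv⟩ := orbitMk_surjective _ (yonedaEquiv t')
  obtain ⟨t, rfl⟩ := yonedaEquiv.surjective v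
  have ht : t ≫ orbitMk _ = t' := yonedaEquiv.injective ((yonedaEquiv_comp _ _).trans hv)
  obtain ⟨r, hr, hr'⟩ := exists_twisted_lift hE hB hZ free hp s (∂Δ[n].ι ≫ t) (by
    rw [sq.w, Category.assoc, ht])
  have := hI _ hi'
  have sq' : CommSq r ∂Δ[n].ι p (t ≫ snd _ _) := ⟨by rw [hr', Category.assoc]⟩
  refine ⟨⟨{ l := lift (t ≫ fst _ _) sq'.lift ≫ orbitMk _, fac_left := ?_, fac_right := ?_ }⟩⟩
  · rw [← hr, comp_lift_assoc, sq'.fac_left, Category.assoc]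
  · rw [← ht, Category.assoc]
    change lift (t ≫ fst _ _) sq'.lift ≫ Z ◁ p ≫ orbitMk _ = _
    rw [lift_whiskerLeft_assoc, sq'.fac_right, ← comp_lift, lift_fst_snd, Category.comp_id]

/-- Equivariant lifting of a free simplicial set against a trivial fibration. -/
theorem exists_equivariant_lift {ρY : G → (Y ⟶ Y)} (hE : IsAction ρE) (hB : IsAction ρB)
    (hZ : IsAction ρZ)
    (free : IsFree ρZ) (hp : ∀ g, ρE g ≫ p = p ≫ ρB g) (hI : modelCategoryQuillen.I.rlp p)
    (i : Y ⟶ Z) (hi : ∀ g, ρY g ≫ i = i ≫ ρZ g)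
    (inj : ∀ k, Function.Injective (i.app k)) (f : Y ⟶ E) (hf : ∀ g, ρY g ≫ f = f ≫ ρE g)
    (b : Z ⟶ B) (hb : ∀ g, ρZ g ≫ b = b ≫ ρB g) (h : f ≫ p = i ≫ b) :
    ∃ l : Z ⟶ E, (∀ g, ρZ g ≫ l = l ≫ ρE g) ∧ i ≫ l = f ∧ l ≫ p = b := by
  -- Passing to quotients turns the equivariant problem into an ordinary one: lift the monomorphism
  -- `i'` against the map of twisted products. No induction on equivariant cells is needed.
  let i' : orbitSpace ρY ⟶ orbitSpace ρZ := orbitDesc (i ≫ orbitMk ρZ) fun g => by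
    rw [reassoc_of% hi]
    congr 1
    exact hom_ext_apply fun k z => orbitMk_app ρZ g z
  have : Mono i' := by
    have hk : ∀ k, Mono (i'.app k) := fun k => by
      rw [mono_iff_injective]
      rintro ⟨x⟩ ⟨y⟩ hxy
      obtain ⟨g, hg⟩ := (hZ.orbitMk_eq_iff _ _).1 hxy
      exact Quot.sound ⟨g, inj k ((congr_app_apply (hi g) x).trans hg)⟩
    exact NatTrans.mono_of_mono_app i'
  let s : orbitSpace ρY ⟶ orbitSpace (diagonalAction ρZ ρE) :=
    orbitDesc (lift i f ≫ orbitMk _) fun g => by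
      rw [comp_lift_assoc, hi, hf]
      exact hom_ext_apply fun k z =>
        orbitMk_app (diagonalAction ρZ ρE) g (⟨i.app k z, f.app k z⟩ : (Z ⊗ E).obj k)
  let t : orbitSpace ρZ ⟶ orbitSpace (diagonalAction ρZ ρB) :=
    orbitDesc (lift (𝟙 Z) b ≫ orbitMk _) fun g => by
      rw [comp_lift_assoc, hb, Category.comp_id]
      exact hom_ext_apply fun k z =>
        orbitMk_app (diagonalAction ρZ ρB) g (⟨z, b.app k z⟩ : (Z ⊗ B).obj k)
  have sq : CommSq s i' (twistedMap ρZ hp) t := ⟨orbitMk_cancel (hom_ext_apply fun k y =>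
    congrArg (fun b => (orbitMk (diagonalAction ρZ ρB)).app k
      (⟨i.app k y, b⟩ : (Z ⊗ B).obj k)) (congr_app_apply h y))⟩
  have hq : (MorphismProperty.monomorphisms SSet.{0}).rlp (twistedMap ρZ hp) := by
    rw [rlp_monomorphisms]
    exact rlp_twistedMap hE hB hZ free hp hI
  have := hq i' (MorphismProperty.monomorphisms.infer_property i')
  -- The section over `Z/G` is converted back into a map `Z ⟶ E`; equivariance follows from
  -- uniqueness of representatives.
  obtain ⟨l, hl, hl'⟩ := exists_twisted_lift hE hB hZ free hp (orbitMk ρZ ≫ sq.lift)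
    (lift (𝟙 Z) b) (by rw [Category.assoc, sq.fac_right]; rfl)
  rw [lift_fst] at hl
  rw [lift_snd] at hl'
  refine ⟨l, fun g => hom_ext_apply fun k z => ?_, hom_ext_apply fun k y => ?_, hl'⟩
  · refine eq_of_orbitMk_eq (z := (ρZ g).app k z) hE hZ free ?_
    refine (congr_app_apply hl ((ρZ g).app k z)).trans (Eq.trans ?_
      (orbitMk_app (diagonalAction ρZ ρE) g (⟨z, l.app k z⟩ : (Z ⊗ E).obj k)).symm)
    refine Eq.trans ?_ (congr_app_apply hl z).symm
    exact congrArg (sq.lift.app k) (orbitMk_app ρZ g z)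
  · refine eq_of_orbitMk_eq (z := i.app k y) hE hZ free ?_
    refine (congr_app_apply hl (i.app k y)).trans ?_
    exact congr_app_apply sq.fac_left ((orbitMk ρY).app k y)

end lifting

end SSet

namespace SSet

open Simplicial Opposite MonoidalCategory CartesianMonoidalCategory

/-! ### Quotient maps -/

/-- A map of simplicial sets which is the quotient by an action. -/
structure IsOrbitMap {G : Type} {Z Q : SSet.{0}} (ρ : G → (Z ⟶ Z)) (π : Z ⟶ Q) : Prop where
  surjective : ∀ k, Function.Surjective (π.app k)
  invariant : ∀ g, ρ g ≫ π = π
  exists_of_eq : ∀ {k} {x y : Z.obj k}, π.app k x = π.app k y → ∃ g, (ρ g).app k x = y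

/-- Maps constant on the fibres of a surjection factor. -/
lemma exists_desc {Z Q W : SSet.{0}} (π : Z ⟶ Q) (hπ : ∀ k, Function.Surjective (π.app k))
    (f : Z ⟶ W) (h : ∀ k (x y : Z.obj k), π.app k x = π.app k y → f.app k x = f.app k y) :
    ∃ f' : Q ⟶ W, π ≫ f' = f := by
  choose s hs using hπ
  refine ⟨{ app := fun k => TypeCat.ofHom fun q => f.app k (s k q)
            naturality := fun k l φ => ?_ },
    hom_ext_apply fun k x => h k _ _ (hs k _)⟩
  ext q
  change f.app l (s l _) = W.map φ (f.app k (s k q))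
  refine Eq.trans (h l _ _ ?_) (NatTrans.naturality_apply f φ (s k q))
  rw [hs, NatTrans.naturality_apply, hs]
  rfl

namespace IsOrbitMap

variable {G : Type} {Z Q W T : SSet.{0}} {ρ : G → (Z ⟶ Z)} {π : Z ⟶ Q} (hπ : IsOrbitMap ρ π)
include hπ

lemma exists_desc (f : Z ⟶ W) (hf : ∀ g, ρ g ≫ f = f) : ∃ f' : Q ⟶ W, π ≫ f' = f :=
  SSet.exists_desc π hπ.surjective f fun k x y h => by
    obtain ⟨g, rfl⟩ := hπ.exists_of_eq h
    exact (congr_app_apply (hf g) x).symm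

lemma exists_desc_whiskerRight (f : Z ⊗ T ⟶ W) (hf : ∀ g, ρ g ▷ T ≫ f = f) :
    ∃ f' : Q ⊗ T ⟶ W, π ▷ T ≫ f' = f :=
  SSet.exists_desc (π ▷ T) (fun k ⟨q, t⟩ => by
      obtain ⟨z, rfl⟩ := hπ.surjective k q
      exact ⟨⟨z, t⟩, rfl⟩) f fun k ⟨x, t⟩ ⟨y, t'⟩ h => by
    obtain ⟨g, rfl⟩ := hπ.exists_of_eq (congrArg Prod.fst h)
    obtain rfl : t = t' := congrArg Prod.snd h
    exact (congr_app_apply (hf g) (⟨x, t⟩ : (Z ⊗ T).obj k)).symm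

lemma cancel {f f' : Q ⟶ W} (h : π ≫ f = π ≫ f') : f = f' :=
  hom_ext_apply fun k q => by
    obtain ⟨z, rfl⟩ := hπ.surjective k q
    exact congr_app_apply h z

/-- Invariant homotopies descend to the quotient. -/
lemma homotopic {f f' : Q ⟶ W} (h : Z ⊗ Δ[1] ⟶ W) (hinv : ∀ g, ρ g ▷ Δ[1] ≫ h = h)
    (h₀ : ι₀ ≫ h = π ≫ f) (h₁ : ι₁ ≫ h = π ≫ f') : Homotopic f f' := by
  obtain ⟨h', rfl⟩ := hπ.exists_desc_whiskerRight h hinv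
  exact ⟨h', hπ.cancel h₀, hπ.cancel h₁⟩

end IsOrbitMap

/-! ### Codiscrete simplicial sets and the universal bundle -/

/-- The codiscrete simplicial set on a type: a simplex is a family of vertices. -/
def codiscrete (S : Type) : SSet.{0} where
  obj k := Fin (k.unop.len + 1) → S
  map φ := TypeCat.ofHom fun c a => c (φ.unop.toOrderHom a)

/-- The homotopy of maps to a codiscrete simplicial set which goes from the last variable to
the first one. -/
noncomputable def codiscreteHomotopy (S : Type) :
    (codiscrete S ⊗ Δ[1]) ⊗ codiscrete S ⟶ codiscrete S where
  app k := TypeCat.ofHom fun v a =>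
    if stdSimplex.asOrderHom (n := 1) v.1.2 a = 0 then v.2 a else v.1.1 a

section

variable {G : Type} [Group G]

/-- The action of `G` on `EG` by left multiplication. -/
def universalAction (G : Type) [Group G] (g : G) : codiscrete G ⟶ codiscrete G where
  app k := TypeCat.ofHom fun c a => g * c a

lemma isAction_universalAction : IsAction (universalAction G) where
  one := by
    ext k c
    exact funext fun a => one_mul _
  mul g h := by
    ext k c
    exact funext fun a => mul_assoc _ _ _

lemma isFree_universalAction : IsFree (universalAction G) := fun _ _ x h =>
  mul_eq_right.1 (congrFun h 0 : _ * x 0 = x 0)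

/-- The universal bundle `EG ⟶ BG`. -/
def universalBundle (G : Type) [Group G] : codiscrete G ⟶ classifyingSpace G where
  app k := TypeCat.ofHom fun c => classifyingSpaceMk c
  naturality k l φ := by
    ext c
    exact classifyingSpace_ext fun a b h => rfl

/-- A simplex of `BG` has a unique lift to `EG` with given vertex `0`, and lifts with different
initial vertices differ by a left translation. -/
lemma isOrbitMap_universalBundle : IsOrbitMap (universalAction G) (universalBundle G) where
  surjective k x := by
    refine ⟨fun a => (edgeLabel x (Fin.zero_le a))⁻¹, classifyingSpace_ext fun a b h => ?_⟩
    refine (edgeLabel_mk _ h).trans ?_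
    rw [inv_inv, mul_inv_eq_iff_eq_mul]
    exact edgeLabel_trans x (Fin.zero_le a) h
  invariant g := by
    ext k c
    refine classifyingSpace_ext fun a b h => ?_
    change (g * c b)⁻¹ * (g * c a) = (c b)⁻¹ * c a
    group
  exists_of_eq {k c c'} h := by
    refine ⟨c' 0 * (c 0)⁻¹, funext fun a => ?_⟩
    have : (c a)⁻¹ * c 0 = (c' a)⁻¹ * c' 0 :=
      congrArg (fun x : (classifyingSpace G).obj k => edgeLabel x (Fin.zero_le a)) h
    change c' 0 * (c 0)⁻¹ * c a = c' a
    rw [← mul_right_inj (c' a)⁻¹, ← mul_assoc, ← mul_assoc, ← this]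
    group

/-- A free action admits an equivariant map to `EG`. -/
lemma exists_map_to_universal {Z : SSet.{0}} {ρ : G → (Z ⟶ Z)} (hρ : IsAction ρ)
    (free : IsFree ρ) :
    ∃ c : Z ⟶ codiscrete G, ∀ g, ρ g ≫ c = c ≫ universalAction G g := by
  -- On vertices, choose a representative of each orbit and record the element of `G` moving it to
  -- `x`. Freeness makes this equivariant, and a simplex of `EG` is just its family of vertices.
  have H (x : Z.obj (op ⦋0⦌)) : ∃ g : G, (ρ g).app _ ((orbitMk ρ).app _ x).out = x :=
    (hρ.orbitMk_eq_iff _ _).1 (Quot.out_eq _)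
  choose c hc using H
  have hc' (g : G) (x : Z.obj (op ⦋0⦌)) : c ((ρ g).app _ x) = g * c x := by
    have h₁ := hc ((ρ g).app _ x)
    rw [orbitMk_app] at h₁
    have h₂ : (ρ (g * c x)).app _ ((orbitMk ρ).app _ x).out = (ρ g).app _ x := by
      rw [hρ.mul_app, hc]
    rw [← h₁] at h₂
    have h₃ := congrArg ((ρ (c ((ρ g).app _ x))⁻¹).app _) h₂
    rw [hρ.inv_app, ← hρ.mul_app] at h₃
    exact (inv_mul_eq_one.1 (free _ _ _ h₃))
  refine ⟨{ app := fun k => TypeCat.ofHom fun x a =>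
              c (Z.map (opMk (k := k) (l := op ⦋0⦌) (OrderHom.const _ a)) x)
            naturality := fun k l φ => ?_ }, fun g => ?_⟩
  · ext x
    refine funext fun a => congrArg c ?_
    exact (Functor.map_comp_apply _ _ _ _).symm
  · ext k x
    refine funext fun a => ?_
    change c (Z.map _ ((ρ g).app k x)) = g * c _
    rw [← hc', NatTrans.naturality_apply]

end

/-! ### Weakly contractible simplicial sets -/

/-- A map to a discrete simplicial set is determined on vertices, and takes the same value at both
ends of the edge traced by a vertex. -/
lemma Homotopic.eq_of_discrete {X : SSet.{0}} {S : Type} {f g : X ⟶ discrete S}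
    (h : Homotopic f g) : f = g := by
  obtain ⟨h, rfl, rfl⟩ := h
  refine hom_ext_apply fun k x => ?_
  let x₀ := X.map (opMk (k := k) (l := op ⦋0⦌) (OrderHom.const _ 0)) x
  have hx (f : X ⟶ discrete S) : f.app k x = f.app _ x₀ :=
    (NatTrans.naturality_apply f (opMk (k := k) (l := op ⦋0⦌) (OrderHom.const _ 0)) x).symm
  rw [hx, hx]
  let e : (X ⊗ Δ[1] : SSet.{0}).obj (op ⦋1⦌) :=
    ⟨X.map (opMk (k := op ⦋0⦌) (l := op ⦋1⦌) (OrderHom.const _ 0)) x₀,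
      stdMk (k := op ⦋1⦌) OrderHom.id⟩
  have he (i : Fin 2) : h.app (op ⦋1⦌) e =
      h.app (op ⦋0⦌)
        (⟨x₀, stdMk (k := op ⦋0⦌) (OrderHom.const _ i)⟩ : (X ⊗ Δ[1] : SSet.{0}).obj _) := by
    refine (NatTrans.naturality_apply h
      (opMk (k := op ⦋1⦌) (l := op ⦋0⦌) (OrderHom.const _ i)) e).symm.trans (congrArg _ ?_)
    refine Prod.ext ?_ rfl
    change X.map _ (X.map _ x₀) = x₀
    rw [← Functor.map_comp_apply]
    refine Eq.trans (congrArg (fun φ => X.map φ x₀) (?_ : _ = 𝟙 (op ⦋0⦌)))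
      (Functor.map_id_apply X _ x₀)
    exact Quiver.Hom.unop_inj (by ext a; fin_cases a; rfl)
  exact (he 0).symm.trans (he 1)

/-- If `A` had no vertices it would be empty. The two constant maps to a two-point discrete set
would then agree on `A`, hence on the point. -/
lemma IsWeaklyContractible.nonempty {A : SSet.{0}} (hA : A.IsWeaklyContractible) :
    Nonempty (A.obj (op ⦋0⦌)) := by
  by_contra h
  rw [not_nonempty_iff] at h
  have hA' := ((bijective_precomp_iff (K := discrete Bool) A.toPoint).1
    (hA _ inferInstance)).1 ((Functor.const _).map (TypeCat.ofHom fun _ => true))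
      ((Functor.const _).map (TypeCat.ofHom fun _ => false))
  refine Bool.noConfusion (congr_app_apply (hA' ?_).eq_of_discrete (k := op ⦋0⦌) PUnit.unit)
  convert Homotopic.refl _ using 1
  refine hom_ext_apply fun k x => ?_
  exact (h.false (A.map (opMk (k := k) (l := op ⦋0⦌) (OrderHom.const _ 0)) x)).elim

/-- A map out of a product with a weakly contractible simplicial set is homotopic to a map which
is constant in this variable. -/
lemma IsWeaklyContractible.homotopic {A X K : SSet.{0}} [KanComplex K] (hA : A.IsWeaklyContractible)
    (a : A.obj (op ⦋0⦌)) (F : X ⊗ A ⟶ K) :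
    Homotopic (fst X A ≫ lift (𝟙 X) (const a) ≫ F) F := by
  -- Test weak contractibility on the Kan complex `K^X`: the curried `F` is homotopic to a constant
  -- map, and restricting that homotopy to `a` identifies the constant.
  obtain ⟨c, hc⟩ := ((bijective_precomp_iff (K := (ihom X).obj K) A.toPoint).1
    (hA _ inferInstance)).2 (MonoidalClosed.curry F)
  obtain ⟨h, h₀, h₁⟩ := (hc.comp_left (const a : A ⟶ A)).symm.trans hc
  refine ⟨(α_ _ _ _).hom ≫ MonoidalClosed.uncurry h, ?_, ?_⟩
  · change X ◁ ι₀ ≫ MonoidalClosed.uncurry h = _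
    rw [← MonoidalClosed.uncurry_natural_left, h₀, MonoidalClosed.uncurry_natural_left,
      MonoidalClosed.uncurry_curry]
    rfl
  · change X ◁ ι₁ ≫ MonoidalClosed.uncurry h = _
    rw [← MonoidalClosed.uncurry_natural_left, h₁, MonoidalClosed.uncurry_curry]

end SSet

namespace SSet

open Simplicial Opposite MonoidalCategory CartesianMonoidalCategory

/-! ### Quotients of weakly contractible simplicial sets by free actions -/

variable {G : Type} [Group G] {A K Z : SSet.{0}}

/-- The constant maps `K ⟶ K^A`. -/
noncomputable def constMap (A K : SSet.{0}) : K ⟶ (ihom A).obj K := powerLift (fst K A)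

/-- The evaluation of maps at a point. -/
noncomputable def evalAt (K : SSet.{0}) (a : A.obj (op ⦋0⦌)) : (ihom A).obj K ⟶ K :=
  lift (𝟙 _) (const a) ≫ powerEv A K

lemma comp_evalAt (a : A.obj (op ⦋0⦌)) (f : Z ⟶ (ihom A).obj K) :
    f ≫ evalAt K a = lift (𝟙 _) (const a) ≫ f ▷ A ≫ powerEv A K := rfl

lemma constMap_evalAt (a : A.obj (op ⦋0⦌)) : constMap A K ≫ evalAt K a = 𝟙 K := by
  rw [comp_evalAt, constMap, powerLift_whiskerRight_ev, lift_fst]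

/-- Homotopies of maps to an internal hom. -/
lemma Homotopic.power {f g : Z ⟶ (ihom A).obj K}
    (h : Homotopic (f ▷ A ≫ powerEv A K) (g ▷ A ≫ powerEv A K)) : Homotopic f g := by
  obtain ⟨h, h₀, h₁⟩ := h
  let s : (Z ⊗ Δ[1]) ⊗ A ⟶ (Z ⊗ A) ⊗ Δ[1] :=
    lift (lift (fst _ _ ≫ fst _ _) (snd _ _)) (fst _ _ ≫ snd _ _)
  refine ⟨powerLift (s ≫ h), power_hom_ext ?_, power_hom_ext ?_⟩
  · rw [comp_whiskerRight_assoc, powerLift_whiskerRight_ev, ← h₀]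
    rfl
  · rw [comp_whiskerRight_assoc, powerLift_whiskerRight_ev, ← h₁]
    rfl

/-- Evaluation at a vertex `a` is a strict retraction of the constant maps `K ⟶ K^A`, and a
deformation retraction by weak contractibility of `A`. -/
lemma rlp_mappingPathStart_constMap [KanComplex K] (hA : A.IsWeaklyContractible) :
    modelCategoryQuillen.I.rlp (mappingPathStart (constMap A K)) := by
  obtain ⟨a⟩ := hA.nonempty
  have h : Homotopic (evalAt K a ≫ constMap A K) (𝟙 _) := by
    refine Homotopic.power ?_
    rw [constMap, comp_whiskerRight_assoc, powerLift_whiskerRight_ev, id_whiskerRight,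
      Category.id_comp]
    exact hA.homotopic a (powerEv A K)
  obtain ⟨D, hD₀, hD₁⟩ := h
  exact rlp_mappingPathStart (constMap_evalAt a) D hD₀ hD₁

section action

variable {ρ : G → (A ⟶ A)}

/-- The action on `K^A` induced by an action on `A`. -/
noncomputable def powerAction (ρ : G → (A ⟶ A)) (K : SSet.{0}) (g : G) :
    (ihom A).obj K ⟶ (ihom A).obj K :=
  powerLift (_ ◁ ρ g⁻¹ ≫ powerEv A K)

lemma powerAction_ev (g : G) :
    powerAction ρ K g ▷ A ≫ powerEv A K = _ ◁ ρ g⁻¹ ≫ powerEv A K :=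
  powerLift_whiskerRight_ev _

lemma isAction_powerAction (hρ : IsAction ρ) : IsAction (powerAction ρ K) where
  one := power_hom_ext (by
    rw [powerAction_ev, inv_one, hρ.one, MonoidalCategory.whiskerLeft_id, id_whiskerRight])
  mul g h := power_hom_ext (by
    rw [powerAction_ev, comp_whiskerRight_assoc, powerAction_ev, ← whisker_exchange_assoc,
      powerAction_ev, mul_inv_rev, hρ.mul, MonoidalCategory.whiskerLeft_comp_assoc])

/-- Constant maps are fixed, so the action on the mapping path space can be taken trivial on the
`K`-component. The projection to `K` of an equivariant map is then invariant. -/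
lemma constMap_powerAction (g : G) : constMap A K ≫ powerAction ρ K g = constMap A K :=
  power_hom_ext (by
    rw [comp_whiskerRight_assoc, powerAction_ev, ← whisker_exchange_assoc, constMap,
      powerLift_whiskerRight_ev, whiskerLeft_fst])

/-- The induced action on the mapping path space of the constant maps. -/
noncomputable def mappingPathAction (ρ : G → (A ⟶ A)) (K : SSet.{0}) (g : G) :
    mappingPath (constMap A K) ⟶ mappingPath (constMap A K) :=
  mappingPathLift (pullback.fst _ _) (mappingPathHomotopy (𝟙 _) ≫ powerAction ρ K g) (by
    rw [reassoc_of% ι₁_mappingPathHomotopy (𝟙 (mappingPath (constMap A K))),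
      constMap_powerAction])

lemma mappingPathAction_fst (g : G) :
    mappingPathAction ρ K g ≫ pullback.fst _ _ = pullback.fst _ _ :=
  mappingPathLift_fst _ _ _

lemma mappingPathHomotopy_action (f : Z ⟶ mappingPath (constMap A K)) (g : G) :
    mappingPathHomotopy (f ≫ mappingPathAction ρ K g) =
      mappingPathHomotopy f ≫ powerAction ρ K g := by
  rw [mappingPathHomotopy_comp, mappingPathAction, mappingPathHomotopy_lift,
    ← Category.assoc, ← mappingPathHomotopy_comp, Category.comp_id]

lemma mappingPathAction_start (g : G) :
    mappingPathAction ρ K g ≫ mappingPathStart (constMap A K) =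
      mappingPathStart (constMap A K) ≫ powerAction ρ K g := by
  rw [← ι₀_mappingPathHomotopy, mappingPathAction, mappingPathHomotopy_lift, ← Category.assoc,
    ι₀_mappingPathHomotopy, Category.id_comp]

lemma isAction_mappingPathAction (hρ : IsAction ρ) : IsAction (mappingPathAction ρ K) where
  one := mappingPath_hom_ext (by rw [mappingPathAction_fst, Category.id_comp]) (by
    rw [← Category.id_comp (mappingPathAction ρ K 1), mappingPathHomotopy_action,
      (isAction_powerAction hρ).one, Category.comp_id])
  mul g h := mappingPath_hom_ext
    (by rw [Category.assoc, mappingPathAction_fst, mappingPathAction_fst, mappingPathAction_fst])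
    (by
    rw [mappingPathHomotopy_action, ← Category.id_comp (mappingPathAction ρ K (g * h)),
      ← Category.id_comp (mappingPathAction ρ K h), mappingPathHomotopy_action,
      mappingPathHomotopy_action, (isAction_powerAction hρ).mul, Category.assoc])

/-- Maps `Z ⊗ A ⟶ K` invariant under the diagonal action correspond to equivariant maps. -/
lemma powerLift_equivariant {σ : G → (Z ⟶ Z)} {F : Z ⊗ A ⟶ K}
    (hF : ∀ g, σ g ▷ A ≫ F = Z ◁ ρ g⁻¹ ≫ F) (g : G) :
    σ g ≫ powerLift F = powerLift F ≫ powerAction ρ K g := power_hom_ext (by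
  rw [comp_whiskerRight_assoc, powerLift_whiskerRight_ev, comp_whiskerRight_assoc,
    powerAction_ev, ← whisker_exchange_assoc, powerLift_whiskerRight_ev, hF])

/-- A lift of a map to `K^A` to the mapping path space. -/
structure IsEquivariantLift (ρ : G → (A ⟶ A)) (σ : G → (Z ⟶ Z)) (F : Z ⊗ A ⟶ K)
    (l : Z ⟶ mappingPath (constMap A K)) : Prop where
  equivariant : ∀ g, σ g ≫ l = l ≫ mappingPathAction ρ K g
  start : l ≫ mappingPathStart (constMap A K) = powerLift F

lemma IsEquivariantLift.invariant {σ : G → (Z ⟶ Z)} {F : Z ⊗ A ⟶ K}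
    {l : Z ⟶ mappingPath (constMap A K)} (hl : IsEquivariantLift ρ σ F l) (g : G) :
    σ g ≫ l ≫ pullback.fst _ _ = l ≫ pullback.fst _ _ := by
  rw [reassoc_of% hl.equivariant g, mappingPathAction_fst]

/-- Equivariant lifting from the empty simplicial set, against the trivial fibration onto `K^A`. -/
lemma exists_isEquivariantLift [KanComplex K] (hA : A.IsWeaklyContractible) (hρ : IsAction ρ)
    {σ : G → (Z ⟶ Z)} (hσ : IsAction σ) (free : IsFree σ) {F : Z ⊗ A ⟶ K}
    (hF : ∀ g, σ g ▷ A ≫ F = Z ◁ ρ g⁻¹ ≫ F) : ∃ l, IsEquivariantLift ρ σ F l := by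
  let e (W : SSet.{0}) : discrete Empty ⟶ W :=
    { app := fun _ => TypeCat.ofHom fun x => x.elim
      naturality := fun _ _ _ => by ext x; exact x.elim }
  have he {W : SSet.{0}} (f g : discrete Empty ⟶ W) : f = g := by ext _ x; exact x.elim
  obtain ⟨l, h₁, -, h₂⟩ := exists_equivariant_lift (isAction_mappingPathAction hρ)
    (isAction_powerAction hρ) hσ free mappingPathAction_start (rlp_mappingPathStart_constMap hA)
    (ρY := fun _ => 𝟙 _) (e Z) (fun _ => he _ _) (fun _ x => x.elim) (e _) (fun _ => he _ _)
    (powerLift F) (powerLift_equivariant hF) (he _ _)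
  exact ⟨l, h₁, h₂⟩

/-- Two equivariant lifts of homotopic maps are equivariantly homotopic. -/
lemma exists_equivariant_homotopy [KanComplex K] (hA : A.IsWeaklyContractible) (hρ : IsAction ρ)
    {σ : G → (Z ⟶ Z)} (hσ : IsAction σ) (free : IsFree σ) {F : (Z ⊗ Δ[1]) ⊗ A ⟶ K}
    (hF : ∀ g, (σ g ▷ Δ[1]) ▷ A ≫ F = _ ◁ ρ g⁻¹ ≫ F)
    {l₀ l₁ : Z ⟶ mappingPath (constMap A K)} (h₀ : IsEquivariantLift ρ σ (ι₀ ▷ A ≫ F) l₀)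
    (h₁ : IsEquivariantLift ρ σ (ι₁ ▷ A ≫ F) l₁) :
    ∃ h : Z ⊗ Δ[1] ⟶ K, (∀ g, σ g ▷ Δ[1] ≫ h = h) ∧
      ι₀ ≫ h = l₀ ≫ pullback.fst _ _ ∧ ι₁ ≫ h = l₁ ≫ pullback.fst _ _ := by
  -- `Z ⊗ discrete Bool` plays the role of `Z ⊗ ∂Δ[1]`: the two lifts are prescribed on it, and the
  -- lift is extended over `Z ⊗ Δ[1]`.
  let ends {W : SSet.{0}} (f₀ f₁ : Z ⟶ W) : Z ⊗ discrete Bool ⟶ W :=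
    { app := fun k => TypeCat.ofHom fun v => bif v.2 then f₁.app k v.1 else f₀.app k v.1
      naturality := fun k l φ => by
        ext ⟨z, b⟩
        cases b
        · exact NatTrans.naturality_apply f₀ φ z
        · exact NatTrans.naturality_apply f₁ φ z }
  have hends {W : SSet.{0}} {f g : Z ⊗ discrete Bool ⟶ W}
      (h₀ : ∀ k (z : Z.obj k), f.app k ⟨z, false⟩ = g.app k ⟨z, false⟩)
      (h₁ : ∀ k (z : Z.obj k), f.app k ⟨z, true⟩ = g.app k ⟨z, true⟩) : f = g := by
    refine hom_ext_apply fun k ⟨z, b⟩ => ?_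
    cases b
    · exact h₀ k z
    · exact h₁ k z
  have start {f : Z ⟶ Z ⊗ Δ[1]} : f ≫ powerLift F = powerLift (f ▷ A ≫ F) := power_hom_ext (by
    rw [comp_whiskerRight_assoc, powerLift_whiskerRight_ev, powerLift_whiskerRight_ev])
  have hσ' : IsAction fun g => σ g ▷ Δ[1] :=
    { one := by rw [hσ.one, id_whiskerRight]
      mul := fun g h => by rw [hσ.mul, comp_whiskerRight] }
  obtain ⟨l, hl, hl', -⟩ := exists_equivariant_lift (isAction_mappingPathAction hρ)
    (isAction_powerAction hρ) hσ' (fun g k x h => free g k x.1 (congrArg Prod.fst h))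
    mappingPathAction_start (rlp_mappingPathStart_constMap hA)
    (ρY := fun g => σ g ▷ discrete Bool) (ends ι₀ ι₁)
    (fun g => hends (fun _ _ => rfl) (fun _ _ => rfl))
    (fun k => by
      rintro ⟨z, b⟩ ⟨z', b'⟩ h
      cases b <;> cases b'
      · exact congrArg (fun v => (v.1, false)) h
      · exact (ι₀_ne_ι₁ _ _ h).elim
      · exact (ι₀_ne_ι₁ _ _ h.symm).elim
      · exact congrArg (fun v => (v.1, true)) h)
    (ends l₀ l₁)
    (fun g => hends (fun _ z => congr_app_apply (h₀.equivariant g) z)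
      (fun _ z => congr_app_apply (h₁.equivariant g) z))
    (powerLift F) (powerLift_equivariant hF)
    (hends (fun _ z => congr_app_apply (h₀.start.trans start.symm) z)
      (fun _ z => congr_app_apply (h₁.start.trans start.symm) z))
  refine ⟨l ≫ pullback.fst _ _, fun g => ?_, ?_, ?_⟩
  · rw [reassoc_of% hl g, mappingPathAction_fst]
  · rw [← Category.assoc]
    congr 1
    exact hom_ext_apply fun k z => congr_app_apply hl' (⟨z, false⟩ : (Z ⊗ discrete Bool).obj k)
  · rw [← Category.assoc]
    congr 1
    exact hom_ext_apply fun k z => congr_app_apply hl' (⟨z, true⟩ : (Z ⊗ discrete Bool).obj k)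

/-- The map of quotients induced by an equivariant map `A ⟶ EG`, with `A` weakly contractible
and free, is a weak equivalence. -/
theorem isKanWeakEquivalence_of_free {Q : SSet.{0}} (hA : A.IsWeaklyContractible)
    (hρ : IsAction ρ) {π : A ⟶ Q} (hπ : IsOrbitMap ρ π) {c : A ⟶ codiscrete G}
    (hc : ∀ g, ρ g ≫ c = c ≫ universalAction G g) {w : Q ⟶ classifyingSpace G}
    (hw : π ≫ w = c ≫ universalBundle G) : IsKanWeakEquivalence w := by
  intro K _
  have hG := isOrbitMap_universalBundle (G := G)
  -- every invariant map from `A` corresponds to a map from `BG`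
  have snd_inv (ψ : Q ⟶ K) (g : G) :
      universalAction G g ▷ A ≫ snd (codiscrete G) A ≫ π ≫ ψ =
        codiscrete G ◁ ρ g⁻¹ ≫ snd (codiscrete G) A ≫ π ≫ ψ := by
    rw [whiskerRight_snd_assoc, whiskerLeft_snd_assoc, reassoc_of% hπ.invariant]
  have canonical (χ : classifyingSpace G ⟶ K) : ∃ l, IsEquivariantLift ρ (universalAction G)
      (snd (codiscrete G) A ≫ π ≫ w ≫ χ) l ∧ l ≫ pullback.fst _ _ = universalBundle G ≫ χ := by
    -- The vertexwise homotopy of `EG` from `c a` to `x` is equivariant for the diagonal action.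
    -- Projected to `BG`, it joins `χ (w (π a))` to `χ` of the image of `x`, so it exhibits `χ`
    -- itself as a rectification of `w ≫ χ`.
    let F : (codiscrete G ⊗ Δ[1]) ⊗ A ⟶ K :=
      _ ◁ c ≫ codiscreteHomotopy G ≫ universalBundle G ≫ χ
    have hF (g) : (universalAction G g ▷ Δ[1]) ▷ A ≫ F = _ ◁ ρ g⁻¹ ≫ F := by
      refine hom_ext_apply fun k ⟨⟨x, t⟩, a⟩ => ?_
      have h₁ : c.app k ((ρ g⁻¹).app k a) = fun i => g⁻¹ * c.app k a i :=
        congr_app_apply (hc g⁻¹) a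
      have h₂ (y : (codiscrete G).obj k) : (universalBundle G).app k (fun i => g * y i) =
        (universalBundle G).app k y := congr_app_apply (hG.invariant g) y
      change χ.app k ((universalBundle G).app k ((codiscreteHomotopy G).app k _)) =
        χ.app k ((universalBundle G).app k ((codiscreteHomotopy G).app k
          ⟨⟨x, t⟩, c.app k ((ρ g⁻¹).app k a)⟩))
      rw [h₁]
      refine Eq.trans ?_ (congrArg (χ.app k) (h₂ _))
      refine congrArg (fun y => χ.app k ((universalBundle G).app k y)) (funext fun i => ?_)
      change (if stdSimplex.asOrderHom (n := 1) t i = 0 then _ else _) =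
        g * (if stdSimplex.asOrderHom (n := 1) t i = 0 then _ else _)
      split_ifs
      · exact (mul_inv_cancel_left _ _).symm
      · rfl
    have hF₁ : ι₁ ▷ A ≫ F = fst _ _ ≫ universalBundle G ≫ χ := by
      refine hom_ext_apply fun k ⟨x, a⟩ => ?_
      exact congrArg (fun y => χ.app k ((universalBundle G).app k y))
        (funext fun i => if_neg (t := c.app k a i) (one_ne_zero (α := Fin 2)))
    have hF₀ : ι₀ ▷ A ≫ F = snd _ _ ≫ c ≫ universalBundle G ≫ χ := by
      refine hom_ext_apply fun k ⟨x, a⟩ => ?_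
      exact congrArg (fun y => χ.app k ((universalBundle G).app k y))
        (funext fun i => if_pos (e := x i) (Eq.refl (0 : Fin 2)))
    refine ⟨mappingPathLift (universalBundle G ≫ χ) (powerLift F) ?_,
      ⟨fun g => mappingPath_hom_ext ?_ ?_, ?_⟩, mappingPathLift_fst _ _ _⟩
    · refine power_hom_ext ?_
      rw [comp_whiskerRight_assoc, powerLift_whiskerRight_ev, hF₁, comp_whiskerRight_assoc,
        constMap, powerLift_whiskerRight_ev, whiskerRight_fst]
    · rw [Category.assoc, mappingPathLift_fst, Category.assoc, mappingPathAction_fst,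
        mappingPathLift_fst, ← Category.assoc, hG.invariant]
    · rw [mappingPathHomotopy_action, mappingPathHomotopy_comp, mappingPathHomotopy_lift,
        powerLift_equivariant (σ := fun g => universalAction G g ▷ Δ[1]) hF]
    · rw [← ι₀_mappingPathHomotopy, mappingPathHomotopy_lift]
      refine power_hom_ext ?_
      rw [comp_whiskerRight_assoc, powerLift_whiskerRight_ev, hF₀, powerLift_whiskerRight_ev,
        reassoc_of% hw]
  refine (bijective_precomp_iff w).2 ⟨fun χ χ' h => ?_, fun ψ => ?_⟩
  -- Injectivity: a homotopy between `w ≫ χ` and `w ≫ χ'` lifts to an invariant homotopy between the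
  -- two canonical rectifications, and this descends to `BG`.
  · obtain ⟨l, hl, hχ⟩ := canonical χ
    obtain ⟨l', hl', hχ'⟩ := canonical χ'
    obtain ⟨H, hH₀, hH₁⟩ := h
    obtain ⟨h, hh, hh₀, hh₁⟩ := exists_equivariant_homotopy hA hρ isAction_universalAction
      isFree_universalAction (F := lift (snd _ _ ≫ π) (fst _ _ ≫ snd _ _) ≫ H) (fun g =>
        hom_ext_apply fun k ⟨⟨x, t⟩, a⟩ => congrArg (fun q => H.app k (⟨q, t⟩ : (Q ⊗ Δ[1]).obj k))
          (congr_app_apply (hπ.invariant g⁻¹) a).symm) (l₀ := l) (l₁ := l') (by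
        rw [← hH₀] at hl
        exact hl) (by
        rw [← hH₁] at hl'
        exact hl')
    exact hG.homotopic h hh (hh₀.trans hχ) (hh₁.trans hχ')
  -- Surjectivity: rectify `(x, a) ↦ ψ (π a)` to an invariant map `EG ⟶ K`, which descends to `χ`.
  · obtain ⟨l, hl⟩ := exists_isEquivariantLift hA hρ isAction_universalAction
      isFree_universalAction (snd_inv ψ)
    obtain ⟨χ, hχ⟩ := hG.exists_desc _ hl.invariant
    refine ⟨χ, Homotopic.symm ?_⟩
    -- The path attached to `c a`, evaluated at `a` itself, runs from `ψ (π a)` to `χ (w (π a))`.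
    -- The actions on `K^A` and on `A` cancel, so it descends to `Q`.
    let N := lift (c ▷ Δ[1] ≫ mappingPathHomotopy l) (fst A Δ[1]) ≫ powerEv A K
    refine hπ.homotopic N (fun g => ?_) ?_ ?_
    · refine hom_ext_apply fun k ⟨a, t⟩ => ?_
      have h₁ : c.app k ((ρ g).app k a) = (universalAction G g).app k (c.app k a) :=
        congr_app_apply (hc g) a
      have h₂ : universalAction G g ▷ Δ[1] ≫ mappingPathHomotopy l =
          mappingPathHomotopy l ≫ powerAction ρ K g := by
        rw [← mappingPathHomotopy_comp, hl.equivariant, mappingPathHomotopy_action]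
      change (powerEv A K).app k ⟨(mappingPathHomotopy l).app k
        ⟨c.app k ((ρ g).app k a), t⟩, (ρ g).app k a⟩ = _
      rw [h₁]
      refine (congrArg (fun y => (powerEv A K).app k
        (⟨y, (ρ g).app k a⟩ : ((ihom A).obj K ⊗ A).obj k)) (congr_app_apply h₂
          (⟨c.app k a, t⟩ : (codiscrete G ⊗ Δ[1]).obj k))).trans ?_
      refine (congr_app_apply (powerAction_ev (ρ := ρ) (K := K) g)
        (⟨_, (ρ g).app k a⟩ : ((ihom A).obj K ⊗ A).obj k)).trans ?_
      exact congrArg (fun y => (powerEv A K).app k (⟨_, y⟩ : ((ihom A).obj K ⊗ A).obj k))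
        (hρ.inv_app g a)
    · refine hom_ext_apply fun k a => ?_
      refine (congrArg (fun y => (powerEv A K).app k (⟨y, a⟩ : ((ihom A).obj K ⊗ A).obj k))
        (congr_app_apply ((ι₀_mappingPathHomotopy l).trans hl.start) (c.app k a))).trans ?_
      exact congr_app_apply (powerLift_whiskerRight_ev (snd (codiscrete G) A ≫ π ≫ ψ))
        (⟨c.app k a, a⟩ : (codiscrete G ⊗ A).obj k)
    · refine hom_ext_apply fun k a => ?_
      refine (congrArg (fun y => (powerEv A K).app k (⟨y, a⟩ : ((ihom A).obj K ⊗ A).obj k))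
        (congr_app_apply (ι₁_mappingPathHomotopy l) (c.app k a))).trans ?_
      refine (congr_app_apply (powerLift_whiskerRight_ev (fst K A))
        (⟨(l ≫ pullback.fst _ _).app k (c.app k a), a⟩ : (K ⊗ A).obj k)).trans ?_
      refine (congr_app_apply hχ (c.app k a)).symm.trans ?_
      exact congrArg (χ.app k) (congr_app_apply hw a).symm

end action

end SSet

namespace SSet

open Simplicial Opposite MonoidalCategory CartesianMonoidalCategory

/-! ### Weak equivalences, compositions and coproducts -/

variable {X Y Z K : SSet.{0}}

lemma HoClass.precomp_comp (f : X ⟶ Y) (g : Y ⟶ Z) (K : SSet.{0}) :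
    HoClass.precomp (f ≫ g) K = HoClass.precomp f K ∘ HoClass.precomp g K := by
  funext x
  induction x using Quot.ind with
  | mk h => exact congrArg (Quot.mk _) (Category.assoc f g h)

lemma HoClass.precomp_id (X K : SSet.{0}) : HoClass.precomp (𝟙 X) K = id := by
  funext x
  induction x using Quot.ind with
  | mk h => exact congrArg (Quot.mk _) (Category.id_comp h)

namespace IsKanWeakEquivalence

lemma comp {f : X ⟶ Y} {g : Y ⟶ Z} (hf : IsKanWeakEquivalence f) (hg : IsKanWeakEquivalence g) :
    IsKanWeakEquivalence (f ≫ g) := fun K hK => by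
  rw [HoClass.precomp_comp]
  exact (hf K hK).comp (hg K hK)

lemma of_comp {f : X ⟶ Y} {g : Y ⟶ Z} (hf : IsKanWeakEquivalence f)
    (hfg : IsKanWeakEquivalence (f ≫ g)) : IsKanWeakEquivalence g := fun K hK => by
  have h := hfg K hK
  rw [HoClass.precomp_comp] at h
  exact (Function.Bijective.of_comp_iff' (hf K hK) _).1 h

lemma of_iso (e : X ≅ Y) : IsKanWeakEquivalence e.hom := fun K _ => by
  refine Function.bijective_iff_has_inverse.2 ⟨HoClass.precomp e.inv K, fun x => ?_, fun x => ?_⟩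
  · change (HoClass.precomp e.inv K ∘ HoClass.precomp e.hom K) x = x
    rw [← HoClass.precomp_comp, e.inv_hom_id, HoClass.precomp_id, id]
  · change (HoClass.precomp e.hom K ∘ HoClass.precomp e.inv K) x = x
    rw [← HoClass.precomp_comp, e.hom_inv_id, HoClass.precomp_id, id]

end IsKanWeakEquivalence

/-- Homotopies as maps into a path object: in this form they glue over a coproduct by its universal
property. -/
lemma homotopic_iff_path (f g : X ⟶ K) :
    Homotopic f g ↔ ∃ p : X ⟶ path K, p ≫ ι₀ ≫ pathEv K = f ∧ p ≫ ι₁ ≫ pathEv K = g := by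
  constructor
  · rintro ⟨h, rfl, rfl⟩
    refine ⟨pathLift h, ?_, ?_⟩
    · rw [← ι₀_comp_assoc, pathLift_whiskerRight_ev]
    · rw [← ι₁_comp_assoc, pathLift_whiskerRight_ev]
  · rintro ⟨p, rfl, rfl⟩
    exact ⟨p ▷ Δ[1] ≫ pathEv K, ι₀_comp_assoc _ _, ι₁_comp_assoc _ _⟩

lemma homotopic_sigma_iff {J : Type} {X : J → SSet.{0}} (f g : (∐ X) ⟶ K) :
    Homotopic f g ↔ ∀ j, Homotopic (Limits.Sigma.ι X j ≫ f) (Limits.Sigma.ι X j ≫ g) := by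
  refine ⟨fun h j => h.comp_left _, fun h => ?_⟩
  choose p hp₀ hp₁ using fun j => (homotopic_iff_path _ _).1 (h j)
  refine (homotopic_iff_path _ _).2 ⟨Limits.Sigma.desc p, Limits.Sigma.hom_ext _ _ fun j => ?_,
    Limits.Sigma.hom_ext _ _ fun j => ?_⟩
  · rw [Limits.Sigma.ι_desc_assoc, hp₀]
  · rw [Limits.Sigma.ι_desc_assoc, hp₁]

lemma IsKanWeakEquivalence.sigmaMap {J : Type} {X Y : J → SSet.{0}} {f : ∀ j, X j ⟶ Y j}
    (hf : ∀ j, IsKanWeakEquivalence (f j)) : IsKanWeakEquivalence (Limits.Sigma.map f) := by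
  intro K _
  refine (bijective_precomp_iff _).2 ⟨fun g h H => (homotopic_sigma_iff _ _).2 fun j => ?_,
    fun g => ?_⟩
  · refine ((bijective_precomp_iff (f j)).1 (hf j K inferInstance)).1 _ _ ?_
    have := (homotopic_sigma_iff _ _).1 H j
    rwa [Limits.Sigma.ι_map_assoc, Limits.Sigma.ι_map_assoc] at this
  · choose h hh using fun j => ((bijective_precomp_iff (f j)).1 (hf j K inferInstance)).2
      (Limits.Sigma.ι X j ≫ g)
    refine ⟨Limits.Sigma.desc h, (homotopic_sigma_iff _ _).2 fun j => ?_⟩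
    rw [Limits.Sigma.ι_map_assoc, Limits.Sigma.ι_desc]
    exact hh j

/-- The classifying space of a nontrivial group is not contractible. -/
lemma eq_one_of_homotopic_const {G : Type} [Group G] (c : point ⟶ classifyingSpace G)
    (h : Homotopic ((classifyingSpace G).toPoint ≫ c) (𝟙 (classifyingSpace G))) (g : G) :
    g = 1 := by
  obtain ⟨h, h₀, h₁⟩ := h
  let E (v : (classifyingSpace G ⊗ Δ[1] : SSet.{0}).obj (op ⦋1⦌)) : G :=
    edgeLabel (k := op ⦋1⦌) (h.app _ v) (Fin.zero_le (1 : Fin 2))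
  let tri (u : Fin 3 → G) (t : Fin 3 →o Fin 2) :
      (classifyingSpace G ⊗ Δ[1] : SSet.{0}).obj (op ⦋2⦌) :=
    ⟨classifyingSpaceMk (k := op ⦋2⦌) u, stdMk (k := op ⦋2⦌) t⟩
  let edge (u : Fin 2 → G) (t : Fin 2 →o Fin 2) :
      (classifyingSpace G ⊗ Δ[1] : SSet.{0}).obj (op ⦋1⦌) :=
    ⟨classifyingSpaceMk (k := op ⦋1⦌) u, stdMk (k := op ⦋1⦌) t⟩
  have key (u : Fin 3 → G) (t : Fin 3 →o Fin 2) (f : Fin 2 →o Fin 3) :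
      E (edge (u ∘ f) (t.comp f)) = edgeLabel (k := op ⦋2⦌) (h.app _ (tri u t))
        (f.monotone (Fin.zero_le (1 : Fin 2))) := by
    refine Eq.trans (congrArg E ?_)
      (congrArg (fun y => edgeLabel (k := op ⦋1⦌) y (Fin.zero_le (1 : Fin 2)))
        (NatTrans.naturality_apply h (opMk (k := op ⦋2⦌) (l := op ⦋1⦌) f) (tri u t)))
    exact Prod.ext (classifyingSpace_ext fun a b h => rfl) rfl
  have comp (u : Fin 3 → G) (t : Fin 3 →o Fin 2) {t₀ t₁ t₂ : Fin 2 →o Fin 2}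
      (h₀ : t.comp ⟨![1, 2], by decide⟩ = t₀) (h₁ : t.comp ⟨![0, 2], by decide⟩ = t₁)
      (h₂ : t.comp ⟨![0, 1], by decide⟩ = t₂) :
      E (edge ![u 0, u 2] t₁) = E (edge ![u 1, u 2] t₀) * E (edge ![u 0, u 1] t₂) := by
    have hu (a b : Fin 3) : ![u a, u b] = u ∘ ![a, b] := by
      funext i; fin_cases i <;> rfl
    rw [hu, hu, hu, ← h₀, ← h₁, ← h₂]
    refine (key u t ⟨![0, 2], by decide⟩).trans (Eq.trans ?_ (congrArg₂ (· * ·)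
      (key u t ⟨![1, 2], by decide⟩) (key u t ⟨![0, 1], by decide⟩)).symm)
    exact edgeLabel_trans (k := op ⦋2⦌) _ (a := (0 : Fin 3)) (b := (1 : Fin 3)) (c := (2 : Fin 3))
      (by decide) (by decide)
  have e₀ (u : Fin 2 → G) : E (edge u (OrderHom.const _ 0)) = 1 := by
    have := congr_app_apply h₀ (classifyingSpaceMk (k := op ⦋1⦌) u)
    refine (congrArg (fun y => edgeLabel (k := op ⦋1⦌) y (Fin.zero_le (1 : Fin 2))) this).trans ?_
    have hc : c.app (op ⦋1⦌) PUnit.unit =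
        (classifyingSpace G).map (opMk (k := op ⦋0⦌) (l := op ⦋1⦌) (OrderHom.const _ 0))
          (c.app (op ⦋0⦌) PUnit.unit) :=
      NatTrans.naturality_apply c (opMk (k := op ⦋0⦌) (l := op ⦋1⦌) (OrderHom.const _ 0)) PUnit.unit
    refine (congrArg (fun y => edgeLabel (k := op ⦋1⦌) y (Fin.zero_le (1 : Fin 2))) hc).trans ?_
    exact edgeLabel_refl (k := op ⦋0⦌) (c.app (op ⦋0⦌) PUnit.unit) 0
  have e₁ (u : Fin 2 → G) : E (edge u (OrderHom.const _ 1)) = (u 1)⁻¹ * u 0 :=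
    congrArg (fun y => edgeLabel (k := op ⦋1⦌) y (Fin.zero_le (1 : Fin 2)))
      (congr_app_apply h₁ (classifyingSpaceMk (k := op ⦋1⦌) u))
  -- `BG` has a single vertex, so the two vertical edges of the square below coincide.
  have hv : edge ![1, 1] OrderHom.id = edge ![g, g] OrderHom.id :=
    Prod.ext (classifyingSpace_ext fun a b h => by
      rw [edgeLabel_mk, edgeLabel_mk]
      fin_cases a <;> fin_cases b <;> simp) rfl
  -- The two triangles of the square (edge labelled `g`) × `Δ[1]` compute its diagonal. One gives
  -- the vertical label times `1`, the other gives `g` times the vertical label.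
  have t₁ : E (edge ![g, 1] OrderHom.id) =
      E (edge ![1, 1] OrderHom.id) * E (edge ![g, 1] (OrderHom.const _ 0)) :=
    comp ![g, 1, 1] ⟨![0, 0, 1], by decide⟩ (by decide) (by decide) (by decide)
  have t₂ : E (edge ![g, 1] OrderHom.id) =
      E (edge ![g, 1] (OrderHom.const _ 1)) * E (edge ![g, g] OrderHom.id) :=
    comp ![g, g, 1] ⟨![0, 1, 1], by decide⟩ (by decide) (by decide) (by decide)
  rw [e₀, mul_one, hv] at t₁
  rw [e₁, t₁] at t₂
  simpa using right_eq_mul.1 t₂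

/-- Otherwise the identity of the summand `BΣ₂` would factor through a point up to homotopy, which
the transposition forbids. -/
lemma not_isKanWeakEquivalence_sigmaMap_toPoint :
    ¬ IsKanWeakEquivalence (Limits.Sigma.map fun j : ℕ =>
      (classifyingSpace (Equiv.Perm (Fin j))).toPoint) := by
  intro H
  let K := classifyingSpace (Equiv.Perm (Fin 2))
  let v : point ⟶ K :=
    { app := fun k => TypeCat.ofHom fun _ => classifyingSpaceMk fun _ => 1 }
  -- Only the summand `j = 2` matters; the others are sent to a base point.
  let F (j : ℕ) : classifyingSpace (Equiv.Perm (Fin j)) ⟶ K :=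
    if h : j = 2 then eqToHom (by rw [h]) else toPoint _ ≫ v
  obtain ⟨h, hh⟩ := ((bijective_precomp_iff _).1 (H K inferInstance)).2 (Limits.Sigma.desc F)
  have := (homotopic_sigma_iff _ _).1 hh 2
  rw [Limits.Sigma.ι_map_assoc, Limits.Sigma.ι_desc] at this
  have := eq_one_of_homotopic_const (Limits.Sigma.ι (fun _ : ℕ => point) 2 ≫ h) this
    (Equiv.swap 0 1)
  exact absurd this (by decide)

end SSet

namespace SSet

open Simplicial Opposite

/-! ### Trivial fibrations are surjective on vertices -/

/-- The vertices of a simplex. -/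
abbrev vertex {X : SSet.{0}} {k : SimplexCategoryᵒᵖ} (x : X.obj k) (a : Fin (k.unop.len + 1)) :
    X.obj (op ⦋0⦌) :=
  X.map (opMk (k := k) (l := op ⦋0⦌) (OrderHom.const _ a)) x

lemma eq_const_of_mem_horn {i : Fin 2} {k : SimplexCategoryᵒᵖ}
    {t : (Δ[1] : SSet.{0}).obj k} (ht : t ∈ Λ[1, i].obj k) :
    t = stdMk (k := k) (OrderHom.const _ i) := by
  refine std_ext fun a => ?_
  change stdSimplex.asOrderHom (n := 1) t a = i
  by_contra h
  rw [mem_horn_iff] at ht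
  refine ht (Set.eq_univ_of_univ_subset fun j _ => ?_)
  obtain rfl | hj := eq_or_ne j i
  · exact Or.inr rfl
  · exact Or.inl ⟨a, by omega⟩

lemma exists_lift_of_edge {X Y : SSet.{0}} {p : X ⟶ Y} (hp : modelCategoryQuillen.J.rlp p)
    (e : Y.obj (op ⦋1⦌)) (i j : Fin 2) {x : X.obj (op ⦋0⦌)}
    (hx : p.app _ x = vertex (k := op ⦋1⦌) e i) :
    ∃ y, p.app _ y = vertex (k := op ⦋1⦌) e j := by
  have := hp _ (modelCategoryQuillen.horn_ι_mem_J 1 i)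
  have sq : CommSq (const x) Λ[1, i].ι p (yonedaEquiv.symm e) :=
    ⟨hom_ext_apply fun k ⟨t, ht⟩ => by
    obtain rfl := eq_const_of_mem_horn ht
    refine (NatTrans.naturality_apply p _ x).trans ?_
    rw [hx]
    exact (Functor.map_comp_apply _ _ _ _).symm⟩
  exact ⟨sq.lift.app _ (stdMk (k := op ⦋0⦌) (OrderHom.const _ j)),
    congr_app_apply sq.fac_right (stdMk (k := op ⦋0⦌) (OrderHom.const _ j))⟩

/-- Lifting along horns of dimension one makes the image on vertices stable under moving along edges
in either direction. So it is classified by a map to a discrete simplicial set. That map agrees with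
the constant `True` after composition with `p`, hence before. -/
lemma surjective_vertices {X Y : SSet.{0}} {p : X ⟶ Y} (hp : modelCategoryQuillen.J.rlp p)
    (hw : IsKanWeakEquivalence p) : Function.Surjective (p.app (op ⦋0⦌)) := by
  let U (y : Y.obj (op ⦋0⦌)) : Prop := ∃ x, p.app _ x = y
  have hU {k} (y : Y.obj k) (a b : Fin (k.unop.len + 1)) (hab : a ≤ b) :
      U (vertex y a) ↔ U (vertex y b) := by
    let e : Y.obj (op ⦋1⦌) := Y.map (opMk (k := k) (l := op ⦋1⦌) ⟨![a, b], by
      intro i j h; fin_cases i <;> fin_cases j <;> simp_all⟩) y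
    have he (i : Fin 2) : vertex (k := op ⦋1⦌) e i = vertex y (![a, b] i) :=
      (Functor.map_comp_apply _ _ _ _).symm
    have h₀ := he 0
    have h₁ := he 1
    change _ = vertex y a at h₀
    change _ = vertex y b at h₁
    rw [← h₀, ← h₁]
    exact ⟨fun ⟨x, hx⟩ => exists_lift_of_edge hp e 0 1 hx,
      fun ⟨x, hx⟩ => exists_lift_of_edge hp e 1 0 hx⟩
  -- Any vertex of a simplex could be used, by `hU`; this is also what gives naturality.
  let χ : Y ⟶ discrete Prop :=
    { app := fun k => TypeCat.ofHom fun y => U (vertex y 0)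
      naturality := fun k l φ => by
        ext y
        refine propext ?_
        change U (vertex (Y.map φ y) 0) ↔ U (vertex y 0)
        have : vertex (Y.map φ y) 0 = vertex y (φ.unop.toOrderHom 0) :=
          (Functor.map_comp_apply _ _ _ _).symm
        rw [this]
        exact (hU y _ _ (Fin.zero_le _)).symm }
  let τ : Y ⟶ discrete Prop := { app := fun k => TypeCat.ofHom fun _ => True }
  have h : p ≫ χ = p ≫ τ := hom_ext_apply fun k x =>
    eq_true ⟨vertex x 0, NatTrans.naturality_apply p _ x⟩
  have h' : Homotopic χ τ := ((bijective_precomp_iff p).1 (hw _ inferInstance)).1 _ _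
    (h ▸ Homotopic.refl _)
  intro y
  have hy : U (vertex (k := op ⦋0⦌) y 0) := of_eq_true (congr_app_apply h'.eq_of_discrete y)
  have : vertex (k := op ⦋0⦌) y 0 = y := by
    refine Eq.trans (congrArg (fun φ => Y.map φ y) (?_ : _ = 𝟙 (op ⦋0⦌)))
      (Functor.map_id_apply Y _ y)
    exact Quiver.Hom.unop_inj (by ext a; fin_cases a; rfl)
  rwa [this] at hy

/-- A simplicial set which deforms to a point is weakly contractible. -/
lemma isWeaklyContractible_of_homotopic {X : SSet.{0}} (s : point ⟶ X)
    (h : Homotopic (X.toPoint ≫ s) (𝟙 X)) : X.IsWeaklyContractible := fun K _ => by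
  refine (bijective_precomp_iff _).2 ⟨fun f g H => ?_, fun f => ⟨s ≫ f, h.comp_right f⟩⟩
  exact H.comp_left s

end SSet

/-! ### The cofibrations `∅ ⟶ ∅₊` and `A ⟶ A₊` -/

namespace SimplicialOperad

open Opposite Simplicial

/-- Since maps out of `∅` are unique, a lifting problem only asks for a preimage of the vertex of
`Y(0)` given by a map `∅₊ ⟶ Y`. -/
instance cofibration_inclusion : Cofibration inclusion := by
  rw [cofibration_iff]
  intro X Y p hp
  refine ⟨fun {f g} sq => ?_⟩
  obtain ⟨x, hx⟩ := SSet.surjective_vertices (hp.1 0) (hp.2 0)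
    ((Hom.app g 0).app (op ⦋0⦌) (emptyPlusPoint _))
  let β (k : SimplexCategoryᵒᵖ) : (X.obj 0).obj k :=
    (X.obj 0).map (SSet.opMk (k := op ⦋0⦌) (l := k) (OrderHom.const _ 0)) x
  have hβ {k l} (φ : k ⟶ l) : (X.obj 0).map φ (β k) = β l :=
    (Functor.map_comp_apply _ _ _ _).symm
  refine ⟨⟨{ l := X.emptyPlusHom β hβ, fac_left := empty_hom_ext, fac_right :=
    emptyPlus_hom_ext fun k => ?_ }⟩⟩
  refine (NatTrans.naturality_apply (Hom.app p 0) _ x).trans ?_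
  rw [hx]
  exact map_emptyPlusPoint g _

lemma cofibration_of_isPushout {A A' : SimplicialOperad} {u : empty ⟶ A} {q : emptyPlus ⟶ A'}
    {η : A ⟶ A'} (h : IsPushout inclusion u q η) : Cofibration η := by
  have hi := (cofibration_iff _).1 cofibration_inclusion
  refine (cofibration_iff _).2 ?_
  exact MorphismProperty.of_isPushout (P := (trivialFibrations SimplicialOperad).llp) h.flip hi

end SimplicialOperad

/-! ### An `E∞`-operad -/

/-- The monad of families of lists. -/
abbrev ContentMonad.lists (I : Type) : ContentMonad where
  M X := I → List X
  pure x := fun _ => [x]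
  bind t f := fun i => (t i).flatMap fun x => f x i
  pure_bind x f := funext fun i => by simp
  bind_pure t := funext fun i => by simp
  bind_assoc t f g := funext fun i => by simp [List.flatMap_assoc]
  κ := I
  content t c := ↑(t c)
  content_pure _ _ := rfl
  content_bind t f c := by simp

lemma ContentMonad.lists_map {I X Y : Type} (f : X → Y) (t : I → List X) :
    (ContentMonad.lists I).map f t = fun i => (t i).map f :=
  funext fun _ => List.map_eq_flatMap.symm

/-- Reindexing families of lists. -/
def ContentMonad.listsHom {I J : Type} (φ : J → I) :
    ContentMonad.Hom (ContentMonad.lists I) (ContentMonad.lists J) where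
  app t := fun j => t (φ j)
  app_pure _ := rfl
  app_bind _ _ := rfl
  linear_app h c := h (φ c)

namespace SimplicialOperad

open Opposite Simplicial SSet MonoidalCategory

/-- The Barratt–Eccles operad: a simplex of arity `n` is a family of orderings of `Fin n`. -/
def barrattEccles : SimplicialOperad :=
  ofLevels (fun k => (ContentMonad.lists (Fin (k.unop.len + 1))).operad)
    (fun φ => (ContentMonad.listsHom fun a => φ.unop.toOrderHom a).operad)
    (fun _ _ _ => rfl) (fun _ _ _ _ => rfl)

/-- The vertex of the Barratt–Eccles operad given by the standard ordering. -/
def barrattEcclesPoint (n : ℕ) : point ⟶ barrattEccles.obj n where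
  app k := TypeCat.ofHom fun _ => ⟨fun _ => List.finRange n, fun _ => rfl⟩

/-- A simplex is an arbitrary family of vertices, so a contraction onto the standard ordering may be
prescribed vertex by vertex. A permutation fixing an ordering of `Fin n` fixes each of its entries.
-/
lemma isEInfinity_barrattEccles : barrattEccles.IsEInfinity where
  contractible n := by
    refine isWeaklyContractible_of_homotopic (barrattEcclesPoint n) ⟨?_, ?_, ?_⟩
    · exact
        { app := fun k => TypeCat.ofHom fun v => ⟨fun a =>
            if stdSimplex.asOrderHom (n := 1) v.2 a = 0 then List.finRange n else v.1.1 a,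
            fun c => by
              change ((if stdSimplex.asOrderHom (n := 1) v.2 c = 0 then List.finRange n
                else v.1.1 c : List (Fin n)) : Multiset (Fin n)) = _
              split_ifs
              · rfl
              · exact v.1.2 c⟩ }
    · refine hom_ext_apply fun k x => Subtype.ext (funext fun a => ?_)
      exact if_pos (e := x.1 a) (Eq.refl (0 : Fin 2))
    · refine hom_ext_apply fun k x => Subtype.ext (funext fun a => ?_)
      exact if_neg (t := List.finRange n) (one_ne_zero (α := Fin 2))
  free n k σ x h := by
    have h₁ : (x.1 0).map σ = x.1 0 :=
      (congrFun (ContentMonad.lists_map σ x.1) 0).symm.trans (congrFun (congrArg Subtype.val h) 0)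
    refine Equiv.ext fun i => ?_
    have hi : i ∈ x.1 0 := by
      have := x.2 0
      change ((x.1 0 : List (Fin n)) : Multiset (Fin n)) = _ at this
      rw [← Multiset.mem_coe, this]
      exact Finset.mem_univ_val i
    exact List.map_inj_left.1 (h₁.trans (List.map_id _).symm) i hi

end SimplicialOperad

/-! ### The cobase change of `A ⟶ Com` and the failure of left properness -/

namespace SimplicialOperad

open Opposite SSet

variable {A : SimplicialOperad}

/-- The projection to the orbits. -/
def toOrbits (A : SimplicialOperad) (j : ℕ) : A.obj j ⟶ A.orbits j where
  app _ := TypeCat.ofHom fun x => Quot.mk _ x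
  naturality _ _ _ := rfl

lemma isAction_act (A : SimplicialOperad) (j : ℕ) :
    IsAction fun σ : Equiv.Perm (Fin j) => A.act σ where
  one := A.act_refl j
  mul σ τ := A.act_trans τ σ

lemma isOrbitMap_toOrbits (A : SimplicialOperad) (j : ℕ) :
    IsOrbitMap (fun σ : Equiv.Perm (Fin j) => A.act σ) (A.toOrbits j) where
  surjective _ x := Quot.exists_rep x
  invariant σ := hom_ext_apply fun _ _ => (Quot.sound ⟨σ, rfl⟩).symm
  exists_of_eq h := ((A.isAction_act j).orbitMk_eq_iff _ _).1 h

/-- `A(j)` is contractible and free, so an equivariant map to `EΣⱼ` induces a weak equivalence on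
quotients. -/
lemma IsEInfinity.exists_isKanWeakEquivalence_orbits (hA : A.IsEInfinity) (j : ℕ) :
    ∃ w : A.orbits j ⟶ classifyingSpace (Equiv.Perm (Fin j)), IsKanWeakEquivalence w := by
  obtain ⟨c, hc⟩ := exists_map_to_universal (A.isAction_act j) fun σ k x => hA.free j k σ x
  have hπ := A.isOrbitMap_toOrbits j
  obtain ⟨w, hw⟩ := hπ.exists_desc (c ≫ universalBundle _) fun σ => by
    rw [reassoc_of% hc σ, isOrbitMap_universalBundle.invariant]
  exact ⟨w, isKanWeakEquivalence_of_free (hA.contractible j) (A.isAction_act j) hπ hc hw⟩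

/-- The commutative operad has a point in each arity. -/
def commObjIso (n : ℕ) : comm.obj n ≅ point where
  hom := toPoint _
  inv := { app := fun _ => TypeCat.ofHom fun _ => ⟨trivial⟩ }
  hom_inv_id := rfl
  inv_hom_id := rfl

/-- The orbits of the commutative operad are points. -/
def commOrbitsIso (j : ℕ) : comm.orbits j ≅ point where
  hom := toPoint _
  inv := (commObjIso j).inv ≫ comm.toOrbits j
  hom_inv_id := (comm.isOrbitMap_toOrbits j).cancel rfl
  inv_hom_id := rfl

lemma IsEInfinity.weakEquivalence_toComm (hA : A.IsEInfinity) : WeakEquivalence A.toComm := by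
  refine (weakEquivalence_iff _).2 fun n => ?_
  have h : Hom.app A.toComm n = (A.obj n).toPoint ≫ (commObjIso n).inv := rfl
  rw [h]
  exact (hA.contractible n).comp (.of_iso (commObjIso n).symm)

/-- The cobase change of `A ⟶ Com` in arity zero. -/
lemma IsEInfinity.exists_cobaseChange (hA : A.IsEInfinity) {A' B' : SimplicialOperad}
    {u : empty ⟶ A} {q : emptyPlus ⟶ A'} {η : A ⟶ A'} {f' : A' ⟶ B'} {θ : comm ⟶ B'}
    (h : IsPushout inclusion u q η) (h' : IsPushout η A.toComm f' θ) :
    ∃ (w : A'.obj 0 ⟶ ∐ fun j : ℕ => classifyingSpace (Equiv.Perm (Fin j)))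
      (e : B'.obj 0 ≅ ∐ fun _ : ℕ => point), IsKanWeakEquivalence w ∧
        Hom.app f' 0 ≫ e.hom = w ≫ Limits.Sigma.map fun j : ℕ =>
          (classifyingSpace (Equiv.Perm (Fin j))).toPoint := by
  choose w hw using hA.exists_isKanWeakEquivalence_orbits
  -- By pasting, `B'` is `Com` with a point freely added, so the description of nullary operations
  -- as orbits applies to both ends of `f'`.
  have h'' : IsPushout inclusion (u ≫ A.toComm) (q ≫ f') θ := h.paste_vert h'
  refine ⟨(sigmaOrbitsIso h).inv ≫ Limits.Sigma.map w,
    (sigmaOrbitsIso h'').symm ≪≫ Limits.Sigma.mapIso fun j => commOrbitsIso j,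
    .comp (.of_iso (sigmaOrbitsIso h).symm) (.sigmaMap hw), ?_⟩
  rw [← cancel_epi (sigmaOrbitsIso h).hom, Category.assoc, Iso.hom_inv_id_assoc,
    ← Category.assoc, sigmaOrbitsIso_hom_comp h h'' A.toComm f' h'.w rfl]
  refine Limits.Sigma.hom_ext _ _ fun j => ?_
  simp
  rfl

lemma not_isKanWeakEquivalence_of_comp_eq {X Y : SSet.{0}} {f : X ⟶ Y}
    {w : X ⟶ ∐ fun j : ℕ => classifyingSpace (Equiv.Perm (Fin j))}
    {e : Y ≅ ∐ fun _ : ℕ => point} (hw : IsKanWeakEquivalence w)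
    (h : f ≫ e.hom = w ≫ Limits.Sigma.map fun j : ℕ =>
      (classifyingSpace (Equiv.Perm (Fin j))).toPoint) : ¬ IsKanWeakEquivalence f := fun hf =>
  not_isKanWeakEquivalence_sigmaMap_toPoint (hw.of_comp (h ▸ hf.comp (.of_iso e)))

lemma IsEInfinity.not_isLeftProper (hA : A.IsEInfinity) : ¬ IsLeftProper SimplicialOperad := by
  intro H
  let u := emptyHom A
  have h := isPushout_plus A u
  have h' : IsPushout A.toPlus A.toComm (plusDesc (A.toComm ≫ comm.toPlus) comm.plusPoint)
      comm.toPlus := by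
    -- The outer square exhibits `Com₊` and the upper one `A₊`, so the lower square is the cobase
    -- change sought.
    refine IsPushout.of_top ?_ (toPlus_plusDesc _ _) h
    rw [plusPoint_plusDesc]
    exact isPushout_plus comm (u ≫ A.toComm)
  have hf := H _ _ _ _ h' (cofibration_of_isPushout h) hA.weakEquivalence_toComm
  obtain ⟨w, e, hw, he⟩ := hA.exists_cobaseChange h h'
  exact not_isKanWeakEquivalence_of_comp_eq hw he ((weakEquivalence_iff _).1 hf 0)

end SimplicialOperad

open SimplicialOperad in
theorem mainTheorem2 :
    -- `∅` is the initial operad, and `i : ∅ ⟶ ∅₊` is a cofibration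
    Nonempty (IsInitial SimplicialOperad.empty) ∧
    Cofibration inclusion ∧
    -- the pushout `A'` of `i` along `∅ ⟶ A` exists for every operad `A`
    (∀ (A : SimplicialOperad) (u : SimplicialOperad.empty ⟶ A), HasPushout inclusion u) ∧
    -- the map `A ⟶ A'` is a cofibration, and `A'(0)` is the coproduct of the `A(j)/Σⱼ`,
    -- an orbit `[a]` being sent to `γ(a; *, …, *)`
    (∀ (A A' : SimplicialOperad) (u : SimplicialOperad.empty ⟶ A) (q : emptyPlus ⟶ A')
      (η : A ⟶ A'), IsPushout inclusion u q η →
        Cofibration η ∧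
        ∃ e : (∐ fun j : ℕ => A.orbits j) ≅ A'.obj 0,
          ∀ (j : ℕ) (k : SimplexCategoryᵒᵖ) (a : (A.obj j).obj k),
            e.hom.app k ((Sigma.ι (fun j : ℕ => A.orbits j) j).app k (Quot.mk _ a)) =
              (A'.act (OperadBijections.zero j)).app k
                (A'.comp ((η.app j).app k a) (fun _ => (q.app 0).app k (emptyPlusPoint k)))) ∧
    -- `E∞`-operads exist
    (∃ A : SimplicialOperad, A.IsEInfinity) ∧
    -- for an `E∞`-operad `A`, the map `f : A ⟶ Com` is a weak equivalence; its cobase change `f'`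
    -- along `A ⟶ A'` is, in arity `0`, the map `∐ BΣⱼ ⟶ ∐ *`, and not a weak equivalence
    (∀ A : SimplicialOperad, A.IsEInfinity →
      WeakEquivalence A.toComm ∧
      ∀ (A' B' : SimplicialOperad) (u : SimplicialOperad.empty ⟶ A) (q : emptyPlus ⟶ A')
        (η : A ⟶ A') (f' : A' ⟶ B') (θ : comm ⟶ B'),
        IsPushout inclusion u q η → IsPushout η A.toComm f' θ →
          (∃ (w : A'.obj 0 ⟶ ∐ fun j : ℕ => SSet.classifyingSpace (Equiv.Perm (Fin j)))
            (e : B'.obj 0 ≅ ∐ fun _ : ℕ => SSet.point),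
            SSet.IsKanWeakEquivalence w ∧
            f'.app 0 ≫ e.hom = w ≫ Limits.Sigma.map fun j : ℕ =>
              (SSet.classifyingSpace (Equiv.Perm (Fin j))).toPoint) ∧
          ¬ SSet.IsKanWeakEquivalence (f'.app 0) ∧
          ¬ WeakEquivalence f') ∧
    -- hence the category of operads is not left proper
    ¬ IsLeftProper SimplicialOperad := by
  refine ⟨⟨emptyIsInitial⟩, cofibration_inclusion, fun A u => (isPushout_plus A u).hasPushout,
    fun A A' u q η h => ⟨cofibration_of_isPushout h, sigmaOrbitsIso h, fun j k a => ?_⟩,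
    ⟨barrattEccles, isEInfinity_barrattEccles⟩, fun A hA => ⟨hA.weakEquivalence_toComm,
      fun A' B' u q η f' θ h h' => ?_⟩, isEInfinity_barrattEccles.not_isLeftProper⟩
  · exact SSet.congr_app_apply (ι_sigmaOrbitsIso_hom h j) (Quot.mk _ a)
  · obtain ⟨w, e, hw, he⟩ := hA.exists_cobaseChange h h'
    have hf := not_isKanWeakEquivalence_of_comp_eq hw he
    exact ⟨⟨w, e, hw, he⟩, hf, fun H => hf ((weakEquivalence_iff _).1 H 0)⟩
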